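/- Let $(R,\mathfrak m)$ be a Noetherian local ring, let $A=\bigoplus_{n\ge 0}A_n$ be a standard graded Noetherian $R$-algebra (generated over $R$ by $A_1$, with $A_0$ the image of $R$), and let $I\subseteq A$ be an ideal generated by elements of degree one. For a finitely generated graded $A$-module $M=\bigoplus_{n\ge 0}M_n$ give the associated graded module $G_I(M)=\bigoplus_{i\ge 0} I^iM/I^{i+1}M$ over $G_I(A)$ its internal grading $[G_I(M)]_n=\bigoplus_{i\ge0}[I^iM/I^{i+1}M]_n$, and put $$h^*_{(I,M)}(s,n)=\ell_R\!\left(\frac{\mathfrak m^s[G_I(M)]_n}{\mathfrak m^{s+1}[G_I(M)]_n}\right),\qquad h^{*\,(1,0)}_{(I,M)}(s,n)=\sum_{u=0}^{s}h^*_{(I,M)}(u,n),$$ that is, the Hilbert function of the bigraded module $G_{\mathfrak m}(G_I(M))$ and its sum transform in the first variable. For an integer $D\ge\dim M$ and $0\le k\le D-1$, let $c^*_{k,D}(I,M)=0$ if $\dim G_I(M)<D$, and otherwise let $c^*_{k,D}(I,M)$ be the coefficient $a_{k,D-1-k}$ in the expansion $\sum_{k,l\ge 0}a_{k,l}\binom{s+k}{k}\binom{n+l}{l}$,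 $a_{k,l}\in\mathbb Z$, of the polynomial that equals $h^{*\,(1,0)}_{(I,M)}(s,n)$ for $s,n\gg0$. **Theorem 3.1 (Additivity).** Let $0\to M_0\to M_1\to M_2\to 0$ be an exact sequence of finitely generated graded $A$-modules with degree-preserving maps, and let $D\ge 0$ be an integer with $D\ge\dim M_1$. Then for $j=0,1,2$ the function $h^{*\,(1,0)}_{(I,M_j)}(s,n)$ is finite and, for $s,n\gg0$, equal to a polynomial $P_j(s,n)=\sum_{k+l\le D-1}a^{(j)}_{k,l}\binom{s+k}{k}\binom{n+l}{l}$ with $a^{(j)}_{k,l}\in\mathbb Z$, and the polynomial $$P_0+P_2-P_1$$ has total degree at most $D-2$ (it is zero if $D\le 1$). In particular, for all $k=0,\dots,D-1$, $$c^*_{k,D}(I,M_1)=c^*_{k,D}(I,M_0)+c^*_{k,D}(I,M_2).$$ -/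

import Mathlib

open scoped BigOperators

noncomputable section

namespace LinearFormMultiplicity

/-! ## Standard graded algebras -/

/-- `A = ⨁ 𝒜 n` is generated, as an algebra over `R`, by its component of degree one
(so that `𝒜 0` is the image of `R`).  Finite generation of `𝒜 1` is automatic as soon as `A` is
Noetherian. -/
def IsStandardGraded (R : Type*) {A : Type*} [CommRing R] [CommRing A] [Algebra R A]
    (𝒜 : ℕ → Submodule R A) : Prop :=
  Algebra.adjoin R (𝒜 1 : Set A) = ⊤

/-- The ideal `I` is generated by linear forms, i.e. by homogeneous elements of degree one. -/
def IsGeneratedByLinearForms {R A : Type*} [CommRing R] [CommRing A] [Algebra R A]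
    (𝒜 : ℕ → Submodule R A) (I : Ideal A) : Prop :=
  ∃ V : Set A, V ⊆ (𝒜 1 : Set A) ∧ I = Ideal.span V

/-! ## Numerical functions of two variables and their polynomials -/

/-- The sum transform with respect to the first variable,
`h^{(1,0)}(s, n) = ∑_{u = 0}^{s} h(u, n)`. -/
def sumTransform (h : ℕ → ℕ → ℕ∞) : ℕ → ℕ → ℕ∞ :=
  fun s n => ∑ u ∈ Finset.range (s + 1), h u n

/-- The function `h` is finite and equal to the polynomial `P` for `s, n ≫ 0`. -/
def IsHilbertPolynomial (h : ℕ → ℕ → ℕ∞) (P : MvPolynomial (Fin 2) ℚ) : Prop :=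
  ∃ n₀ : ℕ, ∀ s n : ℕ, n₀ ≤ s → n₀ ≤ n →
    ∃ c : ℕ, h s n = (c : ℕ∞) ∧ (c : ℚ) = MvPolynomial.eval ![(s : ℚ), (n : ℚ)] P

/-- The polynomial `binom (x + k) k = (x + 1) ⋯ (x + k) / k!` in the variable `x = X v`. -/
def binomialFactor (v : Fin 2) (k : ℕ) : MvPolynomial (Fin 2) ℚ :=
  MvPolynomial.C ((k.factorial : ℚ)⁻¹) *
    ∏ r ∈ Finset.range k, (MvPolynomial.X v + MvPolynomial.C ((r : ℚ) + 1))

/-- The polynomial `∑_{k,l} a_{k,l} binom (i + k) k · binom (j + l) l`. -/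
def binomialPolynomial (a : ℕ × ℕ →₀ ℤ) : MvPolynomial (Fin 2) ℚ :=
  ∑ p ∈ a.support,
    MvPolynomial.C ((a p : ℤ) : ℚ) * (binomialFactor 0 p.1 * binomialFactor 1 p.2)

open Classical in
/-- The coefficient `a_{k,l}` in the binomial expansion of the polynomial that agrees with `h`
for large arguments (`0` by convention if there is no such expansion; the expansion is
unique when it exists). -/
def hilbertCoeff (h : ℕ → ℕ → ℕ∞) (k l : ℕ) : ℤ :=
  if H : ∃ a : ℕ × ℕ →₀ ℤ, IsHilbertPolynomial h (binomialPolynomial a) then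
    H.choose (k, l)
  else 0

/-- The polynomial `P` has degree at most `d`; for negative `d` this means `P = 0`. -/
def HasDegreeAtMost (P : MvPolynomial (Fin 2) ℚ) (d : ℤ) : Prop :=
  P = 0 ∨ (P.totalDegree : ℤ) ≤ d

/-! ## The bigraded module `G_𝔪(N)` and the `c^D`-multiplicity sequence -/

section Bigraded

variable {R : Type*} [CommRing R] [IsLocalRing R] {N : Type*} [AddCommGroup N] [Module R N]

/-- The component of bidegree `(s, n)` of `G_𝔪(N) = ⨁_{s,n} 𝔪^s N_n / 𝔪^{s+1} N_n`, for a graded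
module `N = ⨁ 𝒩 n` over a graded `R`-algebra, `𝔪` being the maximal ideal of `R`. -/
abbrev BigradedPiece (𝒩 : ℕ → Submodule R N) (s n : ℕ) : Type _ :=
  (↥((IsLocalRing.maximalIdeal R) ^ s • 𝒩 n)) ⧸
    ((IsLocalRing.maximalIdeal R) ^ (s + 1) • 𝒩 n).submoduleOf
      ((IsLocalRing.maximalIdeal R) ^ s • 𝒩 n)

/-- The Hilbert function of `G_𝔪(N)`.  The components are killed by `𝔪`, so that their length over
`R` is their length over the field `R ⧸ 𝔪`. -/
def hilbertFunction (𝒩 : ℕ → Submodule R N) (s n : ℕ) : ℕ∞ :=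
  Module.length R (BigradedPiece 𝒩 s n)

open Classical in
/-- The `c^D`-multiplicity sequence `c_k^D(N)`, `0 ≤ k ≤ D - 1`, of a finitely generated graded
`S`-module `N` with `dim N ≤ D`: it is `0` if `dim N < D`, and if `dim N = D` it is the coefficient
`a_{k,D-k-1}` of the polynomial of the sum transform of the Hilbert function of `G_𝔪(N)`. -/
def cMultiplicity (S : Type*) [CommRing S] [Module S N] (𝒩 : ℕ → Submodule R N) (D k : ℕ) : ℤ :=
  if Module.supportDim S N < (D : WithBot ℕ∞) then 0
  else hilbertCoeff (sumTransform (hilbertFunction 𝒩)) k (D - k - 1)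

end Bigraded

/-! ## The associated graded module `G_I(M)` with its internal grading -/

section AssociatedGraded

variable {A : Type*} [CommRing A] (I : Ideal A)

/-- The extension of `I` to the Rees algebra `⨁ I^i t^i`, that is `⨁ I^{i+1} t^i`. -/
abbrev reesExtension : Ideal (reesAlgebra I) := I.map (algebraMap A (reesAlgebra I))

/-- The associated graded ring `G_I(A) = ⨁ I^i / I^{i+1}`. -/
abbrev AssocGradedRing : Type _ := reesAlgebra I ⧸ reesExtension I

variable (M : Type*) [AddCommGroup M] [Module A M]

/-- The Rees module `⨁ I^i M t^i`, over the Rees algebra `⨁ I^i t^i`. -/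
def ReesModule : Type _ := ↥((I.stableFiltration (⊤ : Submodule A M)).submodule)

instance : AddCommGroup (ReesModule I M) :=
  inferInstanceAs (AddCommGroup ↥((I.stableFiltration (⊤ : Submodule A M)).submodule))

instance : Module (reesAlgebra I) (ReesModule I M) :=
  inferInstanceAs (Module (reesAlgebra I) ↥((I.stableFiltration (⊤ : Submodule A M)).submodule))

/-- The associated graded module `G_I(M) = ⨁ I^i M / I^{i+1} M`, a module over `G_I(A)`. -/
abbrev AssocGradedModule : Type _ :=
  ReesModule I M ⧸ (reesExtension I • (⊤ : Submodule (reesAlgebra I) (ReesModule I M)))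

variable {M} {R : Type*} [CommRing R] [Algebra R A] [Module R M] [IsScalarTower R A M]

instance : Module R (ReesModule I M) :=
  inferInstanceAs (Module R ↥((I.stableFiltration (⊤ : Submodule A M)).submodule))

instance : IsScalarTower R (reesAlgebra I) (ReesModule I M) :=
  inferInstanceAs
    (IsScalarTower R (reesAlgebra I) ↥((I.stableFiltration (⊤ : Submodule A M)).submodule))

/-- The coefficient of `t^i` of an element of the Rees module. -/
def ReesModule.coeff (x : ReesModule I M) (i : ℕ) : M := PolynomialModule.coeff x.1 i

/-- The component of degree `n` of the Rees module for the internal grading (`t` has degree zero):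
the elements `∑ x_i t^i` all of whose coefficients `x_i ∈ I^i M` are homogeneous of degree `n`. -/
def reesInternalPiece (ℳ : ℕ → Submodule R M) (n : ℕ) : Submodule R (ReesModule I M) where
  carrier := {x | ∀ i, ReesModule.coeff I x i ∈ ℳ n}
  zero_mem' := fun _ => (ℳ n).zero_mem
  add_mem' := fun hx hy i => (ℳ n).add_mem (hx i) (hy i)
  smul_mem' := fun r _ hx i => (ℳ n).smul_mem r (hx i)

/-- The component `[G_I(M)]_n = ⨁_i [I^i M / I^{i+1} M]_n` of the internal grading of `G_I(M)`. -/
def internalPiece (ℳ : ℕ → Submodule R M) (n : ℕ) : Submodule R (AssocGradedModule I M) :=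
  (reesInternalPiece I ℳ n).map
    ((reesExtension I • (⊤ : Submodule (reesAlgebra I) (ReesModule I M))).mkQ.restrictScalars R)

/-- The Hilbert function `h^*_{(I,M)}(s, n)` of the bigraded module `G_𝔪(G_I(M))`, where `G_I(M)`
carries the internal grading. -/
def hStar [IsLocalRing R] (ℳ : ℕ → Submodule R M) : ℕ → ℕ → ℕ∞ :=
  hilbertFunction (internalPiece I ℳ)

/-- The `c^*`-multiplicity sequence `c^*_{k,D}(I, M) = c^D_k(G_I(M))`. -/
def cStar [IsLocalRing R] (ℳ : ℕ → Submodule R M) (D k : ℕ) : ℤ :=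
  cMultiplicity (AssocGradedRing I) (internalPiece I ℳ) D k

end AssociatedGraded

end LinearFormMultiplicity

end

/-!
# Additivity of the `c^*`-multiplicities

For a graded module `N` over a standard graded algebra, the sum transform of the Hilbert function of
`G_𝔪(N)` at `(s, n)` is the length of `N_n / 𝔪^{s+1} N_n`.  The modules `N = G_I(M)` are quotients
`X / Y` of submodules of `M[t]` over the Rees algebra `S = ⨁ I^i t^i`.  As `I` is generated by linear
forms, `S` is generated over `R` by finitely many elements of internal degree one (`reesGrading`),
and all submodules that occur are homogeneous.  The length above is called `hilb X Y s n`.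

Three facts about `hilb` are used.

* It is a numerical polynomial for large arguments (`exists_hilb_eq_binomialEval`): its difference
  in `s` is the Hilbert function of a Noetherian bigraded module, and this is treated by induction on
  the number of generators acting on it (`exists_eq_binomialEval`).
* The degree of the polynomial is less than the dimension of `X / Y`
  (`supportedBelow_of_supportDim_le`): its sums over `n` are bounded by the Hilbert-Samuel function
  of the ideal generated by `𝔪` and the elements of degree one.
* It is additive on exact sequences up to terms of degree at most `D - 2`, where `D` bounds the
  dimension of the submodule (`growthAtMost_hilb_add_sub`): by the Artin-Rees lemma, the `𝔪`-adic
  filtration of the submodule and the filtration induced on it differ at most by a shift of `s`.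

The functor `G_I` is not exact.  If `N ⊆ M` and `F_i = I^i M ∩ N`, then `G_I(M / N)` is the quotient
of `G_I(M)` by the associated graded module of the filtration `F` of `N`, and it remains to compare
`F` with the `I`-adic filtration `E_i = I^i N` (`growthAtMost_hilb_induced_sub`).  Consider two
filtrations `F ≥ E` with `F_0 = E_0` and `F_{i+1} ⊆ E_i`, and write `F⁺`, `E⁺` for their shifts by
one.  The associated graded module `F / F⁺` is an extension of `F / E` by `E / F⁺`, and `E / E⁺` is
one of `E / F⁺` by `F⁺ / E⁺`.  Division by `t`, which does not change the internal degree,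
identifies `F / E` with `F⁺ / E⁺`.  Hence the two polynomials agree up to terms of degree at most `D - 2`.  The
filtrations `E_i + F_{i+j}` are consecutively of this kind; they start with `F` at `j = 0` and reach
`E` for large `j` by the Artin-Rees lemma for `I`.

All of this needs a bound by `D = dim M` for the dimensions over `S` of subquotients of `M[t]` that
are killed by `I`.  This is `supportDim_reesAlgebra_le`, which rests on the inequality
`dim S ≤ dim A + 1` for the Rees algebra of a nonzero ideal in a domain
(`ringKrullDim_reesAlgebra_le`).

Congruence up to terms of degree at most `D - 2` is expressed through the growth of the functions
(`GrowthAtMost`) and turned into a statement about coefficients by `GrowthAtMost.supportedBelow`.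
-/

open scoped BigOperators

noncomputable section

namespace LinearFormMultiplicity

/-! ### Lengths of subquotients -/

section Length

variable {R : Type*} [CommRing R] {P P' : Type*} [AddCommGroup P] [Module R P]
  [AddCommGroup P'] [Module R P']

/-- The length of the subquotient `B / (A ⊓ B)` of a module. -/
def qlen (B A : Submodule R P) : ℕ∞ := Module.length R (B ⧸ A.submoduleOf B)

lemma qlen_map (φ : P →ₗ[R] P') (B : Submodule R P) (A : Submodule R P') :
    qlen B (A.comap φ) = qlen (B.map φ ⊔ A) A := by
  let ψ : B →ₗ[R] (↥(B.map φ ⊔ A) ⧸ A.submoduleOf (B.map φ ⊔ A)) :=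
    (A.submoduleOf (B.map φ ⊔ A)).mkQ.comp
      ((φ.comp B.subtype).codRestrict (B.map φ ⊔ A)
        (fun b => Submodule.mem_sup_left (Submodule.mem_map_of_mem b.2)))
  have hsurj : Function.Surjective ψ := by
    intro y
    obtain ⟨⟨y, hy⟩, rfl⟩ := Submodule.Quotient.mk_surjective _ y
    obtain ⟨z, ⟨b, hb, rfl⟩, a, ha, rfl⟩ := Submodule.mem_sup.1 hy
    refine ⟨⟨b, hb⟩, ?_⟩
    rw [← sub_eq_zero]
    change Submodule.Quotient.mk _ - Submodule.Quotient.mk _ = _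
    rw [← Submodule.Quotient.mk_sub, Submodule.Quotient.mk_eq_zero]
    change _ - (φ b + a) ∈ A
    simpa using ha
  have hker : LinearMap.ker ψ = (A.comap φ).submoduleOf B := by
    ext b
    change Submodule.Quotient.mk _ = _ ↔ _
    rw [Submodule.Quotient.mk_eq_zero]
    rfl
  rw [qlen, ← hker]
  exact (ψ.quotKerEquivOfSurjective hsurj).length_eq

lemma qlen_congr {A A' B : Submodule R P} (h : A ⊓ B = A' ⊓ B) : qlen B A = qlen B A' := by
  have : A.submoduleOf B = A'.submoduleOf B := by
    ext b
    have := SetLike.ext_iff.1 h (b : P)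
    simpa [Submodule.submoduleOf] using this
  rw [qlen, this, ← qlen]

lemma qlen_sup (B A : Submodule R P) : qlen (B ⊔ A) A = qlen B A := by
  have := qlen_map LinearMap.id B A
  rwa [Submodule.map_id, Submodule.comap_id, eq_comm] at this

lemma qlen_map_of_injective (φ : P →ₗ[R] P') (hφ : Function.Injective φ) {B A : Submodule R P} :
    qlen (B.map φ) (A.map φ) = qlen B A := by
  rw [← qlen_sup, ← qlen_map, Submodule.comap_map_eq_of_injective hφ]

lemma qlen_add {A B C : Submodule R P} (hAB : A ≤ B) (hBC : B ≤ C) :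
    qlen C A = qlen C B + qlen B A := by
  let i : (B ⧸ A.submoduleOf B) →ₗ[R] (C ⧸ A.submoduleOf C) :=
    Submodule.mapQ _ _ (Submodule.inclusion hBC) (fun b hb => hb)
  let p : (C ⧸ A.submoduleOf C) →ₗ[R] (C ⧸ B.submoduleOf C) :=
    Submodule.mapQ _ _ LinearMap.id (fun c hc => hAB hc)
  have hi : Function.Injective i := by
    rw [← LinearMap.ker_eq_bot, Submodule.eq_bot_iff]
    intro y hy
    obtain ⟨b, rfl⟩ := Submodule.Quotient.mk_surjective _ y
    have hy' : (Submodule.Quotient.mk (Submodule.inclusion hBC b) : C ⧸ A.submoduleOf C) = 0 := hy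
    rw [Submodule.Quotient.mk_eq_zero] at hy' ⊢
    exact hy'
  have hp : Function.Surjective p := by
    intro y
    obtain ⟨c, rfl⟩ := Submodule.Quotient.mk_surjective _ y
    exact ⟨Submodule.Quotient.mk c, rfl⟩
  have hex : Function.Exact i p := by
    intro y
    obtain ⟨c, rfl⟩ := Submodule.Quotient.mk_surjective _ y
    change (Submodule.Quotient.mk c : C ⧸ B.submoduleOf C) = 0 ↔ _
    rw [Submodule.Quotient.mk_eq_zero]
    constructor
    · intro hc
      exact ⟨Submodule.Quotient.mk ⟨c.1, hc⟩, rfl⟩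
    · rintro ⟨y, hy⟩
      obtain ⟨b, rfl⟩ := Submodule.Quotient.mk_surjective _ y
      have hy' : (Submodule.Quotient.mk (Submodule.inclusion hBC b) : C ⧸ A.submoduleOf C) =
        Submodule.Quotient.mk c := hy
      rw [Submodule.Quotient.eq] at hy'
      have h1 : (b : P) - c ∈ A := hy'
      have h2 := B.sub_mem b.2 (hAB h1)
      change (c : P) ∈ B
      simpa using h2
  rw [qlen, qlen, qlen, Module.length_eq_add_of_exact i p hi hp hex, add_comm]

lemma qlen_eq_zero {A B : Submodule R P} (h : B ≤ A) : qlen B A = 0 := by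
  rw [qlen, Module.length_eq_zero_iff, Submodule.Quotient.subsingleton_iff]
  exact Submodule.submoduleOf_eq_top.2 h

lemma qlen_anti {A A' B : Submodule R P} (h : A ≤ A') : qlen B A' ≤ qlen B A :=
  Module.length_le_of_surjective
    (Submodule.mapQ (A.submoduleOf B) (A'.submoduleOf B) LinearMap.id (fun _ hc => h hc))
    (fun y => by
      obtain ⟨c, rfl⟩ := Submodule.Quotient.mk_surjective _ y
      exact ⟨Submodule.Quotient.mk c, rfl⟩)

lemma qlen_mono {A B B' : Submodule R P} (h : B ≤ B') : qlen B A ≤ qlen B' A := by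
  rw [← qlen_sup B, ← qlen_sup B', qlen_add (B := B ⊔ A) le_sup_right (sup_le_sup_right h A)]
  exact le_add_self

end Length

/-! ### Numerical polynomials in two variables -/

section Numerical

/-- The value at `(s, n)` of the numerical polynomial with binomial coefficients `a`. -/
def binomialEval (a : ℕ × ℕ →₀ ℤ) (s n : ℕ) : ℤ :=
  a.sum fun p c => c * (((s + p.1).choose p.1 : ℤ) * ((n + p.2).choose p.2 : ℤ))

lemma binomialEval_zero (s n : ℕ) : binomialEval 0 s n = 0 := Finsupp.sum_zero_index

lemma binomialEval_add (a b : ℕ × ℕ →₀ ℤ) (s n : ℕ) :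
    binomialEval (a + b) s n = binomialEval a s n + binomialEval b s n :=
  Finsupp.sum_add_index' (by simp) (by intros; ring)

lemma binomialEval_single (k l : ℕ) (c : ℤ) (s n : ℕ) :
    binomialEval (Finsupp.single (k, l) c) s n =
      c * (((s + k).choose k : ℤ) * ((n + l).choose l : ℤ)) :=
  Finsupp.sum_single_index (by simp)

lemma binomialEval_neg (a : ℕ × ℕ →₀ ℤ) (s n : ℕ) :
    binomialEval (-a) s n = -binomialEval a s n := by
  have := binomialEval_add a (-a) s n
  rw [add_neg_cancel, binomialEval_zero] at this
  linarith

lemma binomialEval_sub (a b : ℕ × ℕ →₀ ℤ) (s n : ℕ) :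
    binomialEval (a - b) s n = binomialEval a s n - binomialEval b s n := by
  rw [sub_eq_add_neg, binomialEval_add, binomialEval_neg, sub_eq_add_neg]

/-- All terms of the binomial expansion `a` have degree at most `D - j`. -/
def SupportedBelow (D j : ℕ) (a : ℕ × ℕ →₀ ℤ) : Prop := ∀ p ∈ a.support, p.1 + p.2 + j ≤ D

lemma SupportedBelow.zero (D j : ℕ) : SupportedBelow D j 0 := by
  intro p hp
  simp at hp

lemma SupportedBelow.add {D j : ℕ} {a b : ℕ × ℕ →₀ ℤ} (ha : SupportedBelow D j a)
    (hb : SupportedBelow D j b) : SupportedBelow D j (a + b) := by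
  classical
  intro p hp
  rcases Finset.mem_union.1 (Finsupp.support_add hp) with h | h
  exacts [ha p h, hb p h]

lemma SupportedBelow.single {D j k l : ℕ} (c : ℤ) (h : k + l + j ≤ D) :
    SupportedBelow D j (Finsupp.single (k, l) c) := by
  classical
  intro p hp
  have := Finset.mem_singleton.1 (Finsupp.support_single_subset hp)
  subst this
  exact h

@[elab_as_elim]
lemma SupportedBelow.induction {D j : ℕ}
    {motive : (a : ℕ × ℕ →₀ ℤ) → SupportedBelow D j a → Prop}
    (zero : motive 0 (.zero D j))
    (add : ∀ a b ha hb, motive a ha → motive b hb → motive (a + b) (ha.add hb))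
    (single : ∀ k l c (h : k + l + j ≤ D), motive (Finsupp.single (k, l) c) (.single c h))
    (a : ℕ × ℕ →₀ ℤ) (ha : SupportedBelow D j a) : motive a ha := by
  classical
  suffices ∃ h, motive a h from this.2
  rw [← Finsupp.sum_single a, Finsupp.sum]
  exact Finset.sum_induction _ (fun a => ∃ h, motive a h)
    (fun a b ha hb => ⟨_, add a b _ _ ha.2 hb.2⟩) ⟨_, zero⟩
    (fun p hp => ⟨_, single p.1 p.2 _ (ha p hp)⟩)

lemma choose_add_succ (n l : ℕ) :
    ((n + 1 + (l + 1)).choose (l + 1) : ℤ) =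
      ((n + (l + 1)).choose (l + 1) : ℤ) + ((n + 1 + l).choose l : ℤ) := by
  have : n + 1 + (l + 1) = (n + (l + 1)) + 1 := by ring
  rw [this, Nat.choose_succ_succ]
  push_cast
  rw [show n + (l + 1) = n + 1 + l by ring]
  ring

/-- The difference of a numerical polynomial in its first variable has smaller degree. -/
lemma exists_difference_fst {D j : ℕ} (a : ℕ × ℕ →₀ ℤ) (ha : SupportedBelow D j a) :
    ∃ b, SupportedBelow D (j + 1) b ∧ ∀ s n,
      binomialEval a (s + 1) n - binomialEval a s n = binomialEval b (s + 1) n := by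
  induction a, ha using SupportedBelow.induction with
  | zero => exact ⟨0, .zero _ _, fun s n => by simp [binomialEval_zero]⟩
  | add a b _ _ ha hb =>
    obtain ⟨a', ha', ha⟩ := ha
    obtain ⟨b', hb', hb⟩ := hb
    refine ⟨a' + b', ha'.add hb', fun s n => ?_⟩
    rw [binomialEval_add, binomialEval_add, binomialEval_add, ← ha, ← hb]
    ring
  | single k l c h =>
    cases k with
    | zero => exact ⟨0, .zero _ _, fun s n => by simp [binomialEval_zero, binomialEval_single]⟩
    | succ k =>
      refine ⟨Finsupp.single (k, l) c, .single c (by omega), fun s n => ?_⟩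
      simp only [binomialEval_single]
      rw [choose_add_succ s k]
      ring

lemma exists_antidifference_fst (a : ℕ × ℕ →₀ ℤ) : ∃ b, ∀ s n,
    binomialEval b (s + 1) n - binomialEval b s n = binomialEval a s n := by
  induction a using Finsupp.induction_linear with
  | zero => exact ⟨0, fun s n => by simp [binomialEval_zero]⟩
  | add a b ha hb =>
    obtain ⟨a', ha⟩ := ha
    obtain ⟨b', hb⟩ := hb
    refine ⟨a' + b', fun s n => ?_⟩
    rw [binomialEval_add, binomialEval_add, binomialEval_add, ← ha, ← hb]
    ring
  | single p c =>
    obtain ⟨k, l⟩ := p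
    refine ⟨Finsupp.single (k + 1, l) c - Finsupp.single (k, l) c, fun s n => ?_⟩
    simp only [binomialEval_single, binomialEval_sub]
    rw [choose_add_succ s k]
    ring

lemma exists_antidifference_snd (a : ℕ × ℕ →₀ ℤ) : ∃ b, ∀ s n,
    binomialEval b s (n + 1) - binomialEval b s n = binomialEval a s n := by
  induction a using Finsupp.induction_linear with
  | zero => exact ⟨0, fun s n => by simp [binomialEval_zero]⟩
  | add a b ha hb =>
    obtain ⟨a', ha⟩ := ha
    obtain ⟨b', hb⟩ := hb
    refine ⟨a' + b', fun s n => ?_⟩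
    rw [binomialEval_add, binomialEval_add, binomialEval_add, ← ha, ← hb]
    ring
  | single p c =>
    obtain ⟨k, l⟩ := p
    refine ⟨Finsupp.single (k, l + 1) c - Finsupp.single (k, l) c, fun s n => ?_⟩
    simp only [binomialEval_single, binomialEval_sub]
    rw [choose_add_succ n l]
    ring

/-- Freezing the second variable leaves a numerical polynomial in the first one. -/
lemma exists_eval_snd (a : ℕ × ℕ →₀ ℤ) (n₀ : ℕ) : ∃ b : ℕ × ℕ →₀ ℤ,
    (∀ k l, b (k, l + 1) = 0) ∧ ∀ s n, binomialEval b s n = binomialEval a s n₀ := by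
  classical
  induction a using Finsupp.induction_linear with
  | zero => exact ⟨0, fun _ _ => rfl, fun s n => by simp [binomialEval_zero]⟩
  | add a b ha hb =>
    obtain ⟨a', ha', ha⟩ := ha
    obtain ⟨b', hb', hb⟩ := hb
    refine ⟨a' + b', fun k l => by simp [ha', hb'], fun s n => ?_⟩
    rw [binomialEval_add, binomialEval_add, ha, hb]
  | single p c =>
    obtain ⟨k, l⟩ := p
    refine ⟨Finsupp.single (k, 0) (c * ((n₀ + l).choose l : ℤ)), fun k' l' => ?_, fun s n => ?_⟩
    · rw [Finsupp.single_apply, if_neg (by simp)]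
    · simp only [binomialEval_single]
      simp
      ring

/-- Freezing the first variable leaves a numerical polynomial in the second one. -/
lemma exists_eval_fst (a : ℕ × ℕ →₀ ℤ) (s₀ : ℕ) : ∃ b : ℕ × ℕ →₀ ℤ,
    ∀ s n, binomialEval b s n = binomialEval a s₀ n := by
  induction a using Finsupp.induction_linear with
  | zero => exact ⟨0, fun s n => by simp [binomialEval_zero]⟩
  | add a b ha hb =>
    obtain ⟨a', ha⟩ := ha
    obtain ⟨b', hb⟩ := hb
    refine ⟨a' + b', fun s n => ?_⟩
    rw [binomialEval_add, binomialEval_add, ha, hb]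
  | single p c =>
    obtain ⟨k, l⟩ := p
    refine ⟨Finsupp.single (0, l) (c * ((s₀ + k).choose k : ℤ)), fun s n => ?_⟩
    simp only [binomialEval_single]
    simp
    ring

/-- Summation in the second variable shifts the coefficients. -/
lemma exists_antidifference_snd_shift (a : ℕ × ℕ →₀ ℤ) : ∃ b : ℕ × ℕ →₀ ℤ,
    (∀ k l, b (k, l + 1) = a (k, l)) ∧ ∀ s n,
      binomialEval b s (n + 1) - binomialEval b s n = binomialEval a s (n + 1) := by
  classical
  induction a using Finsupp.induction_linear with
  | zero => exact ⟨0, fun _ _ => rfl, fun s n => by simp [binomialEval_zero]⟩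
  | add a b ha hb =>
    obtain ⟨a', ha', ha⟩ := ha
    obtain ⟨b', hb', hb⟩ := hb
    refine ⟨a' + b', fun k l => by simp [ha', hb'], fun s n => ?_⟩
    rw [binomialEval_add, binomialEval_add, binomialEval_add, ← ha, ← hb]
    ring
  | single p c =>
    obtain ⟨k, l⟩ := p
    refine ⟨Finsupp.single (k, l + 1) c, fun k' l' => ?_, fun s n => ?_⟩
    · simp [Finsupp.single_apply]
    · simp only [binomialEval_single]
      rw [choose_add_succ n l]
      ring

/-! #### Growth of numerical polynomials -/

/-- The function `d` is `O((s + n + 1) ^ (D - j))` for large arguments; it vanishes for large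
arguments if `D < j`. -/
def GrowthAtMost (D j : ℕ) (d : ℕ → ℕ → ℤ) : Prop :=
  ∃ C n₀ : ℕ, ∀ s n, n₀ ≤ s → n₀ ≤ n → |d s n| * (s + n + 1 : ℤ) ^ j ≤ C * (s + n + 1 : ℤ) ^ D

lemma GrowthAtMost.add {D j : ℕ} {d e : ℕ → ℕ → ℤ} (hd : GrowthAtMost D j d)
    (he : GrowthAtMost D j e) : GrowthAtMost D j (fun s n => d s n + e s n) := by
  obtain ⟨C, n₀, hd⟩ := hd
  obtain ⟨C', n₁, he⟩ := he
  refine ⟨C + C', max n₀ n₁, fun s n hs hn => ?_⟩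
  have h1 := hd s n (le_of_max_le_left hs) (le_of_max_le_left hn)
  have h2 := he s n (le_of_max_le_right hs) (le_of_max_le_right hn)
  have h3 : |d s n + e s n| * (s + n + 1 : ℤ) ^ j ≤
      (|d s n| + |e s n|) * (s + n + 1 : ℤ) ^ j := by
    gcongr
    exact abs_add_le _ _
  push_cast
  linarith

lemma GrowthAtMost.neg {D j : ℕ} {d : ℕ → ℕ → ℤ} (hd : GrowthAtMost D j d) :
    GrowthAtMost D j (fun s n => -d s n) := by
  simpa only [GrowthAtMost, abs_neg] using hd

lemma GrowthAtMost.mono {D j n₀ : ℕ} {d e : ℕ → ℕ → ℤ} (hd : GrowthAtMost D j d)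
    (h : ∀ s n, n₀ ≤ s → n₀ ≤ n → |e s n| ≤ |d s n|) : GrowthAtMost D j e := by
  obtain ⟨C, n₁, hd⟩ := hd
  refine ⟨C, max n₀ n₁, fun s n hs hn => le_trans ?_
    (hd s n (le_of_max_le_right hs) (le_of_max_le_right hn))⟩
  exact mul_le_mul_of_nonneg_right (h s n (le_of_max_le_left hs) (le_of_max_le_left hn))
    (by positivity)

lemma choose_add_le (s k : ℕ) : (s + k).choose k ≤ (k + 1) ^ k * (s + 1) ^ k := by
  calc (s + k).choose k ≤ (s + k) ^ k := Nat.choose_le_pow _ _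
    _ ≤ ((k + 1) * (s + 1)) ^ k := by gcongr; nlinarith
    _ = _ := mul_pow _ _ _

lemma GrowthAtMost.of_supportedBelow {D j : ℕ} (a : ℕ × ℕ →₀ ℤ) (ha : SupportedBelow D j a) :
    GrowthAtMost D j (binomialEval a) := by
  induction a, ha using SupportedBelow.induction with
  | zero => exact ⟨0, 0, fun s n _ _ => by simp [binomialEval_zero]⟩
  | add a b _ _ ha hb =>
    convert ha.add hb using 3
    exact binomialEval_add _ _ _ _
  | single k l c h =>
    refine ⟨c.natAbs * ((k + 1) ^ k * (l + 1) ^ l), 0, fun s n _ _ => ?_⟩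
    rw [binomialEval_single, abs_mul, Int.abs_eq_natAbs]
    have h1 := choose_add_le s k
    have h2 := choose_add_le n l
    have h3 : (s + 1) ^ k ≤ (s + n + 1) ^ k := by gcongr; omega
    have h4 : (n + 1) ^ l ≤ (s + n + 1) ^ l := by gcongr; omega
    have h5 : (s + n + 1) ^ (k + l + j) ≤ (s + n + 1) ^ D := Nat.pow_le_pow_right (by omega) h
    have : c.natAbs * ((s + k).choose k * (n + l).choose l) * (s + n + 1) ^ j ≤
        c.natAbs * ((k + 1) ^ k * (l + 1) ^ l) * (s + n + 1) ^ D := by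
      calc c.natAbs * ((s + k).choose k * (n + l).choose l) * (s + n + 1) ^ j
          ≤ c.natAbs * (((k + 1) ^ k * (s + n + 1) ^ k) * ((l + 1) ^ l * (s + n + 1) ^ l)) *
              (s + n + 1) ^ j := by
            gcongr
            · exact h1.trans (by gcongr)
            · exact h2.trans (by gcongr)
        _ = c.natAbs * ((k + 1) ^ k * (l + 1) ^ l) * (s + n + 1) ^ (k + l + j) := by ring
        _ ≤ _ := by gcongr
    rw [abs_of_nonneg (by positivity)]
    exact_mod_cast this

open Filter Topology in
lemma tendsto_choose_div_pow (m k : ℕ) :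
    Tendsto (fun r : ℕ => ((m * r + k).choose k : ℝ) / (r : ℝ) ^ k) atTop
      (𝓝 ((m : ℝ) ^ k / k.factorial)) := by
  induction k with
  | zero => simp
  | succ k ih =>
    have h1 : Tendsto (fun r : ℕ => ((m : ℝ) + (k + 1) / r) / (k + 1)) atTop
        (𝓝 ((m + 0) / (k + 1))) :=
      (tendsto_const_nhds.add (tendsto_const_div_atTop_nhds_zero_nat _)).div_const _
    have h2 := ih.mul h1
    have h3 : (m : ℝ) ^ k / k.factorial * ((m + 0) / (k + 1)) =
        (m : ℝ) ^ (k + 1) / (k + 1).factorial := by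
      rw [Nat.factorial_succ]
      push_cast
      field_simp
      ring
    rw [h3] at h2
    refine h2.congr' ?_
    filter_upwards [eventually_gt_atTop 0] with r hr
    have h4 : ((m * r + (k + 1)).choose (k + 1) : ℝ) * (k + 1) =
        (m * r + k + 1) * ((m * r + k).choose k : ℝ) := by
      have := Nat.add_one_mul_choose_eq (m * r + k) k
      rw [show m * r + (k + 1) = m * r + k + 1 by ring]
      exact_mod_cast this.symm
    have h5 : ((m * r + (k + 1)).choose (k + 1) : ℝ) =
        (m * r + k + 1) * ((m * r + k).choose k : ℝ) / (k + 1) := by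
      rw [← h4]; field_simp
    rw [h5]
    have : (r : ℝ) ≠ 0 := by positivity
    field_simp
    ring

open Filter Topology in
/-- A numerical polynomial of small growth has small degree.  The leading form is computed as a
limit along the half-lines of direction `(1, m)`. -/
lemma GrowthAtMost.supportedBelow {D j : ℕ} {a : ℕ × ℕ →₀ ℤ}
    (ha : GrowthAtMost D j (binomialEval a)) : SupportedBelow D j a := by
  classical
  by_contra hcon
  obtain ⟨p₀, hp₀, hpD⟩ : ∃ p ∈ a.support, D < p.1 + p.2 + j := by
    simpa [SupportedBelow] using hcon
  obtain ⟨q, hq, hmax⟩ := a.support.exists_max_image (fun p => p.1 + p.2) ⟨p₀, hp₀⟩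
  set e := q.1 + q.2 with he
  have heD : D < e + j := lt_of_lt_of_le hpD (by have := hmax p₀ hp₀; omega)
  let T : Finset (ℕ × ℕ) := a.support.filter (fun p => p.1 + p.2 = e)
  have hterm (m : ℕ) (p : ℕ × ℕ) (hp : p ∈ a.support) :
      Tendsto (fun r : ℕ => ((a p : ℤ) : ℝ) * (((r + p.1).choose p.1 : ℝ) *
        ((m * r + p.2).choose p.2 : ℝ)) / (r : ℝ) ^ e) atTop
        (𝓝 (if p.1 + p.2 = e then
          ((a p : ℤ) : ℝ) * (1 / p.1.factorial * ((m : ℝ) ^ p.2 / p.2.factorial)) else 0)) := by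
    have h1 := tendsto_choose_div_pow 1 p.1
    have h2 := tendsto_choose_div_pow m p.2
    have h3 := (h1.mul h2).const_mul ((a p : ℤ) : ℝ)
    simp only [one_mul, Nat.cast_one, one_pow] at h3
    have hle : p.1 + p.2 ≤ e := hmax p hp
    have h4 : Tendsto (fun r : ℕ => ((r : ℝ) ^ (e - (p.1 + p.2)))⁻¹) atTop
        (𝓝 (if p.1 + p.2 = e then 1 else 0)) := by
      split_ifs with h
      · simp [h]
      · have : Tendsto (fun r : ℕ => ((r : ℝ) ^ (e - (p.1 + p.2)))) atTop atTop :=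
          (tendsto_pow_atTop (by omega)).comp tendsto_natCast_atTop_atTop
        exact this.inv_tendsto_atTop
    have h5 := h3.mul h4
    rw [mul_ite, mul_one, mul_zero] at h5
    refine h5.congr' ?_
    filter_upwards [eventually_gt_atTop 0] with r hr
    have hr' : (r : ℝ) ≠ 0 := by positivity
    have : (r : ℝ) ^ e = (r : ℝ) ^ p.1 * (r : ℝ) ^ p.2 * (r : ℝ) ^ (e - (p.1 + p.2)) := by
      rw [← pow_add, ← pow_add]
      congr 1
      omega
    rw [this]
    field_simp
  have hsum (m : ℕ) : Tendsto (fun r : ℕ => (binomialEval a r (m * r) : ℝ) /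
      (r : ℝ) ^ e) atTop (𝓝 (∑ p ∈ T,
        ((a p : ℤ) : ℝ) * (1 / p.1.factorial * ((m : ℝ) ^ p.2 / p.2.factorial)))) := by
    have := tendsto_finsetSum a.support (hterm m)
    rw [← Finset.sum_filter] at this
    refine this.congr (fun r => ?_)
    rw [binomialEval, Finsupp.sum]
    push_cast
    rw [Finset.sum_div]
  have hzero (m : ℕ) (hm : 0 < m) : Tendsto (fun r : ℕ => (binomialEval a r (m * r) : ℝ) /
      (r : ℝ) ^ e) atTop (𝓝 0) := by
    obtain ⟨C, n₀, hC⟩ := ha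
    have hlim : Tendsto (fun r : ℕ => (C * (m + 2 : ℝ) ^ D) / (r : ℝ)) atTop (𝓝 0) :=
      tendsto_const_div_atTop_nhds_zero_nat _
    refine squeeze_zero_norm' ?_ hlim
    filter_upwards [eventually_ge_atTop (max n₀ 1)] with r hr
    have hr0 : n₀ ≤ r := le_of_max_le_left hr
    have hr1 : 1 ≤ r := le_of_max_le_right hr
    have h1 := hC r (m * r) hr0 (hr0.trans (Nat.le_mul_of_pos_left r hm))
    have h1' : |(binomialEval a r (m * r) : ℝ)| * ((r : ℝ) + m * r + 1) ^ j ≤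
        C * ((r : ℝ) + m * r + 1) ^ D := by exact_mod_cast h1
    have hrpos : (1 : ℝ) ≤ r := by exact_mod_cast hr1
    have h2 : (r : ℝ) ^ j ≤ ((r : ℝ) + m * r + 1) ^ j := by
      gcongr
      have : (0 : ℝ) ≤ m * r := by positivity
      linarith
    have h3 : ((r : ℝ) + m * r + 1) ^ D ≤ ((m + 2 : ℝ) * r) ^ D := by
      gcongr
      linarith
    have h4 : |(binomialEval a r (m * r) : ℝ)| * (r : ℝ) ^ j ≤ C * ((m + 2 : ℝ) ^ D * r ^ D) := by
      rw [← mul_pow]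
      calc _ ≤ |(binomialEval a r (m * r) : ℝ)| * ((r : ℝ) + m * r + 1) ^ j := by gcongr
        _ ≤ _ := h1'
        _ ≤ _ := by gcongr
    rw [norm_div, Real.norm_eq_abs, Real.norm_eq_abs, abs_of_nonneg (by positivity : (0:ℝ) ≤ r ^ e),
      div_le_div_iff₀ (by positivity) (by positivity)]
    have h5 : (r : ℝ) ^ D * r ≤ r ^ e * r ^ j := by
      rw [← pow_succ, ← pow_add]
      exact pow_le_pow_right₀ hrpos heD
    have hrj : (0 : ℝ) < (r : ℝ) ^ j := by positivity
    refine le_of_mul_le_mul_right ?_ hrj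
    calc |(binomialEval a r (m * r) : ℝ)| * r * r ^ j
        = (|(binomialEval a r (m * r) : ℝ)| * r ^ j) * r := by ring
      _ ≤ C * ((m + 2 : ℝ) ^ D * r ^ D) * r := by gcongr
      _ = C * (m + 2 : ℝ) ^ D * (r ^ D * r) := by ring
      _ ≤ C * (m + 2 : ℝ) ^ D * (r ^ e * r ^ j) := by gcongr
      _ = _ := by ring
  -- the leading form, restricted to the line of the points `(1, m)`
  let F : Polynomial ℝ := ∑ p ∈ T, Polynomial.monomial p.2
    (((a p : ℤ) : ℝ) * (1 / p.1.factorial * (1 / p.2.factorial)))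
  have hF : F = 0 := by
    refine Polynomial.eq_zero_of_infinite_isRoot F (Set.Infinite.mono (s := Nat.cast '' Set.Ioi 0)
      ?_ ((Set.Ioi_infinite 0).image Nat.cast_injective.injOn))
    rintro _ ⟨m, hm, rfl⟩
    have := tendsto_nhds_unique (hsum m) (hzero m hm)
    simp only [Set.mem_ofPred_eq, Polynomial.IsRoot, F, Polynomial.eval_finsetSum,
      Polynomial.eval_monomial]
    rw [← this]
    refine Finset.sum_congr rfl fun p _ => ?_
    ring
  have hcoeff := congrArg (fun f => Polynomial.coeff f q.2) hF
  simp only [F, Polynomial.finsetSum_coeff, Polynomial.coeff_monomial, Polynomial.coeff_zero]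
    at hcoeff
  rw [Finset.sum_eq_single q] at hcoeff
  · rw [if_pos rfl] at hcoeff
    have : ((a q : ℤ) : ℝ) ≠ 0 := by exact_mod_cast Finsupp.mem_support_iff.1 hq
    have h6 : (1 / (q.1.factorial : ℝ) * (1 / q.2.factorial)) ≠ 0 := by positivity
    exact (mul_ne_zero this h6) hcoeff
  · intro p hp hpq
    rw [if_neg]
    intro h
    apply hpq
    have := (Finset.mem_filter.1 hp).2
    ext
    · omega
    · exact h
  · intro h
    exact absurd (Finset.mem_filter.2 ⟨hq, he.symm⟩) h

lemma binomialEval_injective {a b : ℕ × ℕ →₀ ℤ} {n₀ : ℕ}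
    (h : ∀ s n, n₀ ≤ s → n₀ ≤ n → binomialEval a s n = binomialEval b s n) : a = b := by
  have : SupportedBelow 0 1 (a - b) := by
    refine GrowthAtMost.supportedBelow ⟨0, n₀, fun s n hs hn => ?_⟩
    rw [binomialEval_sub, h s n hs hn]
    simp
  rw [← sub_eq_zero, ← Finsupp.support_eq_empty, Finset.eq_empty_iff_forall_notMem]
  intro p hp
  have := this p hp
  omega

/-! #### The polynomials `binomialPolynomial a` -/

lemma eval_binomialFactor (v : Fin 2) (k : ℕ) (x : Fin 2 → ℚ) (m : ℕ) (hx : x v = m) :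
    MvPolynomial.eval x (binomialFactor v k) = ((m + k).choose k : ℚ) := by
  have h : ∏ r ∈ Finset.range k, ((m : ℚ) + (r + 1)) = k.factorial * ((m + k).choose k : ℚ) := by
    rw [← Nat.cast_mul, ← Nat.ascFactorial_eq_factorial_mul_choose, Nat.ascFactorial_eq_prod_range]
    push_cast
    exact Finset.prod_congr rfl fun r _ => by ring
  rw [binomialFactor, map_mul, MvPolynomial.eval_C, map_prod]
  simp only [map_add, MvPolynomial.eval_X, MvPolynomial.eval_C, hx]
  rw [h]
  field_simp

lemma eval_binomialPolynomial (a : ℕ × ℕ →₀ ℤ) (s n : ℕ) :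
    MvPolynomial.eval ![(s : ℚ), (n : ℚ)] (binomialPolynomial a) = (binomialEval a s n : ℚ) := by
  rw [binomialPolynomial, binomialEval, Finsupp.sum, map_sum]
  push_cast
  refine Finset.sum_congr rfl fun p _ => ?_
  rw [map_mul, map_mul, MvPolynomial.eval_C, eval_binomialFactor 0 p.1 _ s rfl,
    eval_binomialFactor 1 p.2 _ n rfl]

lemma binomialPolynomial_add (a b : ℕ × ℕ →₀ ℤ) :
    binomialPolynomial (a + b) = binomialPolynomial a + binomialPolynomial b :=
  Finsupp.sum_add_index' (h := fun (p : ℕ × ℕ) (c : ℤ) => MvPolynomial.C ((c : ℤ) : ℚ) *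
    (binomialFactor 0 p.1 * binomialFactor 1 p.2)) (by simp) (by intros; push_cast; simp; ring)

lemma binomialPolynomial_zero : binomialPolynomial 0 = 0 := by
  simp [binomialPolynomial]

lemma totalDegree_binomialFactor_le (v : Fin 2) (k : ℕ) :
    (binomialFactor v k).totalDegree ≤ k := by
  refine (MvPolynomial.totalDegree_mul _ _).trans ?_
  rw [MvPolynomial.totalDegree_C, zero_add]
  refine (MvPolynomial.totalDegree_finsetProd _ _).trans ?_
  refine (Finset.sum_le_card_nsmul _ _ 1 fun r _ => ?_).trans (by simp)
  refine (MvPolynomial.totalDegree_add _ _).trans ?_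
  rw [MvPolynomial.totalDegree_X, MvPolynomial.totalDegree_C]
  simp

lemma hasDegreeAtMost_binomialPolynomial {D : ℕ} {a : ℕ × ℕ →₀ ℤ} (ha : SupportedBelow D 2 a) :
    HasDegreeAtMost (binomialPolynomial a) ((D : ℤ) - 2) := by
  by_cases h0 : a = 0
  · left
    rw [h0, binomialPolynomial_zero]
  · right
    obtain ⟨p, hp⟩ := Finsupp.support_nonempty_iff.2 h0
    have hp := ha p hp
    have : (binomialPolynomial a).totalDegree ≤ D - 2 := by
      refine MvPolynomial.totalDegree_finsetSum_le fun q hq => ?_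
      have h := ha q hq
      refine (MvPolynomial.totalDegree_mul _ _).trans ?_
      rw [MvPolynomial.totalDegree_C, zero_add]
      refine (MvPolynomial.totalDegree_mul _ _).trans ?_
      have h1 := totalDegree_binomialFactor_le 0 q.1
      have h2 := totalDegree_binomialFactor_le 1 q.2
      omega
    omega

lemma isHilbertPolynomial_binomialPolynomial_iff {h : ℕ → ℕ → ℕ∞} {a : ℕ × ℕ →₀ ℤ} :
    IsHilbertPolynomial h (binomialPolynomial a) ↔ ∃ n₀ : ℕ, ∀ s n, n₀ ≤ s → n₀ ≤ n →
      ∃ c : ℕ, h s n = c ∧ (c : ℤ) = binomialEval a s n := by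
  simp only [IsHilbertPolynomial, eval_binomialPolynomial]
  norm_cast

/-- The coefficients of a binomial expansion are determined by its values for large arguments. -/
lemma hilbertCoeff_eq {h : ℕ → ℕ → ℕ∞} {a : ℕ × ℕ →₀ ℤ}
    (ha : IsHilbertPolynomial h (binomialPolynomial a)) (k l : ℕ) :
    hilbertCoeff h k l = a (k, l) := by
  have H : ∃ a : ℕ × ℕ →₀ ℤ, IsHilbertPolynomial h (binomialPolynomial a) := ⟨a, ha⟩
  rw [hilbertCoeff, dif_pos H]
  have hb := H.choose_spec
  obtain ⟨n₀, ha⟩ := isHilbertPolynomial_binomialPolynomial_iff.1 ha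
  obtain ⟨n₁, hb⟩ := isHilbertPolynomial_binomialPolynomial_iff.1 hb
  suffices H.choose = a by rw [this]
  refine binomialEval_injective (n₀ := max n₀ n₁) fun s n hs hn => ?_
  obtain ⟨c, h1, h2⟩ := ha s n (le_of_max_le_left hs) (le_of_max_le_left hn)
  obtain ⟨c', h3, h4⟩ := hb s n (le_of_max_le_right hs) (le_of_max_le_right hn)
  rw [← h2, ← h4]
  rw [h1] at h3
  exact_mod_cast h3.symm

end Numerical

/-! ### Hilbert functions of Noetherian families -/

section Families

variable {R : Type*} [CommRing R] {P : Type*} [AddCommGroup P] [Module R P]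

/-- The lengths in the exact sequence of kernel and cokernel of multiplication by `y`, from `W / Z`
to `W₁ / Z₁`. -/
lemma qlen_add_ker_eq (y : Module.End R P) {W Z W₁ Z₁ : Submodule R P} (hZW : Z ≤ W)
    (hZW₁ : Z₁ ≤ W₁) (hW : W.map y ≤ W₁) (hZ : Z.map y ≤ Z₁) :
    qlen W₁ Z₁ + qlen (W ⊓ Z₁.comap y) Z = qlen W₁ (Z₁ ⊔ W.map y) + qlen W Z := by
  have h1 : Z ≤ W ⊓ Z₁.comap y := le_inf hZW (Submodule.map_le_iff_le_comap.1 hZ)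
  rw [qlen_add h1 inf_le_left, qlen_add (le_sup_left : Z₁ ≤ Z₁ ⊔ W.map y) (sup_le hZW₁ hW),
    sup_comm Z₁, ← qlen_map, qlen_congr (A := W ⊓ Z₁.comap y) (A' := Z₁.comap y) (B := W), add_assoc]
  rw [inf_right_comm, inf_idem, inf_comm]

/-- The endomorphisms in `ys` map the member of index `i` of the family `U` into the member of
index `step i`. -/
def StableFamily {ι : Type*} (step : ι → ι) (ys : List (Module.End R P))
    (U : ι → Submodule R P) : Prop :=
  ∀ y ∈ ys, ∀ i, (U i).map y ≤ U (step i)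

/-- The ascending chain condition for the families with property `p` between `Z` and `W`. -/
def ChainCondition {ι : Type*} (p : (ι → Submodule R P) → Prop) (Z W : ι → Submodule R P) : Prop :=
  ∀ U : ℕ → ι → Submodule R P, Monotone U → (∀ k, p (U k)) → (∀ k, Z ≤ U k) → (∀ k, U k ≤ W) →
    ∃ k₀, ∀ k, k₀ ≤ k → U k = U k₀

lemma StableFamily.cons_iff {ι : Type*} {step : ι → ι} {y : Module.End R P}
    {ys : List (Module.End R P)} {U : ι → Submodule R P} :
    StableFamily step (y :: ys) U ↔ (∀ i, (U i).map y ≤ U (step i)) ∧ StableFamily step ys U := by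
  simp [StableFamily]

lemma StableFamily.ker {ι : Type*} {step step' : ι → ι} {y : Module.End R P}
    {ys : List (Module.End R P)} {Z W : ι → Submodule R P} (hcomm : ∀ y' ∈ ys, Commute y y')
    (hsteps : ∀ i, step (step' i) = step' (step i))
    (hZ : StableFamily step' ys Z) (hW : StableFamily step' ys W) :
    StableFamily step' ys (fun i => W i ⊓ (Z (step i)).comap y) := by
  intro y' hy' i
  rintro _ ⟨w, ⟨hw, hw'⟩, rfl⟩
  refine ⟨hW y' hy' i (Submodule.mem_map_of_mem hw), ?_⟩
  have h1 : y (y' w) = y' (y w) := congrArg (fun e : Module.End R P => e w) (hcomm y' hy')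
  change y (y' w) ∈ Z (step (step' i))
  rw [h1, hsteps]
  exact hZ y' hy' _ (Submodule.mem_map_of_mem hw')

lemma StableFamily.coker {ι : Type*} {step step' : ι → ι} {y : Module.End R P}
    {ys : List (Module.End R P)} {Z W : ι → Submodule R P} (hcomm : ∀ y' ∈ ys, Commute y y')
    (hsteps : ∀ i, step (step' i) = step' (step i))
    (hZ : StableFamily step' ys Z) (hW : StableFamily step' ys W) :
    StableFamily step' ys (fun i => Z (step i) ⊔ (W i).map y) := by
  intro y' hy' i
  rw [Submodule.map_sup]
  refine sup_le_sup (hsteps i ▸ hZ y' hy' _) ?_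
  rintro _ ⟨_, ⟨w, hw, rfl⟩, rfl⟩
  refine ⟨y' w, hW y' hy' i (Submodule.mem_map_of_mem hw), ?_⟩
  exact congrArg (fun e : Module.End R P => e w) (hcomm y' hy')

lemma toNat_sub_toNat_of_add_eq {a b c d : ℕ∞} (h : a + b = c + d) (ha : a ≠ ⊤) (hb : b ≠ ⊤)
    (hc : c ≠ ⊤) (hd : d ≠ ⊤) : (a.toNat : ℤ) - d.toNat = c.toNat - b.toNat := by
  lift a to ℕ using ha
  lift b to ℕ using hb
  lift c to ℕ using hc
  lift d to ℕ using hd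
  simp only [ENat.toNat_natCast]
  have : a + b = c + d := by exact_mod_cast h
  omega

/-- The Hilbert function of a Noetherian graded family of modules of finite length is eventually
polynomial.  By induction on the number of operators: the first operator acts as zero on its kernel
and on its cokernel, which inherit the chain condition for the remaining operators. -/
lemma exists_eq_binomialEval_of_row (ys : List (Module.End R P))
    (hcomm : ∀ y ∈ ys, ∀ y' ∈ ys, Commute y y') (Z W : ℕ → Submodule R P) (hZW : Z ≤ W)
    (hZ : StableFamily Nat.succ ys Z) (hW : StableFamily Nat.succ ys W)
    (hacc : ChainCondition (StableFamily Nat.succ ys) Z W)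
    (hfin : ∀ n, qlen (W n) (Z n) ≠ ⊤) :
    ∃ a n₀, ∀ n, n₀ ≤ n → ((qlen (W n) (Z n)).toNat : ℤ) = binomialEval a 0 n := by
  induction ys generalizing Z W with
  | nil =>
    -- All families are stable.  The one that agrees with `W` in degrees less than `k` and with `Z`
    -- in the others becomes constant, so that `W` and `Z` agree in large degrees.
    obtain ⟨k₀, hk₀⟩ := hacc (fun k n => if n < k then W n else Z n)
      (by
        intro k k' hkk' n
        dsimp only
        split_ifs with h h'
        exacts [le_rfl, absurd (h.trans_le hkk') h', hZW n, le_rfl])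
      (by intro k y hy; simp at hy)
      (by intro k n; dsimp only; split_ifs; exacts [hZW n, le_rfl])
      (by intro k n; dsimp only; split_ifs; exacts [le_rfl, hZW n])
    refine ⟨0, k₀, fun n hn => ?_⟩
    have h := congrFun (hk₀ (n + 1) (by omega)) n
    simp only [lt_add_iff_pos_right, if_true, if_neg (not_lt.2 hn),
      zero_lt_one] at h
    rw [h, qlen_eq_zero le_rfl, binomialEval_zero]
    rfl
  | cons y ys ih =>
    obtain ⟨hZy, hZ⟩ := StableFamily.cons_iff.1 hZ
    obtain ⟨hWy, hW⟩ := StableFamily.cons_iff.1 hW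
    have hc : ∀ y' ∈ ys, Commute y y' := fun y' h => hcomm y (by simp) y' (by simp [h])
    have hc' : ∀ y ∈ ys, ∀ y' ∈ ys, Commute y y' :=
      fun y h y' h' => hcomm y (by simp [h]) y' (by simp [h'])
    have hZK : Z ≤ fun n => W n ⊓ (Z (n + 1)).comap y :=
      fun n => le_inf (hZW n) (Submodule.map_le_iff_le_comap.1 (hZy n))
    have hfinK : ∀ n, qlen (W n ⊓ (Z (n + 1)).comap y) (Z n) ≠ ⊤ :=
      fun n => ne_top_of_le_ne_top (hfin n) (qlen_mono inf_le_left)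
    have hfinC : ∀ n, qlen (W (n + 1)) (Z (n + 1) ⊔ (W n).map y) ≠ ⊤ :=
      fun n => ne_top_of_le_ne_top (hfin (n + 1)) (qlen_anti le_sup_left)
    obtain ⟨a, n₀, ha⟩ := ih hc' Z (fun n => W n ⊓ (Z (n + 1)).comap y) hZK hZ
      (StableFamily.ker (step := Nat.succ) hc (fun _ => rfl) hZ hW)
      (by
        intro U hU hst hZU hUK
        refine hacc U hU (fun k => StableFamily.cons_iff.2 ⟨fun n => ?_, hst k⟩) hZU
          (fun k n => (hUK k n).trans inf_le_left)
        exact (Submodule.map_le_iff_le_comap.2 ((hUK k n).trans inf_le_right)).trans (hZU k (n + 1)))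
      hfinK
    obtain ⟨b, n₁, hb⟩ := ih hc' (fun n => Z (n + 1) ⊔ (W n).map y) (fun n => W (n + 1))
      (fun n => sup_le (hZW _) (hWy n))
      (StableFamily.coker (step := Nat.succ) hc (fun _ => rfl) hZ hW)
      (fun y' hy' n => hW y' hy' (n + 1))
      (by
        intro U hU hst hZU hUW
        -- Families of submodules of the cokernel are completed by `Z` in degree zero.
        obtain ⟨k₀, hk₀⟩ := hacc (fun k n => Nat.casesOn n (Z 0) (U k))
          (by
            intro k k' hkk' n
            cases n with
            | zero => exact le_rfl
            | succ n => exact hU hkk' n)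
          (by
            refine fun k => StableFamily.cons_iff.2 ⟨fun n => ?_, fun y' hy' n => ?_⟩
            · cases n with
              | zero => exact (hZy 0).trans (le_sup_left.trans (hZU k 0))
              | succ n =>
                exact (Submodule.map_mono (hUW k n)).trans (le_sup_right.trans (hZU k (n + 1)))
            · cases n with
              | zero => exact (hZ y' hy' 0).trans (le_sup_left.trans (hZU k 0))
              | succ n => exact hst k y' hy' n)
          (by
            intro k n
            cases n with
            | zero => exact le_rfl
            | succ n => exact le_sup_left.trans (hZU k n))
          (by
            intro k n
            cases n with
            | zero => exact hZW 0
            | succ n => exact hUW k n)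
        exact ⟨k₀, fun k hk => funext fun n => congrFun (hk₀ k hk) (n + 1)⟩)
      hfinC
    obtain ⟨c, hc⟩ := exists_antidifference_snd (b - a)
    have hdiff : ∀ n, max n₀ n₁ ≤ n →
        ((qlen (W (n + 1)) (Z (n + 1))).toNat : ℤ) - (qlen (W n) (Z n)).toNat =
          binomialEval c 0 (n + 1) - binomialEval c 0 n := by
      intro n hn
      rw [hc, binomialEval_sub, ← ha n (le_of_max_le_left hn), ← hb n (le_of_max_le_right hn)]
      exact toNat_sub_toNat_of_add_eq
        (qlen_add_ker_eq y (hZW n) (hZW (n + 1)) (hWy n) (hZy n)) (hfin _) (hfinK _) (hfinC _)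
        (hfin _)
    let m := max n₀ n₁
    refine ⟨c + Finsupp.single (0, 0) (((qlen (W m) (Z m)).toNat : ℤ) - binomialEval c 0 m), m,
      fun n hn => ?_⟩
    rw [binomialEval_add, binomialEval_single]
    induction n, hn using Nat.le_induction with
    | base => simp
    | succ n hn ihn =>
      have := hdiff n hn
      simp at ihn ⊢
      linarith

/-- The rows of a Noetherian bigraded family have eventually polynomial Hilbert functions. -/
lemma exists_row_eq_binomialEval (xs ys : List (Module.End R P))
    (hcomm : ∀ y ∈ xs ++ ys, ∀ y' ∈ xs ++ ys, Commute y y') (Z W : ℕ × ℕ → Submodule R P)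
    (hZW : Z ≤ W)
    (hZx : StableFamily (fun p => (p.1 + 1, p.2)) xs Z)
    (hZy : StableFamily (fun p => (p.1, p.2 + 1)) ys Z)
    (hWx : StableFamily (fun p => (p.1 + 1, p.2)) xs W)
    (hWy : StableFamily (fun p => (p.1, p.2 + 1)) ys W)
    (hacc : ChainCondition (fun U => StableFamily (fun p => (p.1 + 1, p.2)) xs U ∧
      StableFamily (fun p => (p.1, p.2 + 1)) ys U) Z W)
    (hfin : ∀ p, qlen (W p) (Z p) ≠ ⊤) (s₀ : ℕ) :
    ∃ a n₀, ∀ n, n₀ ≤ n →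
      ((qlen (W (s₀, n)) (Z (s₀, n))).toNat : ℤ) = binomialEval a 0 n := by
  refine exists_eq_binomialEval_of_row ys
    (fun y h y' h' => hcomm y (by simp [h]) y' (by simp [h']))
    (fun n => Z (s₀, n)) (fun n => W (s₀, n)) (fun n => hZW _) (fun y hy n => hZy y hy _)
    (fun y hy n => hWy y hy _) ?_ (fun n => hfin _)
  intro U hU hst hZU hUW
  -- A stable family in the row `s₀` is completed by `Z` before and by `W` after this row.
  obtain ⟨k₀, hk₀⟩ := hacc
    (fun k p => if p.1 < s₀ then Z p else if p.1 = s₀ then U k p.2 else W p)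
    (by
      intro k k' hkk' p
      dsimp only
      split_ifs
      exacts [le_rfl, hU hkk' _, le_rfl])
    (by
      refine fun k => ⟨fun x hx p => ?_, fun y hy p => ?_⟩
      · dsimp only
        split_ifs with h1 h2 h3 h4 h5 h6 h7 <;> try omega
        · exact hZx x hx p
        · refine (hZx x hx p).trans ?_
          have := hZU k p.2
          rw [← h3] at this
          exact this
        · refine (Submodule.map_mono (hUW k p.2)).trans ?_
          have := hWx x hx p
          rwa [show p = (s₀, p.2) from Prod.ext h4 rfl] at this ⊢
        · exact hWx x hx p
      · dsimp only
        split_ifs with h1 h2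
        · exact hZy y hy p
        · exact hst k y hy p.2
        · exact hWy y hy p)
    (by
      intro k p
      dsimp only
      split_ifs with h1 h2
      · exact le_rfl
      · have := hZU k p.2
        rwa [show p = (s₀, p.2) from Prod.ext h2 rfl]
      · exact hZW p)
    (by
      intro k p
      dsimp only
      split_ifs with h1 h2
      · exact hZW p
      · have := hUW k p.2
        rwa [show p = (s₀, p.2) from Prod.ext h2 rfl]
      · exact le_rfl)
  refine ⟨k₀, fun k hk => funext fun n => ?_⟩
  have := congrFun (hk₀ k hk) (s₀, n)
  simpa using this

/-- The Hilbert function of a Noetherian bigraded family of modules of finite length is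
polynomial for large arguments.  The induction is the one of `exists_eq_binomialEval_of_row`, on the
number of operators of bidegree `(1, 0)`. -/
theorem exists_eq_binomialEval (xs ys : List (Module.End R P))
    (hcomm : ∀ y ∈ xs ++ ys, ∀ y' ∈ xs ++ ys, Commute y y') (Z W : ℕ × ℕ → Submodule R P)
    (hZW : Z ≤ W)
    (hZx : StableFamily (fun p => (p.1 + 1, p.2)) xs Z)
    (hZy : StableFamily (fun p => (p.1, p.2 + 1)) ys Z)
    (hWx : StableFamily (fun p => (p.1 + 1, p.2)) xs W)
    (hWy : StableFamily (fun p => (p.1, p.2 + 1)) ys W)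
    (hacc : ChainCondition (fun U => StableFamily (fun p => (p.1 + 1, p.2)) xs U ∧
      StableFamily (fun p => (p.1, p.2 + 1)) ys U) Z W)
    (hfin : ∀ p, qlen (W p) (Z p) ≠ ⊤) :
    ∃ a n₀, ∀ s n, n₀ ≤ s → n₀ ≤ n →
      ((qlen (W (s, n)) (Z (s, n))).toNat : ℤ) = binomialEval a s n := by
  induction xs generalizing Z W with
  | nil =>
    obtain ⟨k₀, hk₀⟩ := hacc (fun k p => if p.1 < k then W p else Z p)
      (by
        intro k k' hkk' n
        dsimp only
        split_ifs with h h'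
        exacts [le_rfl, absurd (h.trans_le hkk') h', hZW n, le_rfl])
      (by
        refine fun k => ⟨fun y hy => by simp at hy, fun y hy p => ?_⟩
        dsimp only
        split_ifs
        exacts [hWy y hy p, hZy y hy p])
      (by intro k n; dsimp only; split_ifs; exacts [hZW n, le_rfl])
      (by intro k n; dsimp only; split_ifs; exacts [le_rfl, hZW n])
    refine ⟨0, k₀, fun s n hs hn => ?_⟩
    have h := congrFun (hk₀ (s + 1) (by omega)) (s, n)
    simp only [lt_add_iff_pos_right, if_true, if_neg (not_lt.2 hs), zero_lt_one] at h
    rw [h, qlen_eq_zero le_rfl, binomialEval_zero]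
    rfl
  | cons x xs ih =>
    have hrow := exists_row_eq_binomialEval (x :: xs) ys hcomm Z W hZW hZx hZy hWx hWy hacc hfin
    obtain ⟨hZx₁, hZx⟩ := StableFamily.cons_iff.1 hZx
    obtain ⟨hWx₁, hWx⟩ := StableFamily.cons_iff.1 hWx
    have hcx : ∀ y' ∈ xs, Commute x y' := fun y' h => hcomm x (by simp) y' (by simp [h])
    have hcy : ∀ y' ∈ ys, Commute x y' := fun y' h => hcomm x (by simp) y' (by simp [h])
    have hc' : ∀ y ∈ xs ++ ys, ∀ y' ∈ xs ++ ys, Commute y y' :=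
      fun y h y' h' => hcomm y (List.mem_cons_of_mem _ h) y' (List.mem_cons_of_mem _ h')
    have hZK : Z ≤ fun p => W p ⊓ (Z (p.1 + 1, p.2)).comap x :=
      fun p => le_inf (hZW p) (Submodule.map_le_iff_le_comap.1 (hZx₁ p))
    have hfinK : ∀ p, qlen (W p ⊓ (Z (p.1 + 1, p.2)).comap x) (Z p) ≠ ⊤ :=
      fun p => ne_top_of_le_ne_top (hfin p) (qlen_mono inf_le_left)
    have hfinC : ∀ p : ℕ × ℕ,
        qlen (W (p.1 + 1, p.2)) (Z (p.1 + 1, p.2) ⊔ (W p).map x) ≠ ⊤ :=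
      fun p => ne_top_of_le_ne_top (hfin (p.1 + 1, p.2)) (qlen_anti le_sup_left)
    obtain ⟨a, n₀, ha⟩ := ih hc' Z (fun p => W p ⊓ (Z (p.1 + 1, p.2)).comap x) hZK hZx hZy
      (StableFamily.ker (step := fun p => (p.1 + 1, p.2)) hcx (fun _ => rfl) hZx hWx)
      (StableFamily.ker (step := fun p => (p.1 + 1, p.2)) hcy (fun _ => rfl) hZy hWy)
      (by
        intro U hU hst hZU hUK
        refine hacc U hU (fun k => ⟨StableFamily.cons_iff.2 ⟨fun p => ?_, (hst k).1⟩, (hst k).2⟩)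
          hZU (fun k p => (hUK k p).trans inf_le_left)
        exact (Submodule.map_le_iff_le_comap.2 ((hUK k p).trans inf_le_right)).trans (hZU k _))
      hfinK
    obtain ⟨b, n₁, hb⟩ := ih hc' (fun p => Z (p.1 + 1, p.2) ⊔ (W p).map x)
      (fun p => W (p.1 + 1, p.2)) (fun p => sup_le (hZW _) (hWx₁ p))
      (StableFamily.coker (step := fun p => (p.1 + 1, p.2)) hcx (fun _ => rfl) hZx hWx)
      (StableFamily.coker (step := fun p => (p.1 + 1, p.2)) hcy (fun _ => rfl) hZy hWy)
      (fun x' hx' p => hWx x' hx' _) (fun y' hy' p => hWy y' hy' _)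
      (by
        intro U hU hst hZU hUW
        obtain ⟨k₀, hk₀⟩ := hacc (fun k p => Nat.casesOn p.1 (Z (0, p.2)) (fun s => U k (s, p.2)))
          (by
            rintro k k' hkk' ⟨s, n⟩
            cases s with
            | zero => exact le_rfl
            | succ s => exact hU hkk' _)
          (by
            refine fun k => ⟨StableFamily.cons_iff.2 ⟨?_, ?_⟩, ?_⟩
            · rintro ⟨s, n⟩
              cases s with
              | zero => exact (hZx₁ (0, n)).trans (le_sup_left.trans (hZU k (0, n)))
              | succ s =>
                exact (Submodule.map_mono (hUW k (s, n))).trans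
                  (le_sup_right.trans (hZU k (s + 1, n)))
            · rintro x' hx' ⟨s, n⟩
              cases s with
              | zero => exact (hZx x' hx' (0, n)).trans (le_sup_left.trans (hZU k (0, n)))
              | succ s => exact (hst k).1 x' hx' (s, n)
            · rintro y' hy' ⟨s, n⟩
              cases s with
              | zero => exact hZy y' hy' (0, n)
              | succ s => exact (hst k).2 y' hy' (s, n))
          (by
            rintro k ⟨s, n⟩
            cases s with
            | zero => exact le_rfl
            | succ s => exact le_sup_left.trans (hZU k (s, n)))
          (by
            rintro k ⟨s, n⟩
            cases s with
            | zero => exact hZW (0, n)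
            | succ s => exact hUW k (s, n))
        exact ⟨k₀, fun k hk => funext fun p => congrFun (hk₀ k hk) (p.1 + 1, p.2)⟩)
      hfinC
    obtain ⟨c, hc⟩ := exists_antidifference_fst (b - a)
    have hdiff : ∀ s n, max n₀ n₁ ≤ s → max n₀ n₁ ≤ n →
        ((qlen (W (s + 1, n)) (Z (s + 1, n))).toNat : ℤ) - (qlen (W (s, n)) (Z (s, n))).toNat =
          binomialEval c (s + 1) n - binomialEval c s n := by
      intro s n hs hn
      rw [hc, binomialEval_sub, ← ha s n (le_of_max_le_left hs) (le_of_max_le_left hn),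
        ← hb s n (le_of_max_le_right hs) (le_of_max_le_right hn)]
      exact toNat_sub_toNat_of_add_eq
        (qlen_add_ker_eq x (hZW (s, n)) (hZW (s + 1, n)) (hWx₁ (s, n)) (hZx₁ (s, n))) (hfin _)
        (hfinK _) (hfinC _) (hfin _)
    -- The rows are polynomial, which determines the constant of summation in the first variable.
    obtain ⟨r, n₂, hr⟩ := hrow (max n₀ n₁)
    obtain ⟨r', hr'⟩ := exists_eval_fst r 0
    obtain ⟨c', hc'⟩ := exists_eval_fst c (max n₀ n₁)
    refine ⟨c + (r' - c'), max (max n₀ n₁) n₂, fun s n hs hn => ?_⟩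
    rw [binomialEval_add, binomialEval_sub, hr', hc', ← hr n (le_of_max_le_right hn)]
    replace hs := le_of_max_le_left hs
    induction s, hs using Nat.le_induction with
    | base => simp
    | succ s hs' ihs =>
      have := hdiff s n hs' (le_of_max_le_left hn)
      linarith

end Families

/-! ### Graded modules over algebras generated in degree one -/

section Graded

/-- A grading of the module `P` over the `R`-algebra `S`, given by the projections `proj n` onto the
homogeneous components.  The algebra `S` is generated over `R` by the finite set `gens`, whose
elements raise degrees by one. -/
structure ModuleGrading (R S P : Type*) [CommRing R] [CommRing S] [Algebra R S]
    [AddCommGroup P] [Module R P] [Module S P] where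
  /-- The generators of the algebra, acting with degree one. -/
  gens : Finset S
  /-- The projection onto the component of degree `n`. -/
  proj : ℕ → P →ₗ[R] P
  adjoin_gens : Algebra.adjoin R (gens : Set S) = ⊤
  proj_proj : ∀ m n z, proj m (proj n z) = if m = n then proj n z else 0
  exists_sum_proj : ∀ z, ∃ N, ∑ n ∈ Finset.range N, proj n z = z
  proj_succ_smul : ∀ a ∈ gens, ∀ n z, proj (n + 1) (a • z) = a • proj n z
  proj_zero_smul : ∀ a ∈ gens, ∀ z, proj 0 (a • z) = 0

variable {R S P : Type*} [CommRing R] [CommRing S] [Algebra R S]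
    [AddCommGroup P] [Module R P] [Module S P] [IsScalarTower R S P]

namespace ModuleGrading

variable (G : ModuleGrading R S P)

include G in
lemma smul_mem_of_gens (T : Submodule R P) (hT : ∀ a ∈ G.gens, ∀ z ∈ T, a • z ∈ T) (s : S) :
    ∀ z ∈ T, s • z ∈ T := by
  have hs : s ∈ Algebra.adjoin R (G.gens : Set S) := by rw [G.adjoin_gens]; trivial
  induction hs using Algebra.adjoin_induction with
  | mem a ha => exact hT a ha
  | algebraMap r =>
    intro z hz
    rw [algebraMap_smul]
    exact T.smul_mem r hz
  | add a b _ _ ha hb =>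
    intro z hz
    rw [add_smul]
    exact T.add_mem (ha z hz) (hb z hz)
  | mul a b _ _ ha hb =>
    intro z hz
    rw [mul_smul]
    exact ha _ (hb z hz)

/-- An `R`-submodule stable under the generators, as an `S`-submodule. -/
def submoduleOfGens (T : Submodule R P) (hT : ∀ a ∈ G.gens, ∀ z ∈ T, a • z ∈ T) :
    Submodule S P :=
  { T with smul_mem' := G.smul_mem_of_gens T hT }

/-- A submodule is homogeneous if it is stable under the projections. -/
def IsHomogeneous (X : Submodule S P) : Prop := ∀ z ∈ X, ∀ n, G.proj n z ∈ X

/-- The component of degree `n` of a homogeneous submodule. -/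
def piece (X : Submodule S P) (n : ℕ) : Submodule R P := (X.restrictScalars R).map (G.proj n)

variable {G}

lemma mem_piece_iff {X : Submodule S P} (hX : G.IsHomogeneous X) {n : ℕ} {z : P} :
    z ∈ G.piece X n ↔ z ∈ X ∧ G.proj n z = z := by
  constructor
  · rintro ⟨w, hw, rfl⟩
    exact ⟨hX w hw n, by rw [G.proj_proj, if_pos rfl]⟩
  · rintro ⟨h1, h2⟩
    exact ⟨z, h1, h2⟩

lemma piece_le {X : Submodule S P} (hX : G.IsHomogeneous X) (n : ℕ) :
    G.piece X n ≤ X.restrictScalars R := fun _ hz => ((mem_piece_iff hX).1 hz).1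

lemma proj_mem_piece {X : Submodule S P} {z : P} (hz : z ∈ X) (n : ℕ) :
    G.proj n z ∈ G.piece X n := Submodule.mem_map_of_mem hz

lemma piece_mono {X Y : Submodule S P} (h : Y ≤ X) (n : ℕ) : G.piece Y n ≤ G.piece X n :=
  Submodule.map_mono h

lemma proj_eq_zero_of_mem_piece {X : Submodule S P} {m n : ℕ} (hmn : m ≠ n) {z : P}
    (hz : z ∈ G.piece X n) : G.proj m z = 0 := by
  obtain ⟨w, -, rfl⟩ := hz
  rw [G.proj_proj, if_neg hmn]

lemma proj_eq_self_of_mem_piece {X : Submodule S P} {n : ℕ} {z : P}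
    (hz : z ∈ G.piece X n) : G.proj n z = z := by
  obtain ⟨w, -, rfl⟩ := hz
  rw [G.proj_proj, if_pos rfl]

lemma smul_mem_piece {X : Submodule S P} {n : ℕ} {a : S} (ha : a ∈ G.gens) {z : P}
    (hz : z ∈ G.piece X n) : a • z ∈ G.piece X (n + 1) := by
  obtain ⟨w, hw, rfl⟩ := hz
  rw [← G.proj_succ_smul a ha]
  exact proj_mem_piece (X.smul_mem a hw) _

omit [IsScalarTower R S P] in
lemma mem_of_proj_mem {T : Submodule R P} {z : P} (h : ∀ n, G.proj n z ∈ T) : z ∈ T := by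
  obtain ⟨N, hN⟩ := G.exists_sum_proj z
  rw [← hN]
  exact T.sum_mem fun n _ => h n

omit [IsScalarTower R S P] in
lemma IsHomogeneous.inf {X Y : Submodule S P} (hX : G.IsHomogeneous X) (hY : G.IsHomogeneous Y) :
    G.IsHomogeneous (X ⊓ Y) := fun z hz n => ⟨hX z hz.1 n, hY z hz.2 n⟩

omit [IsScalarTower R S P] in
lemma IsHomogeneous.sup {X Y : Submodule S P} (hX : G.IsHomogeneous X) (hY : G.IsHomogeneous Y) :
    G.IsHomogeneous (X ⊔ Y) := by
  intro z hz n
  obtain ⟨x, hx, y, hy, rfl⟩ := Submodule.mem_sup.1 hz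
  rw [map_add]
  exact Submodule.add_mem_sup (hX x hx n) (hY y hy n)

lemma piece_inf {X Y : Submodule S P} (hX : G.IsHomogeneous X) (hY : G.IsHomogeneous Y) (n : ℕ) :
    G.piece (X ⊓ Y) n = G.piece X n ⊓ G.piece Y n := by
  ext z
  rw [mem_piece_iff (hX.inf hY), Submodule.mem_inf, Submodule.mem_inf, mem_piece_iff hX,
    mem_piece_iff hY]
  tauto

lemma piece_sup (X Y : Submodule S P) (n : ℕ) :
    G.piece (X ⊔ Y) n = G.piece X n ⊔ G.piece Y n := by
  rw [piece, Submodule.restrictScalars_sup, Submodule.map_sup]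
  rfl

/-- The components of a Noetherian graded module are Noetherian modules over the base ring: a
submodule `V` of the component of degree `n` is recovered from the `S`-module of the elements that
have their component of degree `n` in `V` and no components of smaller degree. -/
lemma isNoetherian_piece {X : Submodule S P} (hX : G.IsHomogeneous X) [IsNoetherian S X] (n : ℕ) :
    IsNoetherian R (G.piece X n) := by
  let T₀ : Submodule R (G.piece X n) → Submodule R P := fun V =>
    X.restrictScalars R ⊓ (V.map (G.piece X n).subtype).comap (G.proj n) ⊓
      ⨅ j : Fin n, LinearMap.ker (G.proj j)
  have hT₀ : ∀ V z, z ∈ T₀ V ↔ (z ∈ X ∧ G.proj n z ∈ V.map (G.piece X n).subtype) ∧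
      ∀ j : Fin n, G.proj j z = 0 := by
    intro V z
    simp only [T₀, Submodule.mem_inf, Submodule.mem_iInf, LinearMap.mem_ker, Submodule.mem_comap,
      Submodule.restrictScalars_mem]
  let T : Submodule R (G.piece X n) → Submodule S P := fun V => G.submoduleOfGens (T₀ V) (by
    intro a ha z hz
    rw [hT₀] at hz ⊢
    obtain ⟨⟨h1, h2⟩, h3⟩ := hz
    refine ⟨⟨X.smul_mem a h1, ?_⟩, fun j => ?_⟩
    · cases n with
      | zero => rw [G.proj_zero_smul a ha]; exact Submodule.zero_mem _
      | succ n =>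
        have := h3 (Fin.last n)
        rw [Fin.val_last] at this
        rw [G.proj_succ_smul a ha, this, smul_zero]
        exact Submodule.zero_mem _
    · obtain ⟨j, hj⟩ := j
      cases j with
      | zero => exact G.proj_zero_smul a ha z
      | succ j =>
        have := h3 ⟨j, by omega⟩
        dsimp only at this ⊢
        rw [G.proj_succ_smul a ha, this, smul_zero])
  have hT : ∀ (V : Submodule R (G.piece X n)) (z : G.piece X n), z ∈ V ↔ (z : P) ∈ T V := by
    intro V z
    change _ ↔ (z : P) ∈ T₀ V
    rw [hT₀, proj_eq_self_of_mem_piece z.2]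
    constructor
    · exact fun h => ⟨⟨piece_le hX n z.2, ⟨z, h, rfl⟩⟩,
        fun j => proj_eq_zero_of_mem_piece j.2.ne z.2⟩
    · rintro ⟨⟨-, ⟨w, hw, hwz⟩⟩, -⟩
      rwa [← Subtype.ext hwz]
  rw [← monotone_stabilizes_iff_noetherian]
  intro f
  have hmono : Monotone fun k => (T (f k)).submoduleOf X := by
    intro k k' hkk' z hz
    obtain ⟨⟨h1, h2⟩, h3⟩ := (hT₀ (f k) z).1 hz
    exact (hT₀ (f k') z).2 ⟨⟨h1, Submodule.map_mono (f.mono hkk') h2⟩, h3⟩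
  obtain ⟨k₀, hk₀⟩ := monotone_stabilizes_iff_noetherian.2 ‹IsNoetherian S X› ⟨_, hmono⟩
  refine ⟨k₀, fun k hk => ?_⟩
  ext z
  rw [hT, hT]
  exact SetLike.ext_iff.1 (hk₀ k hk) ⟨z, piece_le hX n z.2⟩

end ModuleGrading

end Graded

section Finiteness

variable {R : Type*} [CommRing R] [IsLocalRing R] {P : Type*} [AddCommGroup P] [Module R P]

open IsLocalRing

lemma qlen_ne_top_of_maximalIdeal_smul_le {A B : Submodule R P} (hB : IsNoetherian R B)
    (h : maximalIdeal R • B ≤ A) : qlen B A ≠ ⊤ := by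
  have htors : Module.IsTorsionBySet R (B ⧸ A.submoduleOf B) (maximalIdeal R) := by
    intro y r
    obtain ⟨b, rfl⟩ := Submodule.Quotient.mk_surjective _ y
    change (r : R) • Submodule.Quotient.mk b = (0 : B ⧸ A.submoduleOf B)
    rw [← Submodule.Quotient.mk_smul, Submodule.Quotient.mk_eq_zero]
    exact h (Submodule.smul_mem_smul r.2 b.2)
  let : Module (R ⧸ maximalIdeal R) (B ⧸ A.submoduleOf B) := htors.module
  have : IsScalarTower R (R ⧸ maximalIdeal R) (B ⧸ A.submoduleOf B) :=
    Module.IsTorsionBySet.isScalarTower htors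
  let : Field (R ⧸ maximalIdeal R) := Ideal.Quotient.field _
  rw [qlen, Module.length_eq_of_surjective (R := R ⧸ maximalIdeal R) Ideal.Quotient.mk_surjective]
  have : Module.Finite (R ⧸ maximalIdeal R) (B ⧸ A.submoduleOf B) :=
    Module.Finite.of_restrictScalars_finite R _ _
  exact Module.length_ne_top

lemma qlen_pow_smul_ne_top {X Y : Submodule R P} (hX : IsNoetherian R X) (hYX : Y ≤ X) (s : ℕ) :
    qlen X (maximalIdeal R ^ s • X ⊔ Y) ≠ ⊤ := by
  induction s with
  | zero =>
    rw [qlen_eq_zero (by simp)]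
    simp
  | succ s ih =>
    have h2 : maximalIdeal R ^ s • X ⊔ Y ≤ X := sup_le Submodule.smul_le_right hYX
    rw [qlen_add (sup_le_sup_right (Submodule.smul_mono_left (Ideal.pow_le_pow_right
      (Nat.le_succ s))) _) h2]
    refine WithTop.add_ne_top.2 ⟨ih, qlen_ne_top_of_maximalIdeal_smul_le (isNoetherian_of_le h2) ?_⟩
    rw [Submodule.smul_sup, ← mul_smul, ← pow_succ']
    exact sup_le_sup_left Submodule.smul_le_right _

end Finiteness

section HilbertFunction

open IsLocalRing

variable {R S P : Type*} [CommRing R] [IsLocalRing R] [CommRing S] [Algebra R S]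
    [AddCommGroup P] [Module R P] [Module S P] [IsScalarTower R S P]

namespace ModuleGrading

/-- The sum transform of the Hilbert function of the graded module `X / Y`: the length of
`N_n / 𝔪^{s+1} N_n`, where `N_n` is the component of degree `n` of `X / Y`. -/
def hilb (G : ModuleGrading R S P) (X Y : Submodule S P) (s n : ℕ) : ℕ∞ :=
  qlen (G.piece X n) (maximalIdeal R ^ (s + 1) • G.piece X n ⊔ G.piece Y n)

variable {G : ModuleGrading R S P}

lemma hilb_ne_top {X Y : Submodule S P} (hX : G.IsHomogeneous X) [IsNoetherian S X] (hYX : Y ≤ X)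
    (s n : ℕ) : G.hilb X Y s n ≠ ⊤ :=
  qlen_pow_smul_ne_top (isNoetherian_piece hX n) (piece_mono hYX n) _

/-- The components of the `𝔪`-adic filtration of `X`. -/
def upper (G : ModuleGrading R S P) (X : Submodule S P) (p : ℕ × ℕ) : Submodule R P :=
  maximalIdeal R ^ p.1 • G.piece X p.2

/-- The submodules with `upper G X (s, n) / lower G X Y (s, n)` isomorphic to
`𝔪^s N_n / 𝔪^{s+1} N_n`, where `N = X / Y`. -/
def lower (G : ModuleGrading R S P) (X Y : Submodule S P) (p : ℕ × ℕ) : Submodule R P :=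
  maximalIdeal R ^ (p.1 + 1) • G.piece X p.2 ⊔ (maximalIdeal R ^ p.1 • G.piece X p.2 ⊓ G.piece Y p.2)

lemma lower_le_upper (X Y : Submodule S P) : G.lower X Y ≤ G.upper X := fun _ =>
  sup_le (Submodule.smul_mono_left (Ideal.pow_le_pow_right (Nat.le_succ _))) inf_le_left

lemma qlen_upper_lower {X Y : Submodule S P} (s n : ℕ) :
    qlen (G.upper X (s, n)) (G.lower X Y (s, n)) =
      qlen (maximalIdeal R ^ s • G.piece X n ⊔ G.piece Y n)
        (maximalIdeal R ^ (s + 1) • G.piece X n ⊔ G.piece Y n) := by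
  have hle : maximalIdeal R ^ (s + 1) • G.piece X n ≤ maximalIdeal R ^ s • G.piece X n :=
    Submodule.smul_mono_left (Ideal.pow_le_pow_right (Nat.le_succ _))
  have h1 : maximalIdeal R ^ s • G.piece X n ⊔
      (maximalIdeal R ^ (s + 1) • G.piece X n ⊔ G.piece Y n) =
      maximalIdeal R ^ s • G.piece X n ⊔ G.piece Y n := by
    rw [← sup_assoc, sup_eq_left.2 hle]
  rw [← h1, qlen_sup]
  refine qlen_congr ?_
  change (maximalIdeal R ^ (s + 1) • G.piece X n ⊔
    (maximalIdeal R ^ s • G.piece X n ⊓ G.piece Y n)) ⊓ (maximalIdeal R ^ s • G.piece X n) =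
      (maximalIdeal R ^ (s + 1) • G.piece X n ⊔ G.piece Y n) ⊓ (maximalIdeal R ^ s • G.piece X n)
  rw [sup_inf_assoc_of_le _ hle, sup_inf_assoc_of_le _ hle, inf_right_comm, inf_idem, inf_comm]

lemma hilb_zero {X Y : Submodule S P} (hYX : Y ≤ X) (n : ℕ) :
    G.hilb X Y 0 n = qlen (G.upper X (0, n)) (G.lower X Y (0, n)) := by
  rw [qlen_upper_lower, pow_zero, Ideal.one_eq_top, Submodule.top_smul,
    sup_eq_left.2 (piece_mono hYX n), hilb]

lemma hilb_succ {X Y : Submodule S P} (hYX : Y ≤ X) (s n : ℕ) :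
    G.hilb X Y (s + 1) n = G.hilb X Y s n +
      qlen (G.upper X (s + 1, n)) (G.lower X Y (s + 1, n)) := by
  rw [qlen_upper_lower, hilb, hilb, qlen_add]
  · exact sup_le_sup_right (Submodule.smul_mono_left (Ideal.pow_le_pow_right (Nat.le_succ _))) _
  · exact sup_le Submodule.smul_le_right (piece_mono hYX n)

/-- The chain condition for the bigraded module `G_𝔪(X)`: stable families between the lower and
the upper one are graded submodules of the Rees module of `X` for the ideal `𝔪 S`. -/
lemma chainCondition_lower_upper {X Y : Submodule S P} (hX : G.IsHomogeneous X) [IsNoetherianRing S]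
    (hfg : X.FG) {T : Finset R} (hT : Ideal.span (T : Set R) = maximalIdeal R) :
    ChainCondition (fun U => StableFamily (fun p => (p.1 + 1, p.2))
        (T.toList.map fun t => Algebra.lsmul R R P (algebraMap R S t)) U ∧
      StableFamily (fun p => (p.1, p.2 + 1)) (G.gens.toList.map fun t => Algebra.lsmul R R P t) U)
      (G.lower X Y) (G.upper X) := by
  intro U hU hst hZU hUW
  have hUx : ∀ k s n, ∀ t ∈ maximalIdeal R, ∀ z ∈ U k (s, n), t • z ∈ U k (s + 1, n) := by
    intro k s n t ht z hz
    rw [← hT] at ht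
    induction ht using Submodule.span_induction with
    | mem t ht =>
      have := (hst k).1 (Algebra.lsmul R R P (algebraMap R S t))
        (List.mem_map.2 ⟨t, Finset.mem_toList.2 ht, rfl⟩) (s, n) (Submodule.mem_map_of_mem hz)
      simpa using this
    | zero => rw [zero_smul]; exact Submodule.zero_mem _
    | add a b _ _ ha hb => rw [add_smul]; exact Submodule.add_mem _ ha hb
    | smul a b _ hb => rw [smul_assoc]; exact Submodule.smul_mem _ _ hb
  have hUy : ∀ k s n, ∀ a ∈ G.gens, ∀ z ∈ U k (s, n), a • z ∈ U k (s, n + 1) := by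
    intro k s n a ha z hz
    exact (hst k).2 (Algebra.lsmul R R P a)
      (List.mem_map.2 ⟨a, Finset.mem_toList.2 ha, rfl⟩) (s, n) (Submodule.mem_map_of_mem hz)
  set J : Ideal S := (maximalIdeal R).map (algebraMap R S) with hJ
  -- The elements with all components in the row `s` of the family form an `S`-module; the rows
  -- together are a module over the Rees algebra of `J`.
  let V : ℕ → ℕ → Submodule R P := fun k s => ⨅ n, (U k (s, n)).comap (G.proj n)
  have hV : ∀ k s z, z ∈ V k s ↔ ∀ n, G.proj n z ∈ U k (s, n) := by
    intro k s z
    simp only [V, Submodule.mem_iInf, Submodule.mem_comap]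
  have hVS : ∀ k s, ∀ a : S, ∀ z ∈ V k s, a • z ∈ V k s := by
    intro k s
    refine G.smul_mem_of_gens _ fun a ha z hz => ?_
    rw [hV] at hz ⊢
    intro n
    cases n with
    | zero => rw [G.proj_zero_smul a ha]; exact Submodule.zero_mem _
    | succ n => rw [G.proj_succ_smul a ha]; exact hUy k s n a ha _ (hz n)
  have hVJ : ∀ k s, ∀ a ∈ J, ∀ z ∈ V k s, a • z ∈ V k (s + 1) := by
    intro k s a ha z hz
    rw [hJ, Ideal.map] at ha
    induction ha using Submodule.span_induction with
    | mem t ht =>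
      obtain ⟨t, ht, rfl⟩ := ht
      rw [hV] at hz ⊢
      intro n
      rw [algebraMap_smul, map_smul]
      exact hUx k s n t ht _ (hz n)
    | zero => rw [zero_smul]; exact Submodule.zero_mem _
    | add a b _ _ ha hb => rw [add_smul]; exact Submodule.add_mem _ ha hb
    | smul a b _ hb => rw [smul_assoc]; exact hVS _ _ _ _ hb
  let N : ℕ → Submodule (reesAlgebra J) (PolynomialModule S P) := fun k =>
    { carrier := {f | ∀ s, f.coeff s ∈ V k s}
      zero_mem' := fun s => Submodule.zero_mem _
      add_mem' := fun hf hg s => Submodule.add_mem _ (hf s) (hg s)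
      smul_mem' := by
        rintro ⟨g, hg⟩
        have hg' : g ∈ Algebra.adjoin S
            (Submodule.map (Polynomial.monomial 1 : S →ₗ[S] Polynomial S) J : Set _) := by
          rw [adjoin_monomial_eq_reesAlgebra]; exact hg
        change ∀ f : PolynomialModule S P, (∀ s, f.coeff s ∈ V k s) → ∀ s, (g • f).coeff s ∈ V k s
        clear hg
        induction hg' using Algebra.adjoin_induction with
        | mem g hg =>
          obtain ⟨a, ha, rfl⟩ := hg
          intro f hf s
          rw [PolynomialModule.monomial_smul_apply]
          cases s with
          | zero => simp
          | succ s => simpa using hVJ k s a ha _ (hf s)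
        | algebraMap a =>
          intro f hf s
          rw [algebraMap_smul]
          exact hVS k s a _ (hf s)
        | add a b _ _ ha hb =>
          intro f hf s
          rw [add_smul]
          exact Submodule.add_mem _ (ha f hf s) (hb f hf s)
        | mul a b _ _ ha hb =>
          intro f hf
          rw [mul_smul]
          exact ha _ (hb f hf) }
  let F := J.stableFiltration X
  have hFfg : F.submodule.FG := by
    rw [Ideal.Filtration.submodule_fg_iff_stable]
    · exact Ideal.stableFiltration_stable J X
    · exact fun i => Submodule.FG.smul (IsNoetherian.noetherian _) hfg
  have hFnoeth : IsNoetherian (reesAlgebra J) F.submodule := isNoetherian_of_fg_of_noetherian _ hFfg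
  have hpieceF : ∀ s n, G.upper X (s, n) ≤ (J ^ s • X).restrictScalars R := by
    intro s n
    rw [hJ, ← Ideal.map_pow, Ideal.smul_restrictScalars]
    exact Submodule.smul_mono le_rfl (piece_le hX n)
  have hNF : ∀ k, N k ≤ F.submodule := by
    intro k f hf s
    change f.coeff s ∈ (J ^ s • X).restrictScalars R
    refine mem_of_proj_mem (G := G) fun n => ?_
    exact hpieceF s n (hUW k (s, n) ((hV k s _).1 (hf s) n))
  have hmono : Monotone fun k => (N k).submoduleOf F.submodule := by
    intro k k' hkk' f hf s
    exact (hV _ _ _).2 fun n => hU hkk' (s, n) ((hV _ _ _).1 (hf s) n)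
  obtain ⟨k₀, hk₀⟩ := monotone_stabilizes_iff_noetherian.2 hFnoeth ⟨_, hmono⟩
  have hmem : ∀ k s n z, z ∈ G.piece X n →
      (z ∈ U k (s, n) ↔ PolynomialModule.single S s z ∈ N k) := by
    intro k s n z hz
    have h1 : ∀ i m, G.proj m ((PolynomialModule.single S s z).coeff i) =
        if i = s ∧ m = n then z else 0 := by
      intro i m
      rw [PolynomialModule.coeff_single, Finsupp.single_apply]
      split_ifs with h1 h2 h2
      · rw [h2.2, proj_eq_self_of_mem_piece hz]
      · exact proj_eq_zero_of_mem_piece (fun h => h2 ⟨h1.symm, h⟩) hz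
      · exact absurd h2.1.symm h1
      · rw [map_zero]
    constructor
    · intro h i
      rw [hV]
      intro m
      rw [h1]
      split_ifs with h2
      · rw [h2.1, h2.2]
        exact h
      · exact Submodule.zero_mem _
    · intro h
      have := (hV _ _ _).1 (h s) n
      rwa [h1, if_pos ⟨rfl, rfl⟩] at this
  refine ⟨k₀, fun k hk => ?_⟩
  ext ⟨s, n⟩ z
  have hUX : ∀ k, U k (s, n) ≤ G.piece X n := fun k => (hUW k _).trans Submodule.smul_le_right
  have key : N k = N k₀ := by
    have h := SetLike.ext_iff.1 (hk₀ k hk)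
    ext f
    exact ⟨fun hf => (h ⟨f, hNF _ hf⟩).2 hf, fun hf => (h ⟨f, hNF _ hf⟩).1 hf⟩
  constructor
  · intro h
    rw [hmem _ _ _ _ (hUX _ h), ← key]
    exact (hmem _ _ _ _ (hUX _ h)).1 h
  · intro h
    rw [hmem _ _ _ _ (hUX _ h), key]
    exact (hmem _ _ _ _ (hUX _ h)).1 h

/-- For large arguments, the length of `N_n / 𝔪^{s+1} N_n` is a numerical polynomial, for every
finitely generated graded module `N = X / Y`. -/
theorem exists_hilb_eq_binomialEval [IsNoetherianRing R] [IsNoetherianRing S] {X Y : Submodule S P}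
    (hX : G.IsHomogeneous X) (hfg : X.FG) (hYX : Y ≤ X) :
    ∃ a n₀, ∀ s n, n₀ ≤ s → n₀ ≤ n → ((G.hilb X Y s n).toNat : ℤ) = binomialEval a s n := by
  have hXn : IsNoetherian S X := isNoetherian_of_fg_of_noetherian _ hfg
  obtain ⟨T, hT⟩ : (maximalIdeal R).FG := IsNoetherian.noetherian _
  have hacc := chainCondition_lower_upper (Y := Y) hX hfg hT
  set xs := T.toList.map fun t => Algebra.lsmul R R P (algebraMap R S t) with hxs
  set ys := G.gens.toList.map fun t => Algebra.lsmul R R P t with hys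
  have hcomm : ∀ y ∈ xs ++ ys, ∀ y' ∈ xs ++ ys, Commute y y' := by
    have h : ∀ y ∈ xs ++ ys, ∃ t : S, Algebra.lsmul R R P t = y := by
      intro y hy
      rcases List.mem_append.1 hy with hy | hy
      · obtain ⟨t, -, rfl⟩ := List.mem_map.1 hy
        exact ⟨_, rfl⟩
      · obtain ⟨t, -, rfl⟩ := List.mem_map.1 hy
        exact ⟨_, rfl⟩
    intro y hy y' hy'
    obtain ⟨t, rfl⟩ := h y hy
    obtain ⟨t', rfl⟩ := h y' hy'
    exact (Commute.all t t').map (Algebra.lsmul R R P)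
  have hx : ∀ (t : R), t ∈ T → ∀ (s : ℕ) (V : Submodule R P),
      (maximalIdeal R ^ s • V).map (Algebra.lsmul R R P (algebraMap R S t)) ≤
        maximalIdeal R ^ (s + 1) • V := by
    rintro t ht s V _ ⟨z, hz, rfl⟩
    have ht' : t ∈ maximalIdeal R := hT ▸ Ideal.subset_span ht
    rw [pow_succ', mul_smul]
    simpa using Submodule.smul_mem_smul ht' hz
  have hy : ∀ a ∈ G.gens, ∀ (s n : ℕ) (X : Submodule S P),
      (maximalIdeal R ^ s • G.piece X n).map (Algebra.lsmul R R P a) ≤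
        maximalIdeal R ^ s • G.piece X (n + 1) := by
    intro a ha s n X
    rw [Submodule.map_smul'']
    refine Submodule.smul_mono le_rfl ?_
    rintro _ ⟨z, hz, rfl⟩
    exact smul_mem_piece ha hz
  have hWx : StableFamily (fun p => (p.1 + 1, p.2)) xs (G.upper X) := by
    intro x hx' p
    obtain ⟨t, ht, rfl⟩ := List.mem_map.1 hx'
    exact hx t (Finset.mem_toList.1 ht) _ _
  have hWy : StableFamily (fun p => (p.1, p.2 + 1)) ys (G.upper X) := by
    intro y hy' p
    obtain ⟨t, ht, rfl⟩ := List.mem_map.1 hy'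
    exact hy t (Finset.mem_toList.1 ht) _ _ _
  have hZx : StableFamily (fun p => (p.1 + 1, p.2)) xs (G.lower X Y) := by
    intro x hx' p
    obtain ⟨t, ht, rfl⟩ := List.mem_map.1 hx'
    rw [lower, Submodule.map_sup]
    refine sup_le_sup (hx t (Finset.mem_toList.1 ht) _ _) ((Submodule.map_inf_le _).trans
      (inf_le_inf (hx t (Finset.mem_toList.1 ht) _ _) ?_))
    rintro _ ⟨z, hz, rfl⟩
    simpa using Submodule.smul_mem _ t hz
  have hZy : StableFamily (fun p => (p.1, p.2 + 1)) ys (G.lower X Y) := by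
    intro y hy' p
    obtain ⟨t, ht, rfl⟩ := List.mem_map.1 hy'
    have ht := Finset.mem_toList.1 ht
    rw [lower, Submodule.map_sup]
    refine sup_le_sup (hy t ht _ _ _) ((Submodule.map_inf_le _).trans
      (inf_le_inf (hy t ht _ _ _) ?_))
    rintro _ ⟨z, hz, rfl⟩
    exact smul_mem_piece ht hz
  have hfinH : ∀ s n, G.hilb X Y s n ≠ ⊤ := fun s n => hilb_ne_top hX hYX s n
  have hfin : ∀ p, qlen (G.upper X p) (G.lower X Y p) ≠ ⊤ := by
    rintro ⟨s, n⟩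
    cases s with
    | zero => rw [← hilb_zero hYX]; exact hfinH 0 n
    | succ s =>
      have := hfinH (s + 1) n
      rw [hilb_succ hYX] at this
      exact (WithTop.add_ne_top.1 this).2
  obtain ⟨a, n₀, ha⟩ := exists_eq_binomialEval xs ys hcomm (G.lower X Y) (G.upper X)
    (lower_le_upper X Y) hZx hZy hWx hWy hacc hfin
  have hsucc : ∀ s n, ((G.hilb X Y (s + 1) n).toNat : ℤ) = (G.hilb X Y s n).toNat +
      (qlen (G.upper X (s + 1, n)) (G.lower X Y (s + 1, n))).toNat := by
    intro s n
    rw [hilb_succ hYX, ENat.toNat_add (hfinH s n) (hfin _)]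
    push_cast
    rfl
  have hrow : ∀ s₀, ∃ b n₁, ∀ n, n₁ ≤ n →
      ((G.hilb X Y s₀ n).toNat : ℤ) = binomialEval b 0 n := by
    intro s₀
    induction s₀ with
    | zero =>
      obtain ⟨b, n₁, hb⟩ := exists_row_eq_binomialEval xs ys hcomm (G.lower X Y) (G.upper X)
        (lower_le_upper X Y) hZx hZy hWx hWy hacc hfin 0
      exact ⟨b, n₁, fun n hn => by rw [hilb_zero hYX, hb n hn]⟩
    | succ s ih =>
      obtain ⟨c, n₂, hc⟩ := ih
      obtain ⟨b, n₁, hb⟩ := exists_row_eq_binomialEval xs ys hcomm (G.lower X Y) (G.upper X)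
        (lower_le_upper X Y) hZx hZy hWx hWy hacc hfin (s + 1)
      refine ⟨c + b, max n₁ n₂, fun n hn => ?_⟩
      rw [hsucc, hb n (le_of_max_le_left hn), hc n (le_of_max_le_right hn), binomialEval_add]
  -- The polynomial of the differences in `s` is summed, starting with the row `n₀`.
  obtain ⟨b, n₁, hb⟩ := hrow n₀
  obtain ⟨b', hb'⟩ := exists_eval_fst b 0
  obtain ⟨c, hc⟩ := exists_antidifference_fst a
  obtain ⟨d, hd⟩ : ∃ d, ∀ s n, binomialEval d (s + 1) n - binomialEval d s n =
      binomialEval a (s + 1) n := by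
    refine ⟨c + a, fun s n => ?_⟩
    rw [binomialEval_add, binomialEval_add, ← hc s]
    linarith
  obtain ⟨d', hd'⟩ := exists_eval_fst d n₀
  refine ⟨d + (b' - d'), max n₀ n₁, fun s n hs hn => ?_⟩
  rw [binomialEval_add, binomialEval_sub, hb', hd', ← hb n (le_of_max_le_right hn)]
  replace hs := le_of_max_le_left hs
  induction s, hs using Nat.le_induction with
  | base => simp
  | succ s hs ih =>
    rw [hsucc, ha (s + 1) n (by omega) (le_of_max_le_left hn), ← hd]
    linarith

end ModuleGrading

end HilbertFunction

/-! ### Dimension and the degree of the Hilbert polynomial -/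

section Samuel

variable {R : Type*} [CommRing R]

lemma qlen_top_comap {N₁ N₂ : Type*} [AddCommGroup N₁] [AddCommGroup N₂] [Module R N₁] [Module R N₂]
    {f : N₁ →ₗ[R] N₂} (hf : Function.Surjective f) (A : Submodule R N₂) :
    qlen ⊤ (A.comap f) = qlen ⊤ A := by
  rw [qlen_map, Submodule.map_top, LinearMap.range_eq_top.2 hf, top_sup_eq]

lemma qlen_top_le_add {N₁ N₂ N₃ : Type*} [AddCommGroup N₁] [AddCommGroup N₂] [AddCommGroup N₃]
    [Module R N₁] [Module R N₂] [Module R N₃] (f : N₁ →ₗ[R] N₂) (g : N₂ →ₗ[R] N₃)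
    (hg : Function.Surjective g) (hfg : Function.Exact f g) {A₁ : Submodule R N₁}
    {A₂ : Submodule R N₂} (hA : A₁ ≤ A₂.comap f) :
    qlen ⊤ A₂ ≤ qlen ⊤ A₁ + qlen ⊤ (A₂.map g) := by
  have h1 : qlen ⊤ (A₂.map g) = qlen ⊤ (LinearMap.range f ⊔ A₂) := by
    rw [← qlen_top_comap hg, Submodule.comap_map_eq, LinearMap.exact_iff.1 hfg, sup_comm]
  have h2 : qlen (LinearMap.range f ⊔ A₂) A₂ ≤ qlen ⊤ A₁ := by
    rw [← Submodule.map_top, ← qlen_map]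
    exact qlen_anti hA
  rw [qlen_add (le_sup_right : A₂ ≤ LinearMap.range f ⊔ A₂) le_top, ← h1, add_comm]
  gcongr

variable {S : Type*} [CommRing S] [Algebra R S] (J : Ideal S)

/-- The length over `R` of `N / J^t N`. -/
def samuel (N : Type*) [AddCommGroup N] [Module R N] [Module S N] [IsScalarTower R S N]
    (t : ℕ) : ℕ∞ :=
  qlen (⊤ : Submodule R N) ((J ^ t • (⊤ : Submodule S N)).restrictScalars R)

variable {J}

lemma samuel_le_add {N₁ N₂ N₃ : Type*} [AddCommGroup N₁] [AddCommGroup N₂] [AddCommGroup N₃]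
    [Module R N₁] [Module S N₁] [IsScalarTower R S N₁]
    [Module R N₂] [Module S N₂] [IsScalarTower R S N₂]
    [Module R N₃] [Module S N₃] [IsScalarTower R S N₃] (f : N₁ →ₗ[S] N₂) (g : N₂ →ₗ[S] N₃)
    (hg : Function.Surjective g) (hfg : Function.Exact f g) {t u : ℕ}
    (hf : (J ^ u • (⊤ : Submodule S N₁)).map f ≤ J ^ t • ⊤) :
    samuel (R := R) J N₂ t ≤ samuel (R := R) J N₁ u + samuel (R := R) J N₃ t := by
  have h1 := qlen_top_le_add (f.restrictScalars R) (g.restrictScalars R) hg hfg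
    (A₁ := (J ^ u • (⊤ : Submodule S N₁)).restrictScalars R)
    (A₂ := (J ^ t • (⊤ : Submodule S N₂)).restrictScalars R)
    (fun z hz => hf (Submodule.mem_map_of_mem hz))
  refine h1.trans (add_le_add_right (qlen_anti ?_) _)
  have h2 : (J ^ t • (⊤ : Submodule S N₂)).map g = J ^ t • ⊤ := by
    rw [Submodule.map_smul'', Submodule.map_top, LinearMap.range_eq_top.2 hg]
  rw [← h2]
  rintro _ ⟨z, hz, rfl⟩
  exact ⟨z, hz, rfl⟩

lemma samuel_zero (N : Type*) [AddCommGroup N] [Module R N] [Module S N] [IsScalarTower R S N] :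
    samuel (R := R) J N 0 = 0 := by
  refine qlen_eq_zero ?_
  simp

lemma samuel_of_subsingleton (N : Type*) [AddCommGroup N] [Module R N] [Module S N]
    [IsScalarTower R S N] [Subsingleton N] (t : ℕ) : samuel (R := R) J N t = 0 :=
  qlen_eq_zero fun z _ => by
    rw [Subsingleton.elim z 0]
    exact Submodule.zero_mem _

universe v

/-- The inductive step of `exists_samuel_le`.  By dévissage it is enough to treat `S / p`, where
multiplication by an element of `J` outside `p` compares consecutive values of the Hilbert-Samuel
function and lowers the dimension.  The factor `D` makes the bound vanish for `D = 0`. -/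
lemma exists_samuel_le_step [IsNoetherianRing S] {c : ℕ} (hc : Module.length R (S ⧸ J) ≤ c)
    (D : ℕ) (ih : ∀ (N : Type v) [AddCommGroup N] [Module S N] [Module.Finite S N] [Module R N]
      [IsScalarTower R S N], Module.supportDim S N + 1 ≤ D →
      ∃ C : ℕ, ∀ t, samuel (R := R) J N t ≤ (C * D * (t + 1) ^ (D - 1) : ℕ))
    (N : Type v) [AddCommGroup N] [Module S N] [hfin : Module.Finite S N] :
    ∀ [Module R N] [IsScalarTower R S N], Module.supportDim S N ≤ D →
      ∃ C : ℕ, ∀ t, samuel (R := R) J N t ≤ (C * (t + 1) ^ D : ℕ) := by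
  induction hfin using IsNoetherianRing.induction_on_isQuotientEquivQuotientPrime S with
  | subsingleton N =>
    intro _ _ _
    exact ⟨0, fun t => by rw [samuel_of_subsingleton]; simp⟩
  | quotient N p e =>
    intro _ _ hD
    by_cases hJ : J ≤ p.1
    · refine ⟨c, fun t => ?_⟩
      have h1 : samuel (R := R) J N t ≤ Module.length R N := by
        rw [samuel, qlen]
        refine (Module.length_le_of_surjective (Submodule.mkQ _) (Submodule.mkQ_surjective _)).trans
          ?_
        rw [Module.length_top]
      have h2 : Module.length R N ≤ Module.length R (S ⧸ J) := by
        rw [(e.restrictScalars R).length_eq]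
        exact Module.length_le_of_surjective
          ((Ideal.Quotient.factorₐ R hJ).toLinearMap) (Ideal.Quotient.factor_surjective hJ)
      refine (h1.trans (h2.trans hc)).trans ?_
      exact_mod_cast Nat.le_mul_of_pos_right c (by positivity)
    · obtain ⟨x, hxJ, hxp⟩ := SetLike.not_le_iff_exists.1 hJ
      have hann : Module.annihilator S N = p.1 := by
        rw [e.annihilator_eq, Ideal.annihilator_quotient]
      have hdim : Module.supportDim S (QuotSMulTop x N) + 1 ≤ D := by
        refine (Module.supportDim_quotSMulTop_succ_le_of_notMem_minimalPrimes ?_).trans hD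
        rw [hann]
        intro q hq
        have := p.2
        rw [Ideal.minimalPrimes_eq_subsingleton_self, Set.mem_singleton_iff] at hq
        rwa [hq]
      obtain ⟨C, hC⟩ := ih (QuotSMulTop x N) hdim
      refine ⟨C * D, fun t => ?_⟩
      induction t with
      | zero => rw [samuel_zero]; exact zero_le
      | succ t iht =>
        have h1 : samuel (R := R) J N (t + 1) ≤
            samuel (R := R) J N t + samuel (R := R) J (QuotSMulTop x N) (t + 1) := by
          refine samuel_le_add (LinearMap.lsmul S N x) (Submodule.mkQ _)
            (Submodule.mkQ_surjective _) ?_ ?_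
          · rw [LinearMap.exact_iff, Submodule.ker_mkQ]
            ext z
            simp [Submodule.mem_smul_pointwise_iff_exists]
          · rw [pow_succ', mul_smul]
            rintro _ ⟨z, hz, rfl⟩
            exact Submodule.smul_mem_smul hxJ hz
        refine h1.trans ((add_le_add iht (hC (t + 1))).trans ?_)
        norm_cast
        cases D with
        | zero => simp
        | succ D =>
          have : (t + 1) ^ D ≤ (t + 1 + 1) ^ D := by gcongr; omega
          calc C * (D + 1) * (t + 1) ^ (D + 1) + C * (D + 1) * (t + 1 + 1) ^ (D + 1 - 1)
              = C * (D + 1) * ((t + 1) ^ D * (t + 1) + (t + 1 + 1) ^ D) := by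
                rw [Nat.add_sub_cancel]; ring
            _ ≤ C * (D + 1) * ((t + 1 + 1) ^ D * (t + 1) + (t + 1 + 1) ^ D) := by gcongr
            _ = _ := by ring
  | exact N₁ N₂ N₃ f g hf hg hfg h1 h3 =>
    intro _ _ hD
    let : Module R N₁ := Module.compHom N₁ (algebraMap R S)
    let : Module R N₃ := Module.compHom N₃ (algebraMap R S)
    have : IsScalarTower R S N₁ := IsScalarTower.of_algebraMap_smul fun _ _ => rfl
    have : IsScalarTower R S N₃ := IsScalarTower.of_algebraMap_smul fun _ _ => rfl
    obtain ⟨C₁, h1⟩ := h1 ((Module.supportDim_le_of_injective f hf).trans hD)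
    obtain ⟨C₃, h3⟩ := h3 ((Module.supportDim_le_of_surjective g hg).trans hD)
    refine ⟨C₁ + C₃, fun t => ?_⟩
    refine (samuel_le_add f g hg hfg (u := t) ?_).trans ((add_le_add (h1 t) (h3 t)).trans ?_)
    · rw [Submodule.map_smul'']
      exact Submodule.smul_mono le_rfl le_top
    · norm_cast
      rw [add_mul]

/-- The Hilbert-Samuel function of a module of dimension at most `D` is bounded by a multiple of
`(t + 1) ^ D`. -/
theorem exists_samuel_le [IsNoetherianRing S] {c : ℕ} (hc : Module.length R (S ⧸ J) ≤ c)
    (D : ℕ) : ∀ (N : Type v) [AddCommGroup N] [Module S N] [Module.Finite S N] [Module R N]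
      [IsScalarTower R S N], Module.supportDim S N ≤ D →
      ∃ C : ℕ, ∀ t, samuel (R := R) J N t ≤ (C * (t + 1) ^ D : ℕ) := by
  induction D with
  | zero =>
    intro N _ _ _ _ _
    refine exists_samuel_le_step hc 0 ?_ N
    intro N _ _ _ _ _ h
    have : Subsingleton N := by
      by_contra hN
      have := not_subsingleton_iff_nontrivial.1 hN
      have hbot := Module.supportDim_ne_bot_of_nontrivial S N
      obtain ⟨d, hd⟩ := WithBot.ne_bot_iff_exists.1 hbot
      rw [← hd] at h
      have h' : d + 1 ≤ (0 : ℕ∞) := by exact_mod_cast h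
      simp at h'
    exact ⟨0, fun t => by rw [samuel_of_subsingleton]; simp⟩
  | succ D ihD =>
    intro N _ _ _ _ _
    refine exists_samuel_le_step hc (D + 1) ?_ N
    intro N _ _ _ _ _ h
    have h' : Module.supportDim S N ≤ D := by
      cases hN : Module.supportDim S N with
      | bot => exact bot_le
      | coe d =>
        rw [hN] at h
        have h' : d + 1 ≤ ((D + 1 : ℕ) : ℕ∞) := by exact_mod_cast h
        have : d ≤ D := by
          push_cast at h'
          exact (ENat.add_le_add_iff_right ENat.one_ne_top).1 h'
        exact_mod_cast this
    obtain ⟨C, hC⟩ := ihD N h'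
    refine ⟨C, fun t => (hC t).trans ?_⟩
    norm_cast
    rw [Nat.add_sub_cancel, mul_assoc]
    gcongr
    exact Nat.le_mul_of_pos_left _ (Nat.succ_pos D)

end Samuel

section Degree

/-- A numerical polynomial whose sums over the second variable are `O((s + n) ^ D)` has degree less
than `D`, as summation raises the degree by one. -/
lemma supportedBelow_of_sum_le {D C n₀ : ℕ} {h : ℕ → ℕ → ℕ} {a : ℕ × ℕ →₀ ℤ}
    (ha : ∀ s n, n₀ ≤ s → n₀ ≤ n → (h s n : ℤ) = binomialEval a s n)
    (hC : ∀ s n, ∑ j ∈ Finset.range n, h s j ≤ C * (s + n + 2) ^ D) : SupportedBelow D 1 a := by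
  obtain ⟨b, hba, hb⟩ := exists_antidifference_snd_shift a
  obtain ⟨c, hc0, hc⟩ := exists_eval_snd b n₀
  have key : ∀ s n, n₀ ≤ s → n₀ ≤ n →
      binomialEval (b - c) s n = ∑ j ∈ Finset.Ico (n₀ + 1) (n + 1), (h s j : ℤ) := by
    intro s n hs hn
    rw [binomialEval_sub, hc]
    induction n, hn using Nat.le_induction with
    | base => simp
    | succ n hn ih =>
      rw [Finset.sum_Ico_succ_top (by omega), ← ih, ha s (n + 1) hs (by omega), ← hb]
      ring
  have hsupp : SupportedBelow D 0 (b - c) := by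
    refine GrowthAtMost.supportedBelow ⟨C * 3 ^ D, n₀, fun s n hs hn => ?_⟩
    rw [key s n hs hn, abs_of_nonneg (by positivity), pow_zero, mul_one]
    have h1 : ∑ j ∈ Finset.Ico (n₀ + 1) (n + 1), h s j ≤ ∑ j ∈ Finset.range (n + 1), h s j := by
      refine Finset.sum_le_sum_of_subset fun j hj => ?_
      rw [Finset.mem_range]
      exact (Finset.mem_Ico.1 hj).2
    have h2 : (s + (n + 1) + 2) ^ D ≤ 3 ^ D * (s + n + 1) ^ D := by
      rw [← mul_pow]
      gcongr
      omega
    have h3 : ∑ j ∈ Finset.Ico (n₀ + 1) (n + 1), h s j ≤ C * 3 ^ D * (s + n + 1) ^ D := by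
      calc _ ≤ _ := h1
        _ ≤ C * (s + (n + 1) + 2) ^ D := hC s (n + 1)
        _ ≤ C * (3 ^ D * (s + n + 1) ^ D) := by gcongr
        _ = _ := by ring
    exact_mod_cast h3
  intro p hp
  have := hsupp (p.1, p.2 + 1) (by
    rw [Finsupp.mem_support_iff, Finsupp.sub_apply, hba, hc0, sub_zero]
    exact Finsupp.mem_support_iff.1 hp)
  dsimp only at this
  omega

open IsLocalRing

variable {R S P : Type*} [CommRing R] [IsLocalRing R] [CommRing S] [Algebra R S]
    [AddCommGroup P] [Module R P] [Module S P] [IsScalarTower R S P]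

namespace ModuleGrading

variable (G : ModuleGrading R S P)

/-- The ideal of `S` generated by `𝔪` and the elements of degree one; it is the homogeneous maximal
ideal, or all of `S`. -/
def irrelevant : Ideal S := (maximalIdeal R).map (algebraMap R S) ⊔ Ideal.span (G.gens : Set S)

omit [IsScalarTower R S P] in
lemma length_quotient_irrelevant_le : Module.length R (S ⧸ G.irrelevant) ≤ 1 := by
  have h1 : maximalIdeal R ≤ LinearMap.ker (Algebra.linearMap R (S ⧸ G.irrelevant)) := by
    intro r hr
    rw [LinearMap.mem_ker, Algebra.linearMap_apply, IsScalarTower.algebraMap_apply R S]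
    exact Ideal.Quotient.eq_zero_iff_mem.2 (Ideal.mem_sup_left (Ideal.mem_map_of_mem _ hr))
  have h2 : Function.Surjective (Submodule.liftQ (maximalIdeal R)
      (Algebra.linearMap R (S ⧸ G.irrelevant)) h1) := by
    intro y
    obtain ⟨s, rfl⟩ := Ideal.Quotient.mk_surjective y
    suffices ∃ r : R, algebraMap R (S ⧸ G.irrelevant) r = Ideal.Quotient.mk _ s by
      obtain ⟨r, hr⟩ := this
      exact ⟨Submodule.Quotient.mk r, hr⟩
    have hs : s ∈ Algebra.adjoin R (G.gens : Set S) := by rw [G.adjoin_gens]; trivial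
    induction hs using Algebra.adjoin_induction with
    | mem a ha =>
      refine ⟨0, ?_⟩
      rw [map_zero, eq_comm, Ideal.Quotient.eq_zero_iff_mem]
      exact Ideal.mem_sup_right (Ideal.subset_span ha)
    | algebraMap r => exact ⟨r, rfl⟩
    | add a b _ _ ha hb =>
      obtain ⟨r, hr⟩ := ha
      obtain ⟨r', hr'⟩ := hb
      exact ⟨r + r', by rw [map_add, hr, hr', map_add]⟩
    | mul a b _ _ ha hb =>
      obtain ⟨r, hr⟩ := ha
      obtain ⟨r', hr'⟩ := hb
      exact ⟨r * r', by rw [map_mul, hr, hr', map_mul]⟩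
  have h3 : IsSimpleModule R (R ⧸ maximalIdeal R) := by
    rw [isSimpleModule_iff_isCoatom]
    exact (maximalIdeal.isMaximal R).out
  refine (Module.length_le_of_surjective _ h2).trans ?_
  exact (Module.length_eq_one R (R ⧸ maximalIdeal R)).le

omit [IsLocalRing R] in
/-- Elements of `(gens)^n P` have no component of degree less than `n`. -/
lemma proj_eq_zero_of_mem_span_pow_smul {n j : ℕ} (hj : j < n) {z : P}
    (hz : z ∈ Ideal.span (G.gens : Set S) ^ n • (⊤ : Submodule S P)) : G.proj j z = 0 := by
  have htail : ∀ n, ∀ a ∈ G.gens, ∀ z ∈ ⨅ j : Fin n, LinearMap.ker (G.proj j),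
      a • z ∈ ⨅ j : Fin (n + 1), LinearMap.ker (G.proj j) := by
    intro n a ha z hz
    simp only [Submodule.mem_iInf, LinearMap.mem_ker] at hz ⊢
    rintro ⟨j, hj⟩
    cases j with
    | zero => exact G.proj_zero_smul a ha z
    | succ j =>
      have := hz ⟨j, by omega⟩
      dsimp only at this ⊢
      rw [G.proj_succ_smul a ha, this, smul_zero]
  have hanti : ∀ n, ⨅ j : Fin (n + 1), LinearMap.ker (G.proj j) ≤
      ⨅ j : Fin n, LinearMap.ker (G.proj j) := by
    intro n z hz
    simp only [Submodule.mem_iInf, LinearMap.mem_ker] at hz ⊢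
    exact fun j => hz j.castSucc
  let tail : ℕ → Submodule S P := fun n => G.submoduleOfGens
    (⨅ j : Fin n, LinearMap.ker (G.proj j)) (fun a ha z hz => hanti n (htail n a ha z hz))
  have hle : ∀ n, Ideal.span (G.gens : Set S) ^ n • (⊤ : Submodule S P) ≤ tail n := by
    intro n
    induction n with
    | zero =>
      intro z _
      change z ∈ ⨅ j : Fin 0, LinearMap.ker (G.proj j)
      simp
    | succ n ih =>
      rw [pow_succ', mul_smul]
      refine Submodule.smul_le.2 fun a ha z hz => ?_
      replace hz := ih hz
      induction ha using Submodule.span_induction with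
      | mem a ha => exact htail n a ha z hz
      | zero => rw [zero_smul]; exact Submodule.zero_mem _
      | add a b _ _ ha hb => rw [add_smul]; exact Submodule.add_mem _ ha hb
      | smul a b _ hb => rw [smul_assoc]; exact Submodule.smul_mem _ _ hb
  have hz' : z ∈ ⨅ j : Fin n, LinearMap.ker (G.proj j) := hle n hz
  simp only [Submodule.mem_iInf, LinearMap.mem_ker] at hz'
  exact hz' ⟨j, hj⟩

variable {G}

/-- The power `s + n` of the ideal generated by `𝔪` and `gens` lies in the sum of `𝔪^s S` and
`(gens)^n`, and the second summand does not contribute to the degrees less than `n`. -/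
lemma proj_mem_of_mem_pow_smul {X : Submodule S P} {s n j : ℕ} (hj : j < n) {z : P}
    (hz : z ∈ G.irrelevant ^ (s + n) • X) : G.proj j z ∈ maximalIdeal R ^ s • G.piece X j := by
  have h1 : G.irrelevant ^ (s + n) • X ≤
      (((maximalIdeal R) ^ s).map (algebraMap R S)) • X ⊔ Ideal.span (G.gens : Set S) ^ n • ⊤ := by
    rw [Ideal.map_pow]
    refine (Submodule.smul_mono Ideal.sup_pow_add_le_pow_sup_pow le_rfl).trans ?_
    rw [Submodule.sup_smul]
    exact sup_le_sup_left (Submodule.smul_mono le_rfl le_top) _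
  obtain ⟨x, hx, y, hy, rfl⟩ := Submodule.mem_sup.1 (h1 hz)
  rw [map_add, G.proj_eq_zero_of_mem_span_pow_smul hj hy, add_zero, piece, ← Submodule.map_smul'']
  refine Submodule.mem_map_of_mem ?_
  rw [← Ideal.smul_restrictScalars]
  exact hx

/-- The elements of `X` whose components of degree less than `n` vanish in
`N_j / 𝔪^{s+1} N_j`, where `N = X / Y`. -/
def truncation (G : ModuleGrading R S P) (X Y : Submodule S P) (s n : ℕ) : Submodule R P :=
  X.restrictScalars R ⊓ ⨅ j : Fin n,
    (maximalIdeal R ^ (s + 1) • G.piece X j ⊔ G.piece Y j).comap (G.proj j)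

lemma mem_truncation {X Y : Submodule S P} {s n : ℕ} {z : P} : z ∈ G.truncation X Y s n ↔
    z ∈ X ∧ ∀ j < n, G.proj j z ∈ maximalIdeal R ^ (s + 1) • G.piece X j ⊔ G.piece Y j := by
  simp only [truncation, Submodule.mem_inf, Submodule.mem_iInf, Submodule.mem_comap,
    Submodule.restrictScalars_mem]
  exact ⟨fun h => ⟨h.1, fun j hj => h.2 ⟨j, hj⟩⟩, fun h => ⟨h.1, fun j => h.2 j j.2⟩⟩

lemma sum_hilb_eq {X : Submodule S P} (Y : Submodule S P) (hX : G.IsHomogeneous X) (s n : ℕ) :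
    ∑ j ∈ Finset.range n, G.hilb X Y s j = qlen (X.restrictScalars R) (G.truncation X Y s n) := by
  induction n with
  | zero =>
    have h : X.restrictScalars R ≤ G.truncation X Y s 0 := fun z hz =>
      mem_truncation.2 ⟨hz, by simp⟩
    rw [qlen_eq_zero h, Finset.sum_range_zero]
  | succ n ih =>
    have h2 : G.truncation X Y s (n + 1) ≤ G.truncation X Y s n := fun z hz =>
      mem_truncation.2
        ⟨(mem_truncation.1 hz).1, fun j hj => (mem_truncation.1 hz).2 j (by omega)⟩
    have h4 : qlen (G.truncation X Y s n) (G.truncation X Y s (n + 1)) =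
        qlen (G.truncation X Y s n)
          ((maximalIdeal R ^ (s + 1) • G.piece X n ⊔ G.piece Y n).comap (G.proj n)) := by
      refine qlen_congr ?_
      ext z
      simp only [Submodule.mem_inf, mem_truncation, Submodule.mem_comap]
      constructor
      · exact fun h => ⟨h.1.2 n (Nat.lt_succ_self n), h.2⟩
      · refine fun h => ⟨⟨h.2.1, fun j hj => ?_⟩, h.2⟩
        rcases Nat.lt_succ_iff_lt_or_eq.1 hj with hj | rfl
        exacts [h.2.2 j hj, h.1]
    have h5 : (G.truncation X Y s n).map (G.proj n) = G.piece X n := by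
      refine le_antisymm (Submodule.map_mono inf_le_left) ?_
      intro z hz
      refine ⟨z, mem_truncation.2 ⟨piece_le hX n hz, fun j hj => ?_⟩, proj_eq_self_of_mem_piece hz⟩
      rw [proj_eq_zero_of_mem_piece hj.ne hz]
      exact Submodule.zero_mem _
    rw [Finset.sum_range_succ, qlen_add h2 inf_le_left, h4, qlen_map, h5, qlen_sup, ih]
    rfl

variable {N : Type*} [AddCommGroup N] [Module R N] [Module S N] [IsScalarTower R S N]

/-- The Hilbert function of a module `N` of the form `X / Y`, summed over the degrees less than
`n`, is bounded by a Hilbert-Samuel function with respect to the homogeneous maximal ideal. -/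
lemma sum_hilb_le {X Y : Submodule S P} (hX : G.IsHomogeneous X) (φ : X →ₗ[S] N)
    (hφ : Function.Surjective φ) (hker : ∀ z, φ z = 0 → (z : P) ∈ Y) (s n : ℕ) :
    ∑ j ∈ Finset.range n, G.hilb X Y s j ≤ samuel (R := R) G.irrelevant N (s + 1 + n) := by
  rw [sum_hilb_eq Y hX]
  let ι : X →ₗ[R] P := X.subtype.restrictScalars R
  have hφ' : Function.Surjective (φ.restrictScalars R) := hφ
  have h7 : qlen (X.restrictScalars R) (G.truncation X Y s n) =
      qlen ⊤ ((G.truncation X Y s n).comap ι) := by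
    rw [qlen_map, qlen_sup]
    congr 1
    ext z
    simp [ι]
  rw [h7, samuel, ← qlen_top_comap hφ']
  refine qlen_anti fun z hz => ?_
  have hz' : φ z ∈ G.irrelevant ^ (s + 1 + n) • (⊤ : Submodule S N) := hz
  have h8 : (⊤ : Submodule S N) = (⊤ : Submodule S X).map φ := by
    rw [Submodule.map_top, LinearMap.range_eq_top.2 hφ]
  rw [h8, ← Submodule.map_smul''] at hz'
  obtain ⟨w, hw, hwz⟩ := hz'
  have h9 : (w : P) ∈ G.irrelevant ^ (s + 1 + n) • X := by
    have := Submodule.mem_map_of_mem (f := X.subtype) hw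
    rw [Submodule.map_smul'', Submodule.map_top, Submodule.range_subtype] at this
    exact this
  have h10 : (z : P) - w ∈ Y := hker (z - w) (by rw [map_sub, hwz, sub_self])
  change (z : P) ∈ G.truncation X Y s n
  rw [mem_truncation]
  refine ⟨z.2, fun j hj => ?_⟩
  rw [← sub_add_cancel (z : P) w, map_add]
  exact Submodule.add_mem _ (Submodule.mem_sup_right (proj_mem_piece h10 j))
    (Submodule.mem_sup_left (proj_mem_of_mem_pow_smul hj h9))

/-- The polynomial of the sum transform of the Hilbert function of a module `N` of the form `X / Y`
has degree less than the dimension of `N`. -/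
theorem supportedBelow_of_supportDim_le [IsNoetherianRing S]
    {X Y : Submodule S P} (hX : G.IsHomogeneous X) (hfg : X.FG) (hYX : Y ≤ X) (φ : X →ₗ[S] N)
    (hφ : Function.Surjective φ) (hker : ∀ z, φ z = 0 → (z : P) ∈ Y) {D n₀ : ℕ}
    (hD : Module.supportDim S N ≤ D)
    {a : ℕ × ℕ →₀ ℤ} (ha : ∀ s n, n₀ ≤ s → n₀ ≤ n →
      ((G.hilb X Y s n).toNat : ℤ) = binomialEval a s n) : SupportedBelow D 1 a := by
  have hXn : IsNoetherian S X := isNoetherian_of_fg_of_noetherian _ hfg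
  have : Module.Finite S N := Module.Finite.of_surjective φ hφ
  obtain ⟨C, hC⟩ := exists_samuel_le (R := R) (J := G.irrelevant) (c := 1)
    (by exact_mod_cast G.length_quotient_irrelevant_le) D _ hD
  refine supportedBelow_of_sum_le (C := C) ha fun s n => ?_
  have h1 := (sum_hilb_le hX φ hφ hker s n).trans (hC _)
  have h2 : ∀ j, G.hilb X Y s j = ((G.hilb X Y s j).toNat : ℕ∞) := fun j =>
    (ENat.natCast_toNat (hilb_ne_top hX hYX s j)).symm
  rw [Finset.sum_congr rfl fun j _ => h2 j] at h1
  have h3 : s + 1 + n + 1 = s + n + 2 := by ring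
  rw [h3] at h1
  exact_mod_cast h1

end ModuleGrading

end Degree

/-! ### Additivity on short exact sequences up to terms of lower degree -/

section Additivity

lemma GrowthAtMost.shift {D j : ℕ} {d : ℕ → ℕ → ℤ} (hd : GrowthAtMost D j d) (u : ℕ) :
    GrowthAtMost D j (fun s n => d (s - u) n) := by
  obtain ⟨C, n₀, hC⟩ := hd
  refine ⟨(u + 1) ^ j * C, n₀ + u, fun s n hs hn => ?_⟩
  obtain ⟨w, rfl⟩ : ∃ w, s = w + u := ⟨s - u, by omega⟩
  have h1 := hC w n (by omega) (by omega)
  dsimp only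
  rw [Nat.add_sub_cancel]
  have h2 : ((w + u : ℕ) + n + 1 : ℤ) ^ j ≤ ((u + 1) * (w + n + 1) : ℤ) ^ j := by
    gcongr
    push_cast
    nlinarith
  have h3 : ((w : ℤ) + n + 1) ^ D ≤ ((w + u : ℕ) + n + 1 : ℤ) ^ D := by
    gcongr
    omega
  calc |d w n| * ((w + u : ℕ) + n + 1 : ℤ) ^ j ≤ |d w n| * ((u + 1) * (w + n + 1) : ℤ) ^ j := by
        gcongr
    _ = (u + 1) ^ j * (|d w n| * (w + n + 1 : ℤ) ^ j) := by rw [mul_pow]; ring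
    _ ≤ (u + 1) ^ j * (C * ((w + u : ℕ) + n + 1 : ℤ) ^ D) := by
        exact mul_le_mul_of_nonneg_left
          (h1.trans (mul_le_mul_of_nonneg_left h3 (by positivity))) (by positivity)
    _ = _ := by push_cast; ring

lemma GrowthAtMost.sub_shift {D j : ℕ} {a : ℕ × ℕ →₀ ℤ} (ha : SupportedBelow D j a) (c : ℕ) :
    GrowthAtMost D (j + 1) (fun s n => binomialEval a s n - binomialEval a (s - c) n) := by
  obtain ⟨b, hbs, hb⟩ := exists_difference_fst a ha
  induction c with
  | zero => exact ⟨0, 0, fun s n _ _ => by simp⟩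
  | succ c ih =>
    refine (ih.add ((GrowthAtMost.of_supportedBelow b hbs).shift c)).mono (n₀ := c + 1)
      fun s n hs _ => le_of_eq ?_
    congr 1
    obtain ⟨w, rfl⟩ : ∃ w, s = w + 1 + c := ⟨s - (c + 1), by omega⟩
    rw [show w + 1 + c - (c + 1) = w by omega, show w + 1 + c - c = w + 1 by omega, ← hb w n]
    ring

/-- The dimension of the support of the subquotient `Z / Y`. -/
def subquotientDim {S P : Type*} [CommRing S] [AddCommGroup P] [Module S P]
    (Z Y : Submodule S P) : WithBot ℕ∞ :=
  Module.supportDim S (Z ⧸ Y.submoduleOf Z)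

open IsLocalRing

variable {R S P : Type*} [CommRing R] [IsLocalRing R] [CommRing S] [Algebra R S]
    [AddCommGroup P] [Module R P] [Module S P] [IsScalarTower R S P]

namespace ModuleGrading

variable {G : ModuleGrading R S P}

/-- The Artin-Rees lemma for the `𝔪`-adic filtration, in each degree with the same constant. -/
lemma exists_pow_smul_piece_inf_le [IsNoetherianRing S] {X Z : Submodule S P}
    (hX : G.IsHomogeneous X) (hZ : G.IsHomogeneous Z) (hfg : X.FG) :
    ∃ c, ∀ s n, c ≤ s → maximalIdeal R ^ s • G.piece X n ⊓ G.piece Z n ≤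
      maximalIdeal R ^ (s - c) • G.piece Z n := by
  have : Module.Finite S X := Module.Finite.iff_fg.2 hfg
  obtain ⟨c, hc⟩ := ((maximalIdeal R).map (algebraMap R S)).exists_pow_inf_eq_pow_smul
    (Z.submoduleOf X)
  refine ⟨c, fun s n hs z hz => ?_⟩
  obtain ⟨hz1, hz2⟩ := hz
  have h1 : z ∈ (maximalIdeal R).map (algebraMap R S) ^ s • X := by
    have := Submodule.smul_mono (le_refl (maximalIdeal R ^ s)) (piece_le hX n) hz1
    rw [← Ideal.smul_restrictScalars, Ideal.map_pow] at this
    exact this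
  have h2 : z ∈ ((maximalIdeal R).map (algebraMap R S) ^ s • (⊤ : Submodule S X)).map X.subtype := by
    rwa [Submodule.map_smul'', Submodule.map_top, Submodule.range_subtype]
  obtain ⟨w, hw, rfl⟩ := h2
  have h3 : w ∈ (maximalIdeal R).map (algebraMap R S) ^ (s - c) • Z.submoduleOf X := by
    have := (hc s hs).le ⟨hw, piece_le hZ n hz2⟩
    exact Submodule.smul_mono le_rfl inf_le_right this
  have h4 : (w : P) ∈ (maximalIdeal R).map (algebraMap R S) ^ (s - c) • Z := by
    have := Submodule.mem_map_of_mem (f := X.subtype) h3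
    rw [Submodule.map_smul''] at this
    exact Submodule.smul_mono le_rfl (Submodule.map_comap_le _ _) this
  rw [← Ideal.map_pow] at h4
  have h5 : (w : P) ∈ maximalIdeal R ^ (s - c) • Z.restrictScalars R := by
    rw [← Ideal.smul_restrictScalars]
    exact h4
  rw [piece, ← Submodule.map_smul'']
  exact ⟨w, h5, proj_eq_self_of_mem_piece hz2⟩

lemma supportedBelow_of_subquotientDim_le [IsNoetherianRing S] {X Y : Submodule S P}
    (hX : G.IsHomogeneous X) (hfg : X.FG) (hYX : Y ≤ X) {D n₀ : ℕ} (hD : subquotientDim X Y ≤ D)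
    {a : ℕ × ℕ →₀ ℤ} (ha : ∀ s n, n₀ ≤ s → n₀ ≤ n →
      ((G.hilb X Y s n).toNat : ℤ) = binomialEval a s n) : SupportedBelow D 1 a :=
  supportedBelow_of_supportDim_le hX hfg hYX (Y.submoduleOf X).mkQ (Submodule.mkQ_surjective _)
    (fun _ hz => (Submodule.Quotient.mk_eq_zero (Y.submoduleOf X)).1 hz) hD ha

/-- Hilbert polynomials are additive on short exact sequences `0 → Z / Y → X / Y → X / Z → 0`
up to terms of degree at most `D - 2`, if the dimension of `Z / Y` is at most `D`.  By the
Artin-Rees lemma, the filtration that the `𝔪`-adic filtration of `X / Y` induces on `Z / Y` lies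
between the `𝔪`-adic filtration and its shift by a constant, and shifting changes the Hilbert
polynomial only in degree less than `D - 1`. -/
theorem growthAtMost_hilb_add_sub [IsNoetherianRing R] [IsNoetherianRing S] {X Y Z : Submodule S P}
    (hX : G.IsHomogeneous X) (hZ : G.IsHomogeneous Z) (hfg : X.FG) (hYZ : Y ≤ Z) (hZX : Z ≤ X)
    {D : ℕ} (hD : subquotientDim Z Y ≤ D) :
    GrowthAtMost D 2 fun s n => ((G.hilb X Z s n).toNat : ℤ) + (G.hilb Z Y s n).toNat -
      (G.hilb X Y s n).toNat := by
  have hXn : IsNoetherian S X := isNoetherian_of_fg_of_noetherian _ hfg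
  have hZn : IsNoetherian S Z := isNoetherian_of_le hZX
  have hZfg : Z.FG := Module.Finite.iff_fg.1 inferInstance
  obtain ⟨a, n₀, ha⟩ := exists_hilb_eq_binomialEval hZ hZfg hYZ
  have hsupp := supportedBelow_of_subquotientDim_le hZ hZfg hYZ hD ha
  obtain ⟨c, hc⟩ := exists_pow_smul_piece_inf_le hX hZ hfg
  refine (GrowthAtMost.sub_shift hsupp c).mono (n₀ := n₀ + c) fun s n hs hn => ?_
  rw [← ha s n (by omega) (by omega), ← ha (s - c) n (by omega) (by omega)]
  set A := maximalIdeal R ^ (s + 1) • G.piece X n ⊔ G.piece Y n with hA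
  have hYZn := piece_mono (G := G) hYZ n
  have hZXn := piece_mono (G := G) hZX n
  have h1 : G.hilb X Y s n = G.hilb X Z s n + qlen (G.piece Z n) A := by
    rw [hilb, hilb, ← qlen_sup (G.piece Z n) A]
    have : G.piece Z n ⊔ A = maximalIdeal R ^ (s + 1) • G.piece X n ⊔ G.piece Z n := by
      rw [hA, sup_left_comm, sup_eq_left.2 hYZn]
    rw [this]
    exact qlen_add (sup_le_sup_left hYZn _) (sup_le Submodule.smul_le_right hZXn)
  have h2 : qlen (G.piece Z n) A ≤ G.hilb Z Y s n :=
    qlen_anti (sup_le_sup_right (Submodule.smul_mono le_rfl hZXn) _)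
  have h3 : G.hilb Z Y (s - c) n ≤ qlen (G.piece Z n) A := by
    have : qlen (G.piece Z n) A = qlen (G.piece Z n) (A ⊓ G.piece Z n) :=
      qlen_congr (by rw [inf_assoc, inf_idem])
    rw [this]
    refine qlen_anti ?_
    rw [hA, sup_comm, sup_inf_assoc_of_le _ hYZn, sup_comm]
    refine sup_le_sup_right ?_ _
    have := hc (s + 1) n (by omega)
    rwa [show s + 1 - c = s - c + 1 by omega] at this
  have e1 := ENat.toNat_add (hilb_ne_top (G := G) hX hZX s n)
    (ne_top_of_le_ne_top (hilb_ne_top (G := G) hZ hYZ s n) h2)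
  rw [← h1] at e1
  have e2 := ENat.toNat_le_toNat h2 (hilb_ne_top (G := G) hZ hYZ s n)
  have e3 := ENat.toNat_le_toNat h3
    (ne_top_of_le_ne_top (hilb_ne_top (G := G) hZ hYZ s n) h2)
  rw [abs_of_nonneg (by omega), abs_of_nonneg (by omega)]
  omega

end ModuleGrading

end Additivity

/-! ### Dimension of modules over the Rees algebra -/

section ReesDimension

open Polynomial

/-- Every chain of primes lies above its smallest member. -/
lemma ringKrullDim_le_of_forall_quotient_prime {B : Type*} [CommRing B] {D : ℕ}
    (h : ∀ P : Ideal B, P.IsPrime → ringKrullDim (B ⧸ P) ≤ D) : ringKrullDim B ≤ D := by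
  rw [ringKrullDim, Order.krullDim]
  refine iSup_le fun l => ?_
  have h1 := h l.head.asIdeal l.head.isPrime
  rw [ringKrullDim_quotient] at h1
  let l' : LTSeries (PrimeSpectrum.zeroLocus (R := B) l.head.asIdeal) :=
    { length := l.length
      toFun := fun i => ⟨l i, by
        rw [PrimeSpectrum.mem_zeroLocus]
        exact l.head_le i⟩
      step := fun i => l.step i }
  exact (le_iSup (fun p : LTSeries (PrimeSpectrum.zeroLocus (R := B) l.head.asIdeal) =>
    (p.length : WithBot ℕ∞)) l').trans h1

lemma le_of_add_one_le_natCast_add_one {x : WithBot ℕ∞} {D : ℕ} (h : x + 1 ≤ (D : WithBot ℕ∞) + 1) :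
    x ≤ D := by
  cases x with
  | bot => exact bot_le
  | coe d =>
    have h' : d + 1 ≤ (D : ℕ∞) + 1 := by exact_mod_cast h
    exact_mod_cast (ENat.add_le_add_iff_right ENat.one_ne_top).1 h'

/-- Adjoining an element that is algebraic over a Noetherian domain does not raise the dimension. -/
lemma ringKrullDim_adjoin_singleton_le {B L : Type*} [CommRing B] [IsDomain B] [IsNoetherianRing B]
    [CommRing L] [Algebra B L] {x : L} (hx : IsAlgebraic B x) {D : ℕ} (hD : ringKrullDim B ≤ D) :
    ringKrullDim (Algebra.adjoin B {x}) ≤ D := by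
  obtain ⟨p, hp, hpx⟩ := hx
  obtain ⟨φ, hφ, hφx⟩ : ∃ φ : B[X] →+* Algebra.adjoin B {x},
      Function.Surjective φ ∧ ∀ p, (φ p : L) = aeval x p := by
    refine ⟨((aeval x).codRestrict (Algebra.adjoin B {x}) fun p => ?_).toRingHom, ?_, fun _ => rfl⟩
    · rw [Algebra.adjoin_singleton_eq_range_aeval]
      exact ⟨p, rfl⟩
    · rintro ⟨y, hy⟩
      obtain ⟨p, rfl⟩ := (Algebra.adjoin_singleton_eq_range_aeval B x).le hy
      exact ⟨p, rfl⟩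
  refine le_of_add_one_le_natCast_add_one ?_
  refine (ringKrullDim_succ_le_of_surjective φ hφ (mem_nonZeroDivisors_of_ne_zero hp)
    (Subtype.ext ((hφx p).trans hpx))).trans ?_
  rw [Polynomial.ringKrullDim_of_isNoetherianRing]
  gcongr

/-- The Rees algebra of a nonzero ideal in a Noetherian domain is obtained from the subalgebra
`B[bX]`, for some `b ≠ 0`, by adjoining elements `aX`, which are algebraic as `b · aX = a · bX`. -/
lemma ringKrullDim_reesAlgebra_le {B : Type*} [CommRing B] [IsDomain B] [IsNoetherianRing B]
    {J : Ideal B} {b : B} (hbJ : b ∈ J) (hb : b ≠ 0) {D : ℕ} (hD : ringKrullDim B ≤ D) :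
    ringKrullDim (reesAlgebra J) ≤ (D + 1 : ℕ) := by
  classical
  have key : ∀ T : Finset B, ringKrullDim (Algebra.adjoin B
      (insert (monomial 1 b : B[X]) ((fun a => monomial 1 a) '' (T : Set B)))) ≤ (D + 1 : ℕ) := by
    intro T
    induction T using Finset.induction_on with
    | empty =>
      rw [Finset.coe_empty, Set.image_empty, insert_empty_eq,
        Algebra.adjoin_singleton_eq_range_aeval]
      refine (ringKrullDim_le_of_surjective (aeval (monomial 1 b)).rangeRestrict.toRingHom
        (aeval (monomial 1 b)).rangeRestrict_surjective).trans ?_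
      rw [Polynomial.ringKrullDim_of_isNoetherianRing]
      push_cast
      gcongr
    | insert a T _ ih =>
      rw [Finset.coe_insert, Set.image_insert_eq, Set.insert_comm, ← Set.union_singleton,
        Algebra.adjoin_union_eq_adjoin_adjoin]
      set C := Algebra.adjoin B
        (insert (monomial 1 b : B[X]) ((fun a => monomial 1 a) '' (T : Set B))) with hC
      change ringKrullDim (Algebra.adjoin C {(monomial 1 a : B[X])}) ≤ _
      have hCn : IsNoetherianRing C := by
        refine isNoetherianRing_of_fg
          ⟨insert (monomial 1 b) (T.image fun a => monomial 1 a), ?_⟩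
        rw [hC, Finset.coe_insert, Finset.coe_image]
      refine ringKrullDim_adjoin_singleton_le ?_ ih
      have hbC : (monomial 1 b : B[X]) ∈ C := Algebra.subset_adjoin (Set.mem_insert _ _)
      refine ⟨Polynomial.C (algebraMap B C b) * X - Polynomial.C (a • (⟨monomial 1 b, hbC⟩ : C)),
        ?_, ?_⟩
      · intro h0
        have h1 := congrArg (fun p => p.coeff 1) h0
        simp only [coeff_sub, coeff_C_mul, coeff_X_one, mul_one, coeff_C_succ, sub_zero,
          coeff_zero] at h1
        have h2 : (algebraMap B B[X]) b = 0 := congrArg Subtype.val h1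
        exact hb (by simpa using h2)
      · simp only [map_sub, map_mul, aeval_C, aeval_X]
        change (algebraMap B B[X]) b * monomial 1 a - a • monomial 1 b = 0
        rw [Polynomial.algebraMap_eq, C_mul_monomial, smul_monomial, smul_eq_mul, mul_comm, sub_self]
  obtain ⟨T, hT⟩ : J.FG := IsNoetherian.noetherian J
  have hJ : reesAlgebra J = Algebra.adjoin B
      (insert (monomial 1 b : B[X]) ((fun a => monomial 1 a) '' (T : Set B))) := by
    rw [← adjoin_monomial_eq_reesAlgebra]
    refine le_antisymm (Algebra.adjoin_le ?_) (Algebra.adjoin_mono ?_)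
    · rintro _ ⟨a, ha, rfl⟩
      replace ha : a ∈ Submodule.span B (T : Set B) := hT.ge ha
      induction ha using Submodule.span_induction with
      | mem a ha => exact Algebra.subset_adjoin (Set.mem_insert_of_mem _ ⟨a, ha, rfl⟩)
      | zero => rw [map_zero]; exact Subalgebra.zero_mem _
      | add a c _ _ ha hc => rw [map_add]; exact Subalgebra.add_mem _ ha hc
      | smul a c _ hc => rw [map_smul]; exact Subalgebra.smul_mem _ hc a
    · rintro _ (rfl | ⟨a, ha, rfl⟩)
      · exact ⟨b, hbJ, rfl⟩
      · exact ⟨a, hT.le (Submodule.subset_span ha), rfl⟩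
  rw [hJ]
  exact key T

variable {A : Type*} [CommRing A] {I : Ideal A}

/-- The map from the Rees algebra of `I` to the Rees algebra of the image of `I` in `A / q`. -/
def reesQuotient (I q : Ideal A) :
    reesAlgebra I →+* reesAlgebra (I.map (Ideal.Quotient.mk q)) :=
  ((mapRingHom (Ideal.Quotient.mk q)).comp (reesAlgebra I).val.toRingHom).codRestrict
    (reesAlgebra (I.map (Ideal.Quotient.mk q))).toSubring (fun f i => by
      change ((f : A[X]).map (Ideal.Quotient.mk q)).coeff i ∈ _
      rw [coeff_map, ← Ideal.map_pow]
      exact Ideal.mem_map_of_mem _ (f.2 i))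

lemma reesQuotient_coeff (I q : Ideal A) (f : reesAlgebra I) (i : ℕ) :
    (reesQuotient I q f : (A ⧸ q)[X]).coeff i = Ideal.Quotient.mk q ((f : A[X]).coeff i) :=
  coeff_map _ _

lemma reesQuotient_surjective (I q : Ideal A) : Function.Surjective (reesQuotient I q) := by
  rintro ⟨g, hg⟩
  have h1 : ∀ i, ∃ a ∈ I ^ i, Ideal.Quotient.mk q a = g.coeff i := by
    intro i
    have := hg i
    rw [← Ideal.map_pow] at this
    exact (Ideal.mem_map_iff_of_surjective _ Ideal.Quotient.mk_surjective).1 this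
  choose a ha hag using h1
  refine ⟨∑ i ∈ g.support, ⟨monomial i (a i), reesAlgebra.monomial_mem.2 (ha i)⟩, ?_⟩
  refine Subtype.ext (Polynomial.ext fun i => ?_)
  rw [reesQuotient_coeff]
  simp only [AddSubmonoidClass.coe_finsetSum, finsetSum_coeff, coeff_monomial,
    Finset.sum_ite_eq', mem_support_iff]
  split_ifs with h
  · exact hag i
  · rw [map_zero]
    exact (notMem_support_iff.1 h).symm

/-- A finite module over the Rees algebra `⨁ I^i t^i` that is killed by `I` and by the polynomials
with coefficients in `a` has dimension at most `dim A / a`.  A prime of the Rees algebra containing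
these elements contains the contraction `Q` of `q[t]` for some prime `q` of `A`, and strictly so
unless `I ⊆ q`; the quotient by `Q` is the Rees algebra of the image of `I` in `A / q`. -/
theorem supportDim_reesAlgebra_le [IsNoetherianRing A] (a : Ideal A) {D : ℕ} (hD : ringKrullDim (A ⧸ a) ≤ D)
    (N : Type*) [AddCommGroup N] [Module (reesAlgebra I) N] [Module.Finite (reesAlgebra I) N]
    (hI : ∀ x ∈ I, ∀ z : N, algebraMap A (reesAlgebra I) x • z = 0)
    (ha : ∀ f : reesAlgebra I, (∀ i, (f : A[X]).coeff i ∈ a) → ∀ z : N, f • z = 0) :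
    Module.supportDim (reesAlgebra I) N ≤ D := by
  rw [Module.supportDim_eq_ringKrullDim_quotient_annihilator]
  refine ringKrullDim_le_of_forall_quotient_prime fun P' hP' => ?_
  set P : Ideal (reesAlgebra I) := P'.comap (Ideal.Quotient.mk _) with hP
  have hPprime : P.IsPrime := Ideal.comap_isPrime _ _
  have hann : Module.annihilator (reesAlgebra I) N ≤ P := by
    intro f hf
    rw [hP, Ideal.mem_comap, Ideal.Quotient.eq_zero_iff_mem.2 hf]
    exact P'.zero_mem
  have hIP : ∀ x ∈ I, algebraMap A (reesAlgebra I) x ∈ P := fun x hx =>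
    hann (Module.mem_annihilator.2 (hI x hx))
  let π : reesAlgebra I →+* (_ ⧸ P') := (Ideal.Quotient.mk P').comp (Ideal.Quotient.mk _)
  have hπ : Function.Surjective π :=
    Ideal.Quotient.mk_surjective.comp Ideal.Quotient.mk_surjective
  have hπP : ∀ f, π f = 0 ↔ f ∈ P := fun f => Ideal.Quotient.eq_zero_iff_mem
  obtain ⟨p, hap, hp, hpP⟩ := Ideal.exists_ideal_comap_le_prime
    (f := (reesAlgebra I).val.toRingHom) P (a.map C) (by
      intro f hf
      exact hann (Module.mem_annihilator.2 (ha f (Ideal.mem_map_C_iff.1 hf))))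
  set q : Ideal A := p.comap C with hq
  have hqprime : q.IsPrime := Ideal.comap_isPrime _ _
  have haq : a ≤ q := fun x hx => hap (Ideal.mem_map_of_mem _ hx)
  have hDq : ringKrullDim (A ⧸ q) ≤ D :=
    (ringKrullDim_le_of_surjective _ (Ideal.Quotient.factor_surjective haq)).trans hD
  have hqP : ∀ f : reesAlgebra I, (∀ i, (f : A[X]).coeff i ∈ q) → f ∈ P := by
    intro f hf
    refine hpP ?_
    have : q.map C ≤ p := Ideal.map_comap_le
    exact this (Ideal.mem_map_C_iff.2 hf)
  by_cases hIq : I ≤ q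
  -- In this case `reesAlgebra I ⧸ P` is a quotient of `A ⧸ q`.
  · let g : A →+* (_ ⧸ P') := π.comp (algebraMap A (reesAlgebra I))
    have hg : Function.Surjective g := by
      intro y
      obtain ⟨f, rfl⟩ := hπ y
      refine ⟨(f : A[X]).coeff 0, ?_⟩
      change π _ = π f
      rw [← sub_eq_zero, ← map_sub, hπP]
      refine hqP _ fun i => ?_
      change ((C ((f : A[X]).coeff 0) : A[X]) - f).coeff i ∈ q
      cases i with
      | zero => simp
      | succ i =>
        rw [coeff_sub, coeff_C_succ, zero_sub]
        exact q.neg_mem (hIq (Ideal.pow_le_self (Nat.succ_ne_zero i) (f.2 (i + 1))))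
    have hgq : ∀ x ∈ q, g x = 0 := by
      intro x hx
      refine (hπP _).2 (hqP _ fun i => ?_)
      change (C x : A[X]).coeff i ∈ q
      rw [coeff_C]
      split_ifs
      exacts [hx, q.zero_mem]
    exact (ringKrullDim_le_of_surjective (Ideal.Quotient.lift q g hgq)
      (Ideal.Quotient.lift_surjective_of_surjective _ _ hg)).trans hDq
  -- Otherwise it is a proper quotient of the domain `reesAlgebra (I (A ⧸ q))`.
  · obtain ⟨b, hbI, hbq⟩ := SetLike.not_le_iff_exists.1 hIq
    have hker : RingHom.ker (reesQuotient I q) ≤ RingHom.ker π := by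
      intro f hf
      rw [RingHom.mem_ker] at hf ⊢
      refine (hπP f).2 (hqP f fun i => ?_)
      rw [← Ideal.Quotient.eq_zero_iff_mem, ← reesQuotient_coeff, hf]
      simp
    let g : reesAlgebra (I.map (Ideal.Quotient.mk q)) →+* (_ ⧸ P') :=
      RingHom.liftOfSurjective (reesQuotient I q) (reesQuotient_surjective I q) ⟨π, hker⟩
    have hgπ : ∀ f, g (reesQuotient I q f) = π f := fun f =>
      RingHom.liftOfRightInverse_comp_apply _ _ _ ⟨π, hker⟩ f
    have hg : Function.Surjective g := by
      intro y
      obtain ⟨f, rfl⟩ := hπ y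
      exact ⟨_, hgπ f⟩
    have hb0 : Ideal.Quotient.mk q b ≠ 0 := fun h => hbq (Ideal.Quotient.eq_zero_iff_mem.1 h)
    have hne : reesQuotient I q (algebraMap A (reesAlgebra I) b) ≠ 0 := by
      intro h
      have h1 := reesQuotient_coeff I q (algebraMap A (reesAlgebra I) b) 0
      rw [h] at h1
      have h2 : ((algebraMap A (reesAlgebra I) b : reesAlgebra I) : A[X]).coeff 0 = b :=
        coeff_C_zero
      rw [h2] at h1
      exact hb0 (by simpa using h1.symm)
    refine le_of_add_one_le_natCast_add_one ?_
    refine (ringKrullDim_succ_le_of_surjective g hg (mem_nonZeroDivisors_of_ne_zero hne) ?_).trans ?_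
    · rw [hgπ, hπP]
      exact hIP b hbI
    · have := ringKrullDim_reesAlgebra_le (Ideal.mem_map_of_mem (Ideal.Quotient.mk q) hbI) hb0 hDq
      exact_mod_cast this

end ReesDimension

/-! ### The grading of the Rees algebra and of its modules -/

section ReesGrading

open Polynomial DirectSum

variable {R A : Type*} [CommRing R] [CommRing A]

section Generators

variable [Algebra R A] {𝒜 : ℕ → Submodule R A} [GradedAlgebra 𝒜]

/-- The component of degree zero of a standard graded algebra is the image of the base ring. -/
lemma IsStandardGraded.mem_range_of_mem_zero (h𝒜 : IsStandardGraded R 𝒜) {a : A}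
    (ha : a ∈ 𝒜 0) : ∃ r, algebraMap R A r = a := by
  have key : ∀ b : A, ∃ r, algebraMap R A r = GradedRing.projZeroRingHom 𝒜 b := by
    intro b
    have hb : b ∈ Algebra.adjoin R (𝒜 1 : Set A) := by
      rw [show Algebra.adjoin R (𝒜 1 : Set A) = ⊤ from h𝒜]
      trivial
    induction hb using Algebra.adjoin_induction with
    | mem x hx =>
      refine ⟨0, ?_⟩
      rw [map_zero, GradedRing.projZeroRingHom_apply, decompose_of_mem_ne 𝒜 hx one_ne_zero]
    | algebraMap r =>
      refine ⟨r, ?_⟩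
      rw [GradedRing.projZeroRingHom_apply,
        decompose_of_mem_same 𝒜 (SetLike.algebraMap_mem_graded 𝒜 r)]
    | add x y _ _ hx hy =>
      obtain ⟨r, hr⟩ := hx
      obtain ⟨r', hr'⟩ := hy
      exact ⟨r + r', by rw [map_add, map_add, hr, hr']⟩
    | mul x y _ _ hx hy =>
      obtain ⟨r, hr⟩ := hx
      obtain ⟨r', hr'⟩ := hy
      exact ⟨r * r', by rw [map_mul, map_mul, hr, hr']⟩
  obtain ⟨r, hr⟩ := key a
  exact ⟨r, by rw [hr, GradedRing.projZeroRingHom_apply, decompose_of_mem_same 𝒜 ha]⟩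

/-- A Noetherian standard graded algebra is generated by finitely many linear forms. -/
lemma IsStandardGraded.exists_finset_adjoin_eq_top [IsNoetherianRing A]
    (h𝒜 : IsStandardGraded R 𝒜) :
    ∃ T : Finset A, (T : Set A) ⊆ 𝒜 1 ∧ Algebra.adjoin R (T : Set A) = ⊤ := by
  obtain ⟨T, hT, hspan⟩ := (Submodule.fg_span_iff_fg_span_finset_subset (𝒜 1 : Set A)).1
    (IsNoetherian.noetherian (R := A) _)
  refine ⟨T, hT, ?_⟩
  rw [← top_le_iff, ← show Algebra.adjoin R (𝒜 1 : Set A) = ⊤ from h𝒜]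
  refine Algebra.adjoin_le fun x hx => ?_
  have key : ∀ y ∈ Submodule.span A (T : Set A),
      (decompose 𝒜 y 1 : A) ∈ Algebra.adjoin R (T : Set A) := by
    intro y hy
    induction hy using Submodule.closure_induction with
    | zero => rw [decompose_zero]; exact Subalgebra.zero_mem _
    | add y z _ _ hy hz => rw [decompose_add]; exact Subalgebra.add_mem _ hy hz
    | smul_mem a t ht =>
      obtain ⟨r, hr⟩ := h𝒜.mem_range_of_mem_zero (decompose 𝒜 a 0).2
      rw [smul_eq_mul, coe_decompose_mul_of_right_mem_of_le 𝒜 (hT ht) le_rfl, Nat.sub_self, ← hr]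
      exact Subalgebra.mul_mem _ (Subalgebra.algebraMap_mem _ r) (Algebra.subset_adjoin ht)
  have h1 := key x (hspan ▸ Submodule.subset_span hx)
  rwa [decompose_of_mem_same 𝒜 hx] at h1

omit [GradedAlgebra 𝒜] in
lemma IsGeneratedByLinearForms.exists_finset [IsNoetherianRing A] {I : Ideal A}
    (hI : IsGeneratedByLinearForms 𝒜 I) :
    ∃ V : Finset A, (V : Set A) ⊆ 𝒜 1 ∧ I = Ideal.span (V : Set A) := by
  obtain ⟨W, hW, rfl⟩ := hI
  obtain ⟨V, hV, hspan⟩ := (Submodule.fg_span_iff_fg_span_finset_subset W).1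
    (IsNoetherian.noetherian (R := A) _)
  exact ⟨V, hV.trans hW, hspan⟩

end Generators

section Component

variable {M : Type*} [AddCommGroup M] [Module R M] (ℳ : ℕ → Submodule R M) [Decomposition ℳ]

/-- The projection of a graded module onto its component of degree `n`. -/
def componentMap (n : ℕ) : M →ₗ[R] M :=
  (ℳ n).subtype ∘ₗ DirectSum.component R ℕ (fun i => ℳ i) n ∘ₗ
    (decomposeLinearEquiv ℳ).toLinearMap

variable {ℳ}

lemma componentMap_of_mem {m n : ℕ} {x : M} (hx : x ∈ ℳ n) :
    componentMap ℳ m x = if m = n then x else 0 := by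
  split_ifs with h
  · subst h
    exact decompose_of_mem_same ℳ hx
  · exact decompose_of_mem_ne ℳ hx (Ne.symm h)

lemma componentMap_mem (n : ℕ) (x : M) : componentMap ℳ n x ∈ ℳ n := (decompose ℳ x n).2

lemma componentMap_comm {M' : Type*} [AddCommGroup M'] [Module R M'] {ℳ' : ℕ → Submodule R M'}
    [Decomposition ℳ'] (φ : M →+ M') {k : ℕ} (hφ : ∀ n, ∀ x ∈ ℳ n, φ x ∈ ℳ' (n + k))
    (n : ℕ) (x : M) : componentMap ℳ' (n + k) (φ x) = φ (componentMap ℳ n x) := by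
  induction x using Decomposition.inductionOn ℳ with
  | zero => simp
  | homogeneous x =>
    rw [componentMap_of_mem x.2, componentMap_of_mem (hφ _ _ x.2)]
    simp only [Nat.add_right_cancel_iff]
    split_ifs <;> simp
  | add x y hx hy => rw [map_add, map_add, map_add, map_add, hx, hy]

lemma componentMap_eq_zero {M' : Type*} [AddCommGroup M'] [Module R M'] {ℳ' : ℕ → Submodule R M'}
    [Decomposition ℳ'] (φ : M →+ M') {k : ℕ} (hφ : ∀ n, ∀ x ∈ ℳ n, φ x ∈ ℳ' (n + k))
    {n : ℕ} (hn : n < k) (x : M) : componentMap ℳ' n (φ x) = 0 := by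
  induction x using Decomposition.inductionOn ℳ with
  | zero => simp
  | homogeneous x =>
    rw [componentMap_of_mem (hφ _ _ x.2), if_neg (by omega)]
  | add x y hx hy => rw [map_add, map_add, hx, hy, add_zero]

end Component

section LinearForm

variable [Algebra R A] {𝒜 : ℕ → Submodule R A} {M : Type*} [AddCommGroup M] [Module R M] [Module A M]
    {ℳ : ℕ → Submodule R M} [Decomposition ℳ] [SetLike.GradedSMul 𝒜 ℳ]

variable (𝒜) in
lemma componentMap_succ_smul {a : A} (ha : a ∈ 𝒜 1) (n : ℕ) (x : M) :
    componentMap ℳ (n + 1) (a • x) = a • componentMap ℳ n x :=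
  componentMap_comm (DistribSMul.toAddMonoidHom M a)
    (fun n x hx => by
      have := SetLike.GradedSMul.smul_mem (A := 𝒜) (B := ℳ) ha hx
      rwa [vadd_eq_add, add_comm] at this) n x

variable (𝒜) in
lemma componentMap_zero_smul {a : A} (ha : a ∈ 𝒜 1) (x : M) :
    componentMap ℳ 0 (a • x) = 0 :=
  componentMap_eq_zero (ℳ := ℳ) (DistribSMul.toAddMonoidHom M a)
    (fun n x hx => by
      have := SetLike.GradedSMul.smul_mem (A := 𝒜) (B := ℳ) ha hx
      rwa [vadd_eq_add, add_comm] at this) one_pos x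

variable (𝒜) in
/-- Multiplication by an ideal generated by linear forms preserves homogeneous submodules. -/
lemma componentMap_mem_smul {V : Set A} (hV : V ⊆ 𝒜 1) {X : Submodule A M}
    (hX : ∀ x ∈ X, ∀ n, componentMap ℳ n x ∈ X) :
    ∀ x ∈ Ideal.span V • X, ∀ n, componentMap ℳ n x ∈ Ideal.span V • X := by
  intro x hx n
  induction hx using Submodule.smul_induction_on' with
  | add x _ y _ hx hy => rw [map_add]; exact Submodule.add_mem _ hx hy
  | smul r hr x hx =>
    induction hr using Submodule.span_induction generalizing x with
    | mem v hv =>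
      cases n with
      | zero => rw [componentMap_zero_smul 𝒜 (hV hv)]; exact Submodule.zero_mem _
      | succ n =>
        rw [componentMap_succ_smul 𝒜 (hV hv)]
        exact Submodule.smul_mem_smul (Submodule.subset_span hv) (hX x hx n)
    | zero => rw [zero_smul, map_zero]; exact Submodule.zero_mem _
    | add r r' _ _ hr hr' =>
      rw [add_smul, map_add]
      exact Submodule.add_mem _ (hr x hx) (hr' x hx)
    | smul a r _ hr =>
      rw [smul_eq_mul, mul_comm, mul_smul]
      exact hr (a • x) (X.smul_mem a hx)

end LinearForm

section CoeffMap

variable {M M' : Type*} [AddCommGroup M] [AddCommGroup M'] [Module A M] [Module A M']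
    [Module R M] [Module R M']

variable (A) in
/-- The coefficientwise extension of an `R`-linear map to polynomials. -/
def coeffMap (φ : M →ₗ[R] M') : PolynomialModule A M →ₗ[R] PolynomialModule A M' :=
  (PolynomialModule.coeffLinearEquiv A R).symm.toLinearMap ∘ₗ Finsupp.mapRange.linearMap φ ∘ₗ
    (PolynomialModule.coeffLinearEquiv A R).toLinearMap

@[simp]
lemma coeff_coeffMap (φ : M →ₗ[R] M') (z : PolynomialModule A M) (i : ℕ) :
    (coeffMap A φ z).coeff i = φ (z.coeff i) := rfl

lemma coeff_algebraMap_smul {I : Ideal A} (a : A) (z : PolynomialModule A M) (i : ℕ) :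
    (algebraMap A (reesAlgebra I) a • z).coeff i = a • z.coeff i := by
  rw [algebraMap_smul]
  rfl

end CoeffMap

section Grading

variable [Algebra R A] {𝒜 : ℕ → Submodule R A} {I : Ideal A} {M : Type*} [AddCommGroup M] [Module A M]
    [Module R M] [IsScalarTower R A M]

/-- The Rees algebra is generated by generators of `A` and the elements `v t`, for generators `v` of
`I`. -/
lemma adjoin_reesAlgebra_eq_top {T V : Set A} (hT : Algebra.adjoin R T = ⊤)
    (hV : I = Ideal.span V) {B : Set (reesAlgebra I)}
    (hB : Subtype.val '' B = (C '' T ∪ monomial 1 '' V : Set A[X])) : Algebra.adjoin R B = ⊤ := by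
  have key : ∀ f ∈ reesAlgebra I, f ∈ Algebra.adjoin R (C '' T ∪ monomial 1 '' V : Set A[X]) := by
    have hC : ∀ a, C a ∈ Algebra.adjoin R (C '' T ∪ monomial 1 '' V : Set A[X]) := by
      intro a
      have ha : a ∈ Algebra.adjoin R T := by rw [hT]; trivial
      have h1 : CAlgHom (R := R) a ∈ (Algebra.adjoin R T).map (CAlgHom (R := R)) := ⟨a, ha, rfl⟩
      rw [AlgHom.map_adjoin] at h1
      exact Algebra.adjoin_mono Set.subset_union_left h1
    intro f hf
    rw [← adjoin_monomial_eq_reesAlgebra] at hf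
    induction hf using Algebra.adjoin_induction with
    | mem f hf =>
      obtain ⟨r, hr, rfl⟩ := hf
      replace hr : r ∈ Submodule.span A V := hV.le hr
      induction hr using Submodule.span_induction with
      | mem v hv => exact Algebra.subset_adjoin (Or.inr ⟨v, hv, rfl⟩)
      | zero => rw [map_zero]; exact Subalgebra.zero_mem _
      | add x y _ _ hx hy => rw [map_add]; exact Subalgebra.add_mem _ hx hy
      | smul a x _ hx =>
        rw [smul_eq_mul, ← C_mul_monomial]
        exact Subalgebra.mul_mem _ (hC a) hx
    | algebraMap a => exact hC a
    | add f g _ _ hf hg => exact Subalgebra.add_mem _ hf hg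
    | mul f g _ _ hf hg => exact Subalgebra.mul_mem _ hf hg
  rw [← top_le_iff]
  intro f _
  let val : reesAlgebra I →ₐ[R] A[X] := (reesAlgebra I).val.restrictScalars R
  have h1 : val f ∈ (Algebra.adjoin R B).map val := by
    rw [AlgHom.map_adjoin]
    change _ ∈ Algebra.adjoin R (Subtype.val '' B)
    rw [hB]
    exact key f f.2
  obtain ⟨f', hf', h⟩ := h1
  rwa [← Subtype.val_injective h]

/-- The internal grading of the polynomials with coefficients in a graded module `M`, as a module
over the Rees algebra of an ideal generated by linear forms; the variable has degree zero. -/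
def reesGrading (𝒜 : ℕ → Submodule R A) {T V : Finset A} (hT : Algebra.adjoin R (T : Set A) = ⊤)
    (hT1 : (T : Set A) ⊆ 𝒜 1) (hV : I = Ideal.span (V : Set A)) (hV1 : (V : Set A) ⊆ 𝒜 1)
    (ℳ : ℕ → Submodule R M) [Decomposition ℳ] [SetLike.GradedSMul 𝒜 ℳ] :
    ModuleGrading R (reesAlgebra I) (PolynomialModule A M) where
  gens := (((T.finite_toSet.image C).union (V.finite_toSet.image (monomial 1))).preimage
    (Subtype.val_injective (p := (· ∈ reesAlgebra I))).injOn).toFinset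
  proj n := coeffMap A (componentMap ℳ n)
  adjoin_gens := by
    refine adjoin_reesAlgebra_eq_top hT hV ?_
    rw [Set.Finite.coe_toFinset, Set.image_preimage_eq_iff, Subtype.range_coe_subtype]
    rintro _ (⟨a, _, rfl⟩ | ⟨v, hv, rfl⟩)
    · exact (reesAlgebra I).algebraMap_mem a
    · refine reesAlgebra.monomial_mem.2 ?_
      rw [pow_one, hV]
      exact Submodule.subset_span hv
  proj_proj m n z := by
    split_ifs with h
    · ext i
      rw [coeff_coeffMap, coeff_coeffMap, componentMap_of_mem (componentMap_mem _ _), if_pos h]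
    · ext i
      rw [coeff_coeffMap, coeff_coeffMap, componentMap_of_mem (componentMap_mem _ _), if_neg h]
      rfl
  exists_sum_proj z := by
    suffices h : ∃ N, ∀ N', N ≤ N' →
        ∑ n ∈ Finset.range N', coeffMap A (componentMap ℳ n) z = z by
      obtain ⟨N, hN⟩ := h
      exact ⟨N, hN N le_rfl⟩
    induction z using PolynomialModule.induction_linear with
    | zero => exact ⟨0, fun N' _ => by simp⟩
    | add x y hx hy =>
      obtain ⟨N₁, h₁⟩ := hx
      obtain ⟨N₂, h₂⟩ := hy
      refine ⟨max N₁ N₂, fun N' hN' => ?_⟩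
      simp only [map_add, Finset.sum_add_distrib]
      rw [h₁ N' (by omega), h₂ N' (by omega)]
    | single i m =>
      induction m using Decomposition.inductionOn ℳ with
      | zero => exact ⟨0, fun N' _ => by simp⟩
      | @homogeneous k m =>
        refine ⟨k + 1, fun N' hN' => ?_⟩
        have : ∀ n, coeffMap A (componentMap ℳ n) (PolynomialModule.single A i (m : M)) =
            if n = k then PolynomialModule.single A i (m : M) else 0 := by
          intro n
          ext j
          rw [coeff_coeffMap, PolynomialModule.coeff_single, Finsupp.single_apply]
          split_ifs with h1 h2 h2 <;> simp [componentMap_of_mem m.2, h1, h2]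
        rw [Finset.sum_congr rfl fun n _ => this n, Finset.sum_ite_eq', if_pos]
        exact Finset.mem_range.2 hN'
      | add x y hx hy =>
        obtain ⟨N₁, h₁⟩ := hx
        obtain ⟨N₂, h₂⟩ := hy
        refine ⟨max N₁ N₂, fun N' hN' => ?_⟩
        simp only [PolynomialModule.single_add, map_add, Finset.sum_add_distrib]
        rw [h₁ N' (by omega), h₂ N' (by omega)]
  proj_succ_smul := by
    rintro ⟨a, ha⟩ ha' n z
    ext i
    rw [Set.Finite.mem_toFinset] at ha'
    rcases ha' with ⟨t, ht, rfl : C t = a⟩ | ⟨v, hv, rfl : monomial 1 v = a⟩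
    · change componentMap ℳ (n + 1) ((C t • z).coeff i) =
        (C t • coeffMap A (componentMap ℳ n) z).coeff i
      rw [← monomial_zero_left, PolynomialModule.monomial_smul_apply,
        PolynomialModule.monomial_smul_apply, if_pos (Nat.zero_le i), if_pos (Nat.zero_le i)]
      exact componentMap_succ_smul 𝒜 (hT1 ht) _ _
    · change componentMap ℳ (n + 1) ((monomial 1 v • z).coeff i) =
        (monomial 1 v • coeffMap A (componentMap ℳ n) z).coeff i
      rw [PolynomialModule.monomial_smul_apply, PolynomialModule.monomial_smul_apply]
      split_ifs
      · exact componentMap_succ_smul 𝒜 (hV1 hv) _ _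
      · exact map_zero _
  proj_zero_smul := by
    rintro ⟨a, ha⟩ ha' z
    ext i
    rw [Set.Finite.mem_toFinset] at ha'
    rcases ha' with ⟨t, ht, rfl : C t = a⟩ | ⟨v, hv, rfl : monomial 1 v = a⟩
    · change componentMap ℳ 0 ((C t • z).coeff i) = 0
      rw [← monomial_zero_left, PolynomialModule.monomial_smul_apply, if_pos (Nat.zero_le i)]
      exact componentMap_zero_smul 𝒜 (hT1 ht) _
    · change componentMap ℳ 0 ((monomial 1 v • z).coeff i) = 0
      rw [PolynomialModule.monomial_smul_apply]
      split_ifs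
      · exact componentMap_zero_smul 𝒜 (hV1 hv) _
      · exact map_zero _

end Grading

end ReesGrading

/-! ### Comparison of Hilbert functions -/

section Transfer

open IsLocalRing

variable {R S P S' P' : Type*} [CommRing R] [IsLocalRing R] [CommRing S] [Algebra R S]
    [AddCommGroup P] [Module R P] [Module S P] [IsScalarTower R S P]
    [CommRing S'] [Algebra R S'] [AddCommGroup P'] [Module R P'] [Module S' P']
    [IsScalarTower R S' P']

namespace ModuleGrading

variable {G : ModuleGrading R S P} {G' : ModuleGrading R S' P'}

/-- Degree-preserving maps that induce an isomorphism of the subquotients preserve the Hilbert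
function. -/
lemma hilb_eq_of_map {X Y : Submodule S P} {X' Y' : Submodule S' P'} (hX : G.IsHomogeneous X)
    (hY : G.IsHomogeneous Y) (hYX : Y ≤ X) (φ : P →ₗ[R] P')
    (hφ : ∀ n z, φ (G.proj n z) = G'.proj n (φ z))
    (hX' : (X.restrictScalars R).map φ = X'.restrictScalars R)
    (hY' : (Y.restrictScalars R).map φ = Y'.restrictScalars R)
    (hker : ∀ z ∈ X, φ z = 0 → z ∈ Y) (s n : ℕ) : G.hilb X Y s n = G'.hilb X' Y' s n := by
  have hpiece : ∀ (Z : Submodule S P) (Z' : Submodule S' P'),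
      (Z.restrictScalars R).map φ = Z'.restrictScalars R →
      G'.piece Z' n = (G.piece Z n).map φ := by
    intro Z Z' h
    rw [piece, piece, ← h, ← Submodule.map_comp, ← Submodule.map_comp]
    congr 1
    exact LinearMap.ext fun z => (hφ n z).symm
  rw [hilb, hilb, hpiece X X' hX', hpiece Y Y' hY', ← Submodule.map_smul'', ← Submodule.map_sup]
  set A := maximalIdeal R ^ (s + 1) • G.piece X n ⊔ G.piece Y n with hA
  have hAX : A ≤ G.piece X n := sup_le Submodule.smul_le_right (piece_mono hYX n)
  rw [← sup_eq_left.2 (Submodule.map_mono (f := φ) hAX), ← qlen_map φ, Submodule.comap_map_eq]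
  refine qlen_congr ?_
  refine le_antisymm (inf_le_inf_right _ le_sup_left) fun z hz => ?_
  obtain ⟨hz1, hz2⟩ := hz
  refine ⟨?_, hz2⟩
  obtain ⟨w, hw, y, hy, rfl⟩ := Submodule.mem_sup.1 hz1
  refine A.add_mem hw ?_
  have hyX : y ∈ G.piece X n := by
    have := Submodule.sub_mem _ hz2 (hAX hw)
    rwa [add_sub_cancel_left] at this
  refine (le_sup_right : _ ≤ A) ((mem_piece_iff hY).2 ⟨hker y (piece_le hX n hyX) hy, ?_⟩)
  exact proj_eq_self_of_mem_piece hyX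

/-- The second isomorphism theorem for Hilbert functions. -/
lemma hilb_sup_eq_hilb_inf {X Y : Submodule S P} (hX : G.IsHomogeneous X)
    (hY : G.IsHomogeneous Y) (s n : ℕ) : G.hilb (X ⊔ Y) Y s n = G.hilb X (X ⊓ Y) s n := by
  rw [hilb, hilb, piece_sup, piece_inf hX hY, Submodule.smul_sup, sup_assoc,
    sup_eq_right.2 (Submodule.smul_le_right : maximalIdeal R ^ (s + 1) • G.piece Y n ≤ _)]
  set B := maximalIdeal R ^ (s + 1) • G.piece X n with hB
  have hBX : B ≤ G.piece X n := Submodule.smul_le_right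
  have h1 : G.piece X n ⊔ G.piece Y n = G.piece X n ⊔ (B ⊔ G.piece Y n) := by
    rw [← sup_assoc, sup_eq_left.2 hBX]
  rw [h1, qlen_sup]
  refine qlen_congr ?_
  rw [sup_inf_assoc_of_le _ hBX, inf_eq_left.2 (sup_le hBX inf_le_left), inf_comm]

end ModuleGrading

end Transfer

/-! ### Filtrations and their Rees modules -/

section Filtrations

open Polynomial

variable {A : Type*} [CommRing A] {I : Ideal A} {M : Type*} [AddCommGroup M] [Module A M]

/-- The filtration `F` with its indices shifted by `j`. -/
def shiftFiltration (F : I.Filtration M) (j : ℕ) : I.Filtration M where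
  N i := F.N (i + j)
  mono i := F.antitone (by omega)
  smul_le i := by
    rw [add_right_comm]
    exact F.smul_le (i + j)

lemma submodule_mono {F E : I.Filtration M} (h : ∀ i, E.N i ≤ F.N i) : E.submodule ≤ F.submodule :=
  fun _ hz i => h i (hz i)

lemma algebraMap_smul_mem {F E : I.Filtration M} (h : ∀ i, I • F.N i ≤ E.N i) {a : A} (ha : a ∈ I)
    {z : PolynomialModule A M} (hz : z ∈ F.submodule) :
    algebraMap A (reesAlgebra I) a • z ∈ E.submodule := by
  intro i
  rw [coeff_algebraMap_smul]
  exact h i (Submodule.smul_mem_smul ha (hz i))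

lemma exists_coeff_eq {F : I.Filtration M} {M' : Type*} [AddCommGroup M'] [Module A M']
    {z : PolynomialModule A M'} (c : ℕ → M)
    (hc : ∀ i, c i ∈ F.N i) (hz : ∀ i, z.coeff i = 0 → c i = 0) :
    ∃ w ∈ F.submodule, ∀ i, w.coeff i = c i := by
  refine ⟨PolynomialModule.ofCoeff A (Finsupp.onFinset z.coeff.support c fun i hi => ?_),
    fun i => hc i, fun i => rfl⟩
  rw [Finsupp.mem_support_iff]
  exact fun h => hi (hz i h)

lemma fg_of_le_stableFiltration [IsNoetherianRing A] [Module.Finite A M]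
    {X : Submodule (reesAlgebra I) (PolynomialModule A M)}
    (hX : X ≤ (I.stableFiltration (⊤ : Submodule A M)).submodule) : X.FG := by
  have h1 : (I.stableFiltration (⊤ : Submodule A M)).submodule.FG :=
    (Ideal.Filtration.submodule_fg_iff_stable _ fun i => IsNoetherian.noetherian _).2
      (I.stableFiltration_stable ⊤)
  have := isNoetherian_of_fg_of_noetherian _ h1
  have := isNoetherian_of_le hX
  exact Module.Finite.iff_fg.1 inferInstance

lemma smul_quotient_eq_zero {S P : Type*} [CommRing S] [AddCommGroup P] [Module S P]
    {Y Z : Submodule S P} {r : S} (h : ∀ z ∈ Z, r • z ∈ Y) (w : Z ⧸ Y.submoduleOf Z) :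
    r • w = 0 := by
  obtain ⟨z, rfl⟩ := Submodule.Quotient.mk_surjective _ w
  rw [← Submodule.Quotient.mk_smul, Submodule.Quotient.mk_eq_zero]
  exact h z z.2

lemma finite_quotient_submoduleOf {S P : Type*} [CommRing S] [AddCommGroup P] [Module S P]
    {Y Z : Submodule S P} (h : Z.FG) : Module.Finite S (Z ⧸ Y.submoduleOf Z) := by
  have : Module.Finite S Z := Module.Finite.iff_fg.2 h
  infer_instance

/-- A subquotient of `M[t]` killed by `I` has at most the dimension of `M` as a module over the Rees
algebra of `I`. -/
lemma subquotientDim_le [IsNoetherianRing A] [Module.Finite A M] {D : ℕ}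
    (hD : Module.supportDim A M ≤ D)
    {Y Z : Submodule (reesAlgebra I) (PolynomialModule A M)} (hZ : Z.FG)
    (hI : ∀ a ∈ I, ∀ z ∈ Z, algebraMap A (reesAlgebra I) a • z ∈ Y) :
    subquotientDim Z Y ≤ D := by
  rw [Module.supportDim_eq_ringKrullDim_quotient_annihilator] at hD
  have := finite_quotient_submoduleOf (Y := Y) hZ
  refine supportDim_reesAlgebra_le _ hD _ (fun a ha => smul_quotient_eq_zero (hI a ha))
    fun f hf => smul_quotient_eq_zero fun z _ => ?_
  have : f • z = 0 := by
    ext i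
    change ((f : A[X]) • z).coeff i = 0
    rw [PolynomialModule.smul_apply]
    exact Finset.sum_eq_zero fun p _ => Module.mem_annihilator.1 (hf p.1) _
  rw [this]
  exact Y.zero_mem

section Homogeneous

variable {R : Type*} [CommRing R] [Module R M] {ℳ : ℕ → Submodule R M}
    [DirectSum.Decomposition ℳ]

variable (ℳ) in
/-- A filtration is homogeneous if all its members are homogeneous submodules. -/
def IsHomogeneousFiltration (F : I.Filtration M) : Prop :=
  ∀ i, ∀ x ∈ F.N i, ∀ n, componentMap ℳ n x ∈ F.N i

lemma IsHomogeneousFiltration.shift {F : I.Filtration M} (hF : IsHomogeneousFiltration ℳ F)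
    (j : ℕ) : IsHomogeneousFiltration ℳ (shiftFiltration F j) := fun i => hF (i + j)

lemma IsHomogeneousFiltration.inf {F E : I.Filtration M} (hF : IsHomogeneousFiltration ℳ F)
    (hE : IsHomogeneousFiltration ℳ E) : IsHomogeneousFiltration ℳ (F ⊓ E) :=
  fun i x hx n => ⟨hF i x hx.1 n, hE i x hx.2 n⟩

lemma IsHomogeneousFiltration.sup {F E : I.Filtration M} (hF : IsHomogeneousFiltration ℳ F)
    (hE : IsHomogeneousFiltration ℳ E) : IsHomogeneousFiltration ℳ (F ⊔ E) := by
  intro i x hx n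
  obtain ⟨y, hy, z, hz, rfl⟩ := Submodule.mem_sup.1 (show x ∈ F.N i ⊔ E.N i from hx)
  rw [map_add]
  exact Submodule.add_mem_sup (hF i y hy n) (hE i z hz n)

lemma isHomogeneousFiltration_stable [Algebra R A] {𝒜 : ℕ → Submodule R A}
    [SetLike.GradedSMul 𝒜 ℳ] {V : Set A} (hV : V ⊆ 𝒜 1) (hI : I = Ideal.span V)
    {N : Submodule A M} (hN : ∀ x ∈ N, ∀ n, componentMap ℳ n x ∈ N) :
    IsHomogeneousFiltration ℳ (I.stableFiltration N) := by
  intro i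
  rw [Ideal.stableFiltration_N]
  induction i with
  | zero => simpa using hN
  | succ i ih =>
    rw [pow_succ', mul_smul, hI] at *
    exact componentMap_mem_smul 𝒜 hV ih

lemma IsHomogeneousFiltration.isHomogeneous [Algebra R A] [IsScalarTower R A M]
    {G : ModuleGrading R (reesAlgebra I) (PolynomialModule A M)}
    (hG : ∀ n z, G.proj n z = coeffMap A (componentMap ℳ n) z)
    {F : I.Filtration M} (hF : IsHomogeneousFiltration ℳ F) : G.IsHomogeneous F.submodule := by
  intro z hz n i
  rw [hG, coeff_coeffMap]
  exact hF i _ (hz i) n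

end Homogeneous

section Map

variable {M' : Type*} [AddCommGroup M'] [Module A M'] {R : Type*} [CommRing R] [Algebra R A]
    [Module R M] [Module R M'] [IsScalarTower R A M] [IsScalarTower R A M']

lemma map_coeffMap_submodule (φ : M →ₗ[A] M') {F : I.Filtration M} {F' : I.Filtration M'}
    (h : ∀ i, (F.N i).map φ = F'.N i) :
    (F.submodule.restrictScalars R).map (coeffMap A (φ.restrictScalars R)) =
      F'.submodule.restrictScalars R := by
  ext z
  constructor
  · rintro ⟨w, hw, rfl⟩ i
    rw [← h i]
    exact Submodule.mem_map_of_mem (hw i)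
  · intro hz
    have h1 : ∀ i, ∃ c ∈ F.N i, φ c = z.coeff i ∧ (z.coeff i = 0 → c = 0) := by
      intro i
      by_cases h0 : z.coeff i = 0
      · exact ⟨0, Submodule.zero_mem _, by rw [map_zero, h0], fun _ => rfl⟩
      · obtain ⟨c, hc, hcz⟩ := (h i).ge (hz i)
        exact ⟨c, hc, hcz, fun h => absurd h h0⟩
    choose c hc hcz hc0 using h1
    obtain ⟨w, hw, hwc⟩ := exists_coeff_eq (F := F) c hc hc0
    refine ⟨w, hw, ?_⟩
    ext i
    rw [coeff_coeffMap, hwc]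
    exact hcz i

end Map

end Filtrations

/-! ### The induced filtration of a submodule -/

section InducedFiltration

open ModuleGrading

variable {R A : Type*} [CommRing R] [CommRing A] [Algebra R A]
    {I : Ideal A} {M : Type*} [AddCommGroup M] [Module A M] [Module R M] [IsScalarTower R A M]
    {ℳ : ℕ → Submodule R M} [DirectSum.Decomposition ℳ]
    {G : ModuleGrading R (reesAlgebra I) (PolynomialModule A M)}

/-- The map `∑ z_i t^i ↦ ∑ z_{i+1} t^i`. -/
def divX (R A M : Type*) [CommRing R] [CommRing A] [AddCommGroup M] [Module A M] [Module R M] :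
    PolynomialModule A M →ₗ[R] PolynomialModule A M :=
  (PolynomialModule.coeffLinearEquiv A R).symm.toLinearMap ∘ₗ
    Finsupp.lcomapDomain Nat.succ Nat.succ_injective ∘ₗ
      (PolynomialModule.coeffLinearEquiv A R).toLinearMap

omit [Algebra R A] [IsScalarTower R A M] in
@[simp]
lemma coeff_divX (z : PolynomialModule A M) (i : ℕ) : (divX R A M z).coeff i = z.coeff (i + 1) :=
  rfl

lemma map_divX_submodule (F : I.Filtration M) :
    (F.submodule.restrictScalars R).map (divX R A M) =
      (shiftFiltration F 1).submodule.restrictScalars R := by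
  ext z
  constructor
  · rintro ⟨w, hw, rfl⟩ i
    exact hw (i + 1)
  · intro hz
    -- the preimage of `z` is `t z`
    refine ⟨(Polynomial.X : Polynomial A) • z, fun i => ?_, ?_⟩
    · rw [← Polynomial.monomial_one_one_eq_X, PolynomialModule.monomial_smul_apply]
      split_ifs with h
      · rw [one_smul]
        have := hz (i - 1)
        change _ ∈ F.N (i - 1 + 1) at this
        rwa [Nat.sub_add_cancel h] at this
      · exact Submodule.zero_mem _
    · ext i
      rw [coeff_divX, ← Polynomial.monomial_one_one_eq_X, PolynomialModule.monomial_smul_apply,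
        if_pos (Nat.le_add_left 1 i), one_smul, Nat.add_sub_cancel]

/-- If the filtrations `F` and `E` agree in degree zero, dividing by `t` identifies their quotient
with the quotient of the shifted filtrations. -/
lemma hilb_shiftFiltration [IsLocalRing R]
    (hG : ∀ n z, G.proj n z = coeffMap A (componentMap ℳ n) z) {F E : I.Filtration M}
    (hF : IsHomogeneousFiltration ℳ F) (hE : IsHomogeneousFiltration ℳ E)
    (hEF : ∀ i, E.N i ≤ F.N i) (h0 : F.N 0 ≤ E.N 0) (s n : ℕ) :
    G.hilb F.submodule E.submodule s n =
      G.hilb (shiftFiltration F 1).submodule (shiftFiltration E 1).submodule s n := by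
  refine hilb_eq_of_map (hF.isHomogeneous hG) (hE.isHomogeneous hG) (submodule_mono hEF)
    (divX R A M) (fun n z => ?_) (map_divX_submodule F) (map_divX_submodule E)
    (fun z hz hz0 => ?_) s n
  · rw [hG, hG]
    ext i
    rfl
  · intro i
    cases i with
    | zero => exact h0 (hz 0)
    | succ i =>
      rw [← coeff_divX (R := R), hz0]
      exact Submodule.zero_mem _

variable [IsLocalRing R] [IsNoetherianRing R] [IsNoetherianRing A] [Module.Finite A M]

/-- If `F ≥ E ≥ F⁺`, where `F⁺` is the shift of `F`, the associated graded modules of `F` and `E`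
have the same Hilbert polynomial up to lower terms: these modules are extensions of `F / E` and
`E / F⁺`, and of `E / F⁺` and `F⁺ / E⁺`, and `F / E` is isomorphic to `F⁺ / E⁺`. -/
lemma growthAtMost_hilb_sub_hilb_of_le {D : ℕ} (hD : Module.supportDim A M ≤ D)
    (hG : ∀ n z, G.proj n z = coeffMap A (componentMap ℳ n) z) {F E : I.Filtration M}
    (hF : IsHomogeneousFiltration ℳ F) (hE : IsHomogeneousFiltration ℳ E)
    (hFL : ∀ i, F.N i ≤ I ^ i • ⊤)
    (hEF : ∀ i, E.N i ≤ F.N i) (hFE : ∀ i, F.N (i + 1) ≤ E.N i) (h0 : F.N 0 ≤ E.N 0) :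
    GrowthAtMost D 2 fun s n =>
      ((G.hilb F.submodule (shiftFiltration F 1).submodule s n).toNat : ℤ) -
        (G.hilb E.submodule (shiftFiltration E 1).submodule s n).toNat := by
  have hF' : (shiftFiltration F 1).submodule ≤ E.submodule := submodule_mono hFE
  have hE' : (shiftFiltration E 1).submodule ≤ (shiftFiltration F 1).submodule :=
    submodule_mono fun i => hEF (i + 1)
  have hEF' : E.submodule ≤ F.submodule := submodule_mono hEF
  have hFL' : F.submodule ≤ (I.stableFiltration (⊤ : Submodule A M)).submodule :=
    submodule_mono hFL
  have hFfg : F.submodule.FG := fg_of_le_stableFiltration hFL'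
  have hEfg : E.submodule.FG := fg_of_le_stableFiltration (hEF'.trans hFL')
  have hF'fg : (shiftFiltration F 1).submodule.FG :=
    fg_of_le_stableFiltration (hF'.trans (hEF'.trans hFL'))
  have e1 : ∀ i, I • E.N i ≤ (shiftFiltration F 1).N i :=
    fun i => (Submodule.smul_mono le_rfl (hEF i)).trans (F.smul_le i)
  have e2 : ∀ i, I • (shiftFiltration F 1).N i ≤ (shiftFiltration E 1).N i :=
    fun i => (Submodule.smul_mono le_rfl (hFE i)).trans (E.smul_le i)
  have h1 := growthAtMost_hilb_add_sub (hF.isHomogeneous hG) (hE.isHomogeneous hG) hFfg hF' hEF'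
    (subquotientDim_le hD hEfg fun a ha z hz => algebraMap_smul_mem e1 ha hz)
  have h2 := growthAtMost_hilb_add_sub (hE.isHomogeneous hG) ((hF.shift 1).isHomogeneous hG) hEfg
    hE' hF' (subquotientDim_le hD hF'fg fun a ha z hz => algebraMap_smul_mem e2 ha hz)
  refine (h2.add h1.neg).mono (n₀ := 0) fun s n _ _ => le_of_eq ?_
  rw [hilb_shiftFiltration hG hF hE hEF h0]
  congr 1
  ring

/-- The filtration induced on `N` by the `I`-adic filtration of `M` and the `I`-adic filtration of
`N` have the same Hilbert polynomial up to lower terms.  By the Artin-Rees lemma the filtrations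
`I^i N + (I^{i+j} M ∩ N)` interpolate between them in finitely many steps. -/
theorem growthAtMost_hilb_induced_sub {D : ℕ} (hD : Module.supportDim A M ≤ D)
    (hG : ∀ n z, G.proj n z = coeffMap A (componentMap ℳ n) z) (N : Submodule A M)
    (hL : IsHomogeneousFiltration ℳ (I.stableFiltration (⊤ : Submodule A M)))
    (hE : IsHomogeneousFiltration ℳ (I.stableFiltration N)) :
    GrowthAtMost D 2 fun s n =>
      ((G.hilb (I.stableFiltration ⊤ ⊓ I.trivialFiltration N).submodule
        (shiftFiltration (I.stableFiltration ⊤ ⊓ I.trivialFiltration N) 1).submodule s n).toNat : ℤ)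
      - (G.hilb (I.stableFiltration N).submodule
        (shiftFiltration (I.stableFiltration N) 1).submodule s n).toNat := by
  set E := I.stableFiltration N with hEdef
  set F := I.stableFiltration ⊤ ⊓ I.trivialFiltration N with hFdef
  have hFN : ∀ i, F.N i = I ^ i • (⊤ : Submodule A M) ⊓ N := fun i => rfl
  have hEN : ∀ i, E.N i = I ^ i • N := fun i => rfl
  have hN : ∀ x ∈ N, ∀ n, componentMap ℳ n x ∈ N := by
    have := hE 0
    rwa [hEN, pow_zero, Ideal.one_eq_top, Submodule.top_smul] at this
  have hF : IsHomogeneousFiltration ℳ F := hL.inf fun i => hN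
  have hEF : ∀ i, E.N i ≤ F.N i := fun i =>
    le_inf (Submodule.smul_mono le_rfl le_top) Submodule.smul_le_right
  have hE0 : ∀ i, F.N i ≤ E.N 0 := by
    intro i
    rw [hEN, pow_zero, Ideal.one_eq_top, Submodule.top_smul]
    exact inf_le_right
  obtain ⟨c, hc⟩ := I.exists_pow_inf_eq_pow_smul N
  have hcE : ∀ i, F.N (i + c) ≤ E.N i := by
    intro i
    rw [hFN, hc (i + c) (Nat.le_add_left c i), Nat.add_sub_cancel]
    exact Submodule.smul_mono le_rfl inf_le_right
  have hNj : ∀ j i, (E ⊔ shiftFiltration F j).N i = E.N i ⊔ F.N (i + j) := fun j i => rfl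
  have key : ∀ j, GrowthAtMost D 2 fun s n =>
      ((G.hilb F.submodule (shiftFiltration F 1).submodule s n).toNat : ℤ) -
        (G.hilb (E ⊔ shiftFiltration F j).submodule
          (shiftFiltration (E ⊔ shiftFiltration F j) 1).submodule s n).toNat := by
    intro j
    induction j with
    | zero =>
      have : E ⊔ shiftFiltration F 0 = F := by
        refine Ideal.Filtration.ext (funext fun i => ?_)
        rw [hNj]
        exact sup_eq_right.2 (hEF i)
      rw [this]
      exact ⟨0, 0, fun s n _ _ => by simp⟩
    | succ j ih =>
      have hle : ∀ i, (E ⊔ shiftFiltration F j).N i ≤ I ^ i • ⊤ := fun i =>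
        sup_le ((hEF i).trans inf_le_left) ((F.antitone (Nat.le_add_right i j)).trans inf_le_left)
      have hle₁ : ∀ i, (E ⊔ shiftFiltration F (j + 1)).N i ≤ (E ⊔ shiftFiltration F j).N i := by
        intro i
        rw [hNj, hNj]
        exact sup_le_sup_left (F.antitone (by omega)) _
      have hle₂ : ∀ i, (E ⊔ shiftFiltration F j).N (i + 1) ≤
          (E ⊔ shiftFiltration F (j + 1)).N i := by
        intro i
        rw [hNj, hNj]
        exact sup_le_sup (E.antitone (Nat.le_succ i)) (F.antitone (by omega))
      have hle₀ : (E ⊔ shiftFiltration F j).N 0 ≤ (E ⊔ shiftFiltration F (j + 1)).N 0 := by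
        rw [hNj, hNj]
        exact sup_le le_sup_left ((hE0 _).trans le_sup_left)
      have hstep := growthAtMost_hilb_sub_hilb_of_le hD hG (hE.sup (hF.shift j))
        (hE.sup (hF.shift (j + 1))) hle hle₁ hle₂ hle₀
      refine (ih.add hstep).mono (n₀ := 0) fun s n _ _ => le_of_eq ?_
      congr 1
      ring
  have : E ⊔ shiftFiltration F c = E := by
    refine Ideal.Filtration.ext (funext fun i => ?_)
    rw [hNj]
    exact sup_eq_left.2 (hcE i)
  have hfinal := key c
  rwa [this] at hfinal

/-- Additivity of the Hilbert function of the associated graded module for a submodule `N` of `M`,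
where `G_I(M / N)` appears as the quotient of `G_I(M)` by the associated graded module of the
filtration induced on `N`. -/
theorem growthAtMost_hilb_stableFiltration {D : ℕ} (hD : Module.supportDim A M ≤ D)
    (hG : ∀ n z, G.proj n z = coeffMap A (componentMap ℳ n) z) (N : Submodule A M)
    (hL : IsHomogeneousFiltration ℳ (I.stableFiltration (⊤ : Submodule A M)))
    (hE : IsHomogeneousFiltration ℳ (I.stableFiltration N)) :
    GrowthAtMost D 2 fun s n =>
      ((G.hilb (I.stableFiltration N).submodule
        (shiftFiltration (I.stableFiltration N) 1).submodule s n).toNat : ℤ) +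
      (G.hilb (I.stableFiltration ⊤).submodule
        ((I.stableFiltration ⊤ ⊓ I.trivialFiltration N).submodule ⊔
          (shiftFiltration (I.stableFiltration (⊤ : Submodule A M)) 1).submodule) s n).toNat -
      (G.hilb (I.stableFiltration ⊤).submodule
        (shiftFiltration (I.stableFiltration (⊤ : Submodule A M)) 1).submodule s n).toNat := by
  have hind := growthAtMost_hilb_induced_sub hD hG N hL hE
  set L := I.stableFiltration (⊤ : Submodule A M) with hLdef
  set F := L ⊓ I.trivialFiltration N with hFdef
  have hN : ∀ x ∈ N, ∀ n, componentMap ℳ n x ∈ N := by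
    have := hE 0
    rwa [Ideal.stableFiltration_N, pow_zero, Ideal.one_eq_top, Submodule.top_smul] at this
  have hF : IsHomogeneousFiltration ℳ F := hL.inf fun i => hN
  have hFL : F.submodule ≤ L.submodule := submodule_mono fun i => inf_le_left
  have hL' : (shiftFiltration L 1).submodule ≤ L.submodule := submodule_mono L.mono
  have hZL : F.submodule ⊔ (shiftFiltration L 1).submodule ≤ L.submodule := sup_le hFL hL'
  have e : ∀ i, I • L.N i ≤ (shiftFiltration L 1).N i := L.smul_le
  have hadd := growthAtMost_hilb_add_sub (hL.isHomogeneous hG)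
    ((hF.isHomogeneous hG).sup ((hL.shift 1).isHomogeneous hG)) (fg_of_le_stableFiltration le_rfl)
    le_sup_right hZL (subquotientDim_le hD (fg_of_le_stableFiltration hZL) fun a ha z hz =>
      algebraMap_smul_mem e ha (hZL hz))
  have hinf : F.submodule ⊓ (shiftFiltration L 1).submodule = (shiftFiltration F 1).submodule := by
    ext z
    constructor
    · rintro ⟨h1, h2⟩ i
      exact ⟨h2 i, (h1 i).2⟩
    · intro h
      exact ⟨fun i => ⟨L.mono i (h i).1, (h i).2⟩, fun i => (h i).1⟩
  refine (hadd.add hind.neg).mono (n₀ := 0) fun s n _ _ => le_of_eq ?_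
  rw [hilb_sup_eq_hilb_inf (hF.isHomogeneous hG) ((hL.shift 1).isHomogeneous hG), hinf]
  congr 1
  ring

end InducedFiltration

/-! ### The Hilbert function of the associated graded module -/

section AssociatedGradedHilbert

open IsLocalRing ModuleGrading

section SumTransform

variable {R : Type*} [CommRing R] [IsLocalRing R] {N : Type*} [AddCommGroup N] [Module R N]

/-- The sum transform of the Hilbert function of `G_𝔪(N)` is the length of `N_n / 𝔪^{s+1} N_n`. -/
lemma sumTransform_hilbertFunction (𝒩 : ℕ → Submodule R N) (s n : ℕ) :
    sumTransform (hilbertFunction 𝒩) s n = qlen (𝒩 n) (maximalIdeal R ^ (s + 1) • 𝒩 n) := by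
  have h : ∀ u, hilbertFunction 𝒩 u n =
      qlen (maximalIdeal R ^ u • 𝒩 n) (maximalIdeal R ^ (u + 1) • 𝒩 n) := fun u => rfl
  induction s with
  | zero => simp [sumTransform, h]
  | succ s ih =>
    rw [sumTransform, Finset.sum_range_succ, ← sumTransform, ih, h]
    exact (qlen_add (Submodule.smul_mono_left (Ideal.pow_le_pow_right (Nat.le_succ _)))
      Submodule.smul_le_right).symm

end SumTransform

variable {R A : Type*} [CommRing R] [CommRing A] [Algebra R A]
    {I : Ideal A} {M : Type*} [AddCommGroup M] [Module A M] [Module R M] [IsScalarTower R A M]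

variable (R I M) in
/-- The inclusion of the Rees module in `M[t]`. -/
def reesVal : ReesModule I M →ₗ[R] PolynomialModule A M :=
  ((I.stableFiltration (⊤ : Submodule A M)).submodule.restrictScalars R).subtype

lemma reesVal_injective : Function.Injective (reesVal R I M) := Subtype.val_injective

lemma reesVal_smul (f : reesAlgebra I) (x : ReesModule I M) :
    reesVal R I M (f • x) = f • reesVal R I M x := rfl

lemma range_reesVal : LinearMap.range (reesVal R I M) =
    (I.stableFiltration (⊤ : Submodule A M)).submodule.restrictScalars R :=
  Submodule.range_subtype _

/-- The elements of the extension of `I` times the Rees module are those whose `i`-th coefficients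
lie in `I^{i+1} M`. -/
lemma mem_reesExtension_smul_top_iff (x : ReesModule I M) :
    x ∈ reesExtension I • (⊤ : Submodule (reesAlgebra I) (ReesModule I M)) ↔
      reesVal R I M x ∈ (shiftFiltration (I.stableFiltration (⊤ : Submodule A M)) 1).submodule := by
  constructor
  · intro hx
    induction hx using Submodule.smul_induction_on' with
    | add x _ y _ hx hy => rw [map_add]; exact Submodule.add_mem _ hx hy
    | smul f hf y _ =>
      change f ∈ Submodule.span _ _ at hf
      induction hf using Submodule.span_induction generalizing y with
      | mem f hf =>
        obtain ⟨a, ha, rfl⟩ := hf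
        have e : ∀ i, I • (I.stableFiltration (⊤ : Submodule A M)).N i ≤
            (shiftFiltration (I.stableFiltration (⊤ : Submodule A M)) 1).N i :=
          (I.stableFiltration (⊤ : Submodule A M)).smul_le
        rw [reesVal_smul]
        exact algebraMap_smul_mem e ha y.2
      | zero => rw [zero_smul, map_zero]; exact Submodule.zero_mem _
      | add f g _ _ hf hg =>
        rw [add_smul, map_add]
        exact Submodule.add_mem _ (hf y trivial) (hg y trivial)
      | smul f g _ hg =>
        rw [smul_assoc, reesVal_smul]
        exact Submodule.smul_mem _ _ (hg y trivial)
  · intro hx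
    have key : ∀ i, ∀ m ∈ I • (I ^ i • (⊤ : Submodule A M)),
        ∃ y ∈ reesExtension I • (⊤ : Submodule (reesAlgebra I) (ReesModule I M)),
          reesVal R I M y = PolynomialModule.single A i m := by
      intro i m hm
      induction hm using Submodule.smul_induction_on' with
      | add m _ m' _ h h' =>
        obtain ⟨y, hy, hym⟩ := h
        obtain ⟨y', hy', hym'⟩ := h'
        exact ⟨y + y', Submodule.add_mem _ hy hy', by
          rw [map_add, hym, hym', PolynomialModule.single_add]⟩
      | smul a ha m hm =>
        let z : ReesModule I M := ⟨PolynomialModule.single A i m, fun j => by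
          rw [PolynomialModule.coeff_single, Finsupp.single_apply]
          split_ifs with h
          · subst h
            exact hm
          · exact Submodule.zero_mem _⟩
        refine ⟨algebraMap A (reesAlgebra I) a • z,
          Submodule.smul_mem_smul (Ideal.mem_map_of_mem _ ha) trivial, ?_⟩
        rw [reesVal_smul]
        change algebraMap A (reesAlgebra I) a • PolynomialModule.single A i m = _
        rw [algebraMap_smul, PolynomialModule.single_smul]
    have h1 : ∀ i, ∃ y ∈ reesExtension I • (⊤ : Submodule (reesAlgebra I) (ReesModule I M)),
        reesVal R I M y = PolynomialModule.single A i ((reesVal R I M x).coeff i) := by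
      intro i
      refine key i _ ?_
      have := hx i
      change _ ∈ I ^ (i + 1) • (⊤ : Submodule A M) at this
      rwa [pow_succ', mul_smul] at this
    choose y hy hyx using h1
    have h2 : x = ∑ i ∈ (reesVal R I M x).coeff.support, y i := by
      refine reesVal_injective (R := R) ?_
      rw [map_sum, Finset.sum_congr rfl fun i _ => hyx i]
      ext i
      rw [PolynomialModule.coeff_sum, Finsupp.finsetSum_apply]
      simp only [PolynomialModule.coeff_single, Finsupp.single_apply, Finset.sum_ite_eq']
      split_ifs with h
      · rfl
      · exact Finsupp.notMem_support_iff.1 h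
    rw [h2]
    exact Submodule.sum_mem _ fun i _ => hy i

variable {ℳ : ℕ → Submodule R M} [DirectSum.Decomposition ℳ]
    {G : ModuleGrading R (reesAlgebra I) (PolynomialModule A M)}

lemma mem_piece_submodule_iff (hG : ∀ n z, G.proj n z = coeffMap A (componentMap ℳ n) z)
    {F : I.Filtration M} (hF : IsHomogeneousFiltration ℳ F) {n : ℕ} {z : PolynomialModule A M} :
    z ∈ G.piece F.submodule n ↔ z ∈ F.submodule ∧ ∀ i, z.coeff i ∈ ℳ n := by
  rw [mem_piece_iff (hF.isHomogeneous hG), hG]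
  refine and_congr_right fun _ => ⟨fun h i => ?_, fun h => ?_⟩
  · rw [← h, coeff_coeffMap]
    exact componentMap_mem _ _
  · ext i
    rw [coeff_coeffMap, componentMap_of_mem (h i), if_pos rfl]

/-- The function `hilb`, for the Rees module of `M` and its submodule of the polynomials with `i`-th
coefficients in `I^{i+1} M`, is the sum transform of `h^*`. -/
lemma sumTransform_hStar [IsLocalRing R]
    (hG : ∀ n z, G.proj n z = coeffMap A (componentMap ℳ n) z)
    (hL : IsHomogeneousFiltration ℳ (I.stableFiltration (⊤ : Submodule A M))) (s n : ℕ) :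
    sumTransform (hStar I ℳ) s n = G.hilb (I.stableFiltration (⊤ : Submodule A M)).submodule
      (shiftFiltration (I.stableFiltration (⊤ : Submodule A M)) 1).submodule s n := by
  rw [hStar, sumTransform_hilbertFunction, internalPiece, ← Submodule.map_smul'']
  set π : ReesModule I M →ₗ[R] AssocGradedModule I M :=
    (reesExtension I • (⊤ : Submodule (reesAlgebra I) (ReesModule I M))).mkQ.restrictScalars R
  set Q := reesInternalPiece I ℳ n
  set B := maximalIdeal R ^ (s + 1) • Q with hB
  have hBQ : B ≤ Q := Submodule.smul_le_right
  have hker : LinearMap.ker π = ((shiftFiltration (I.stableFiltration (⊤ : Submodule A M))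
      1).submodule.restrictScalars R).comap (reesVal R I M) := by
    ext x
    rw [LinearMap.mem_ker, Submodule.mem_comap, Submodule.restrictScalars_mem,
      ← mem_reesExtension_smul_top_iff]
    exact Submodule.Quotient.mk_eq_zero _
  have h1 : qlen (Q.map π) (B.map π) = qlen Q (B ⊔ LinearMap.ker π ⊓ Q) := by
    rw [← sup_eq_left.2 (Submodule.map_mono (f := π) hBQ), ← qlen_map π, Submodule.comap_map_eq]
    refine qlen_congr ?_
    rw [sup_inf_assoc_of_le (LinearMap.ker π) hBQ, inf_eq_left.2 (sup_le hBQ inf_le_right)]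
  have hQ : Q.map (reesVal R I M) =
      G.piece (I.stableFiltration (⊤ : Submodule A M)).submodule n := by
    ext z
    rw [mem_piece_submodule_iff hG hL]
    constructor
    · rintro ⟨x, hx, rfl⟩
      exact ⟨x.2, hx⟩
    · rintro ⟨h1, h2⟩
      exact ⟨⟨z, h1⟩, h2, rfl⟩
  have hK : (LinearMap.ker π ⊓ Q).map (reesVal R I M) =
      G.piece (shiftFiltration (I.stableFiltration (⊤ : Submodule A M)) 1).submodule n := by
    ext z
    rw [hker, mem_piece_submodule_iff hG (hL.shift 1)]
    constructor
    · rintro ⟨x, ⟨hx1, hx2⟩, rfl⟩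
      exact ⟨hx1, hx2⟩
    · rintro ⟨h1, h2⟩
      exact ⟨⟨z, submodule_mono (I.stableFiltration (⊤ : Submodule A M)).mono h1⟩, ⟨h1, h2⟩, rfl⟩
  rw [h1, ← qlen_map_of_injective (reesVal R I M) reesVal_injective, Submodule.map_sup, hK, hB,
    Submodule.map_smul'', hQ]
  rfl

/-- A quotient of a module embedded in `P` has at least the dimension of the corresponding
subquotient of `P`. -/
lemma subquotientDim_le_supportDim {S P X' : Type*} [CommRing S] [AddCommGroup P] [Module S P]
    [AddCommGroup X'] [Module S X'] (ι : X' →ₗ[S] P) (K : Submodule S X') {X Y : Submodule S P}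
    (hX : LinearMap.range ι = X) (hK : ∀ x ∈ K, ι x ∈ Y) :
    subquotientDim X Y ≤ Module.supportDim S (X' ⧸ K) := by
  subst hX
  refine Module.supportDim_le_of_surjective
    (K.mapQ (Y.submoduleOf (LinearMap.range ι)) ι.rangeRestrict hK) fun w => ?_
  obtain ⟨w, rfl⟩ := Submodule.Quotient.mk_surjective _ w
  obtain ⟨x, rfl⟩ := ι.surjective_rangeRestrict w
  exact ⟨Submodule.Quotient.mk x, rfl⟩

lemma le_natCast_sub_one_of_lt {x : WithBot ℕ∞} {D : ℕ} (h : x < D) : x ≤ (D - 1 : ℕ) := by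
  cases x with
  | bot => exact bot_le
  | coe d =>
    have h' : d < (D : ℕ∞) := by exact_mod_cast h
    obtain ⟨m, rfl⟩ := ENat.ne_top_iff_exists.1 (ne_top_of_lt h')
    have h'' : m < D := by exact_mod_cast h'
    exact WithBot.coe_le_coe.2 (Nat.cast_le.2 (Nat.le_sub_one_of_lt h''))

/-- The dimension of a finite module over `S / J` does not increase when it is viewed as a module
over `S`. -/
lemma supportDim_le_supportDim_quotient {S N : Type*} [CommRing S] (J : Ideal S) [AddCommGroup N]
    [Module S N] [Module (S ⧸ J) N] [Module.Finite S N]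
    (hsmul : ∀ (r : S) (z : N), Ideal.Quotient.mk J r • z = r • z) :
    Module.supportDim S N ≤ Module.supportDim (S ⧸ J) N := by
  have : IsScalarTower S (S ⧸ J) N := ⟨fun r x z => by
    obtain ⟨x, rfl⟩ := Ideal.Quotient.mk_surjective x
    rw [hsmul, ← mul_smul, ← hsmul]
    rfl⟩
  have : Module.Finite (S ⧸ J) N := Module.Finite.of_restrictScalars_finite S (S ⧸ J) N
  rw [Module.supportDim_eq_ringKrullDim_quotient_annihilator,
    Module.supportDim_eq_ringKrullDim_quotient_annihilator]
  have hJ : ∀ r ∈ J, Ideal.Quotient.mk (Module.annihilator S N) r = 0 := by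
    intro r hr
    rw [Ideal.Quotient.eq_zero_iff_mem, Module.mem_annihilator]
    intro z
    rw [← hsmul, Ideal.Quotient.eq_zero_iff_mem.2 hr, zero_smul]
  refine ringKrullDim_le_of_surjective (Ideal.Quotient.lift (Module.annihilator (S ⧸ J) N)
    (Ideal.Quotient.lift J (Ideal.Quotient.mk _) hJ) ?_)
    (Ideal.Quotient.lift_surjective_of_surjective _ _
      (Ideal.Quotient.lift_surjective_of_surjective _ _ Ideal.Quotient.mk_surjective))
  intro r hr
  obtain ⟨r, rfl⟩ := Ideal.Quotient.mk_surjective r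
  rw [Ideal.Quotient.lift_mk, Ideal.Quotient.eq_zero_iff_mem, Module.mem_annihilator]
  intro z
  rw [← hsmul]
  exact Module.mem_annihilator.1 hr z

variable [IsLocalRing R] [IsNoetherianRing R] [IsNoetherianRing A] [Module.Finite A M]

/-- The Hilbert polynomial of the associated graded module and its `c^*`-multiplicities. -/
theorem exists_isHilbertPolynomial_hStar {D : ℕ} (hD : Module.supportDim A M ≤ D)
    (hG : ∀ n z, G.proj n z = coeffMap A (componentMap ℳ n) z)
    (hL : IsHomogeneousFiltration ℳ (I.stableFiltration (⊤ : Submodule A M))) :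
    ∃ a n₀, SupportedBelow D 1 a ∧
      (∀ s n, n₀ ≤ s → n₀ ≤ n →
        ((G.hilb (I.stableFiltration (⊤ : Submodule A M)).submodule
          (shiftFiltration (I.stableFiltration (⊤ : Submodule A M)) 1).submodule s n).toNat : ℤ) =
            binomialEval a s n) ∧
      IsHilbertPolynomial (sumTransform (hStar I ℳ)) (binomialPolynomial a) ∧
      ∀ k, k < D → cStar I ℳ D k = a (k, D - k - 1) := by
  have hfg : (I.stableFiltration (⊤ : Submodule A M)).submodule.FG :=
    fg_of_le_stableFiltration le_rfl
  have hLn := isNoetherian_of_fg_of_noetherian _ hfg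
  have hle : (shiftFiltration (I.stableFiltration (⊤ : Submodule A M)) 1).submodule ≤
      (I.stableFiltration (⊤ : Submodule A M)).submodule :=
    submodule_mono (I.stableFiltration (⊤ : Submodule A M)).mono
  have e : ∀ i, I • (I.stableFiltration (⊤ : Submodule A M)).N i ≤
      (shiftFiltration (I.stableFiltration (⊤ : Submodule A M)) 1).N i :=
    (I.stableFiltration (⊤ : Submodule A M)).smul_le
  have hhom := hL.isHomogeneous hG
  obtain ⟨a, n₀, ha⟩ := exists_hilb_eq_binomialEval hhom hfg hle
  have hpoly : IsHilbertPolynomial (sumTransform (hStar I ℳ)) (binomialPolynomial a) := by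
    refine isHilbertPolynomial_binomialPolynomial_iff.2 ⟨n₀, fun s n hs hn => ⟨_, ?_, ha s n hs hn⟩⟩
    rw [sumTransform_hStar hG hL, ENat.natCast_toNat (hilb_ne_top hhom hle s n)]
  refine ⟨a, n₀, supportedBelow_of_subquotientDim_le hhom hfg hle
    (subquotientDim_le hD hfg fun x hx z hz => algebraMap_smul_mem e hx hz) ha, ha, hpoly,
    fun k hk => ?_⟩
  rw [cStar, cMultiplicity]
  split_ifs with hdim
  -- If the dimension of `G_I(M)` is at most `D - 1`, the polynomial has degree less than `D - 1`.
  · have : Module.Finite (reesAlgebra I) (ReesModule I M) := Module.Finite.iff_fg.2 hfg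
    let ι : ReesModule I M →ₗ[reesAlgebra I] PolynomialModule A M :=
      { reesVal R I M with map_smul' := reesVal_smul }
    have hι : LinearMap.range ι = (I.stableFiltration (⊤ : Submodule A M)).submodule :=
      Submodule.restrictScalars_injective R _ _ (range_reesVal (R := R))
    have hsupp := supportedBelow_of_subquotientDim_le hhom hfg hle
      ((subquotientDim_le_supportDim ι
        (reesExtension I • (⊤ : Submodule (reesAlgebra I) (ReesModule I M))) hι
        fun x hx => (mem_reesExtension_smul_top_iff (R := R) x).1 hx).trans
        ((supportDim_le_supportDim_quotient (reesExtension I) fun _ _ => rfl).trans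
          (le_natCast_sub_one_of_lt hdim))) ha
    by_contra h
    have := hsupp (k, D - k - 1) (Finsupp.mem_support_iff.2 (Ne.symm h))
    dsimp only at this
    omega
  · exact hilbertCoeff_eq hpoly k (D - k - 1)

end AssociatedGradedHilbert

/-! ### Additivity -/

section Exact

open ModuleGrading

variable {R A : Type*} [CommRing R] [CommRing A] [Algebra R A] {I : Ideal A}
    {M : Type*} [AddCommGroup M] [Module A M] [Module R M] [IsScalarTower R A M]
    {ℳ : ℕ → Submodule R M} [DirectSum.Decomposition ℳ]
    {G : ModuleGrading R (reesAlgebra I) (PolynomialModule A M)}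
    {M' : Type*} [AddCommGroup M'] [Module A M'] [Module R M'] [IsScalarTower R A M']
    {ℳ' : ℕ → Submodule R M'} [DirectSum.Decomposition ℳ']
    {G' : ModuleGrading R (reesAlgebra I) (PolynomialModule A M')}

lemma coeffMap_proj (hG : ∀ n z, G.proj n z = coeffMap A (componentMap ℳ n) z)
    (hG' : ∀ n z, G'.proj n z = coeffMap A (componentMap ℳ' n) z) (φ : M →ₗ[A] M')
    (hφ : ∀ n, ∀ x ∈ ℳ n, φ x ∈ ℳ' n) (n : ℕ) (z : PolynomialModule A M) :
    coeffMap A (φ.restrictScalars R) (G.proj n z) =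
      G'.proj n (coeffMap A (φ.restrictScalars R) z) := by
  rw [hG, hG']
  ext i
  exact (componentMap_comm (ℳ := ℳ) (ℳ' := ℳ') (k := 0) φ.toAddMonoidHom hφ n (z.coeff i)).symm

variable [IsLocalRing R]

/-- An injective map identifies the associated graded module of `M` with the one of its image. -/
lemma hilb_stableFiltration_of_injective
    (hG : ∀ n z, G.proj n z = coeffMap A (componentMap ℳ n) z)
    (hG' : ∀ n z, G'.proj n z = coeffMap A (componentMap ℳ' n) z)
    (hL : IsHomogeneousFiltration ℳ (I.stableFiltration (⊤ : Submodule A M)))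
    (f : M →ₗ[A] M') (hf : ∀ n, ∀ x ∈ ℳ n, f x ∈ ℳ' n) (hf_inj : Function.Injective f) (s n : ℕ) :
    G.hilb (I.stableFiltration (⊤ : Submodule A M)).submodule
        (shiftFiltration (I.stableFiltration (⊤ : Submodule A M)) 1).submodule s n =
      G'.hilb (I.stableFiltration (LinearMap.range f)).submodule
        (shiftFiltration (I.stableFiltration (LinearMap.range f)) 1).submodule s n := by
  have hmap : ∀ i, ((I.stableFiltration (⊤ : Submodule A M)).N i).map f =
      (I.stableFiltration (LinearMap.range f)).N i := by
    intro i
    rw [Ideal.stableFiltration_N, Ideal.stableFiltration_N, Submodule.map_smul'', Submodule.map_top]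
  have hmap' : ∀ i, ((shiftFiltration (I.stableFiltration (⊤ : Submodule A M)) 1).N i).map f =
      (shiftFiltration (I.stableFiltration (LinearMap.range f)) 1).N i := fun i => hmap (i + 1)
  refine hilb_eq_of_map (hL.isHomogeneous hG) ((hL.shift 1).isHomogeneous hG)
    (submodule_mono (I.stableFiltration (⊤ : Submodule A M)).mono)
    (coeffMap A (f.restrictScalars R)) (coeffMap_proj hG hG' f hf) (map_coeffMap_submodule f hmap)
    (map_coeffMap_submodule f hmap') (fun z _ hz => ?_) s n
  have : z = 0 := by
    ext i
    refine hf_inj ?_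
    rw [PolynomialModule.coeff_zero, Finsupp.zero_apply, map_zero]
    exact DFunLike.congr_fun (congrArg PolynomialModule.coeff hz) i
  rw [this]
  exact Submodule.zero_mem _

/-- The associated graded module of a quotient of `M` by `N` is a quotient of the one of `M`, by the
classes of elements of the filtration induced on `N`. -/
lemma hilb_stableFiltration_of_surjective
    (hG : ∀ n z, G.proj n z = coeffMap A (componentMap ℳ n) z)
    (hG' : ∀ n z, G'.proj n z = coeffMap A (componentMap ℳ' n) z)
    (hL : IsHomogeneousFiltration ℳ (I.stableFiltration (⊤ : Submodule A M)))
    (g : M →ₗ[A] M') (hg : ∀ n, ∀ x ∈ ℳ n, g x ∈ ℳ' n) (hg_surj : Function.Surjective g)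
    {N : Submodule A M} (hN : ∀ x, x ∈ N ↔ g x = 0)
    (hNh : ∀ x ∈ N, ∀ n, componentMap ℳ n x ∈ N) (s n : ℕ) :
    G.hilb (I.stableFiltration (⊤ : Submodule A M)).submodule
        ((I.stableFiltration ⊤ ⊓ I.trivialFiltration N).submodule ⊔
          (shiftFiltration (I.stableFiltration (⊤ : Submodule A M)) 1).submodule) s n =
      G'.hilb (I.stableFiltration (⊤ : Submodule A M')).submodule
        (shiftFiltration (I.stableFiltration (⊤ : Submodule A M')) 1).submodule s n := by
  have hmap : ∀ i, ((I.stableFiltration (⊤ : Submodule A M)).N i).map g =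
      (I.stableFiltration (⊤ : Submodule A M')).N i := by
    intro i
    rw [Ideal.stableFiltration_N, Ideal.stableFiltration_N, Submodule.map_smul'', Submodule.map_top,
      LinearMap.range_eq_top.2 hg_surj]
  have hmap' : ∀ i, ((shiftFiltration (I.stableFiltration (⊤ : Submodule A M)) 1).N i).map g =
      (shiftFiltration (I.stableFiltration (⊤ : Submodule A M')) 1).N i := fun i => hmap (i + 1)
  have hF : IsHomogeneousFiltration ℳ (I.stableFiltration ⊤ ⊓ I.trivialFiltration N) :=
    hL.inf fun _ => hNh
  refine hilb_eq_of_map (hL.isHomogeneous hG)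
    ((hF.isHomogeneous hG).sup ((hL.shift 1).isHomogeneous hG))
    (sup_le (submodule_mono fun i => inf_le_left)
      (submodule_mono (I.stableFiltration (⊤ : Submodule A M)).mono))
    (coeffMap A (g.restrictScalars R)) (coeffMap_proj hG hG' g hg) (map_coeffMap_submodule g hmap)
    ?_ (fun z hz hz0 => ?_) s n
  · rw [Submodule.restrictScalars_sup, Submodule.map_sup, map_coeffMap_submodule g hmap',
      sup_eq_right]
    rintro _ ⟨z, hz, rfl⟩
    have : coeffMap A (g.restrictScalars R) z = 0 := by
      ext i
      exact (hN _).1 (hz i).2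
    rw [this]
    exact Submodule.zero_mem _
  · refine Submodule.mem_sup_left fun i => ⟨hz i, (hN _).2 ?_⟩
    exact DFunLike.congr_fun (congrArg PolynomialModule.coeff hz0) i

end Exact

end LinearFormMultiplicity

end

open LinearFormMultiplicity in
theorem theorem3p1
    {R : Type*} [CommRing R] [IsLocalRing R] [IsNoetherianRing R]
    {A : Type*} [CommRing A] [Algebra R A] [IsNoetherianRing A]
    (𝒜 : ℕ → Submodule R A) [GradedAlgebra 𝒜] (h𝒜 : IsStandardGraded R 𝒜)
    (I : Ideal A) (hI : IsGeneratedByLinearForms 𝒜 I)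
    {M₀ : Type*} [AddCommGroup M₀] [Module A M₀] [Module R M₀] [IsScalarTower R A M₀]
    [Module.Finite A M₀]
    (ℳ₀ : ℕ → Submodule R M₀) [DirectSum.Decomposition ℳ₀] [SetLike.GradedSMul 𝒜 ℳ₀]
    {M₁ : Type*} [AddCommGroup M₁] [Module A M₁] [Module R M₁] [IsScalarTower R A M₁]
    [Module.Finite A M₁]
    (ℳ₁ : ℕ → Submodule R M₁) [DirectSum.Decomposition ℳ₁] [SetLike.GradedSMul 𝒜 ℳ₁]
    {M₂ : Type*} [AddCommGroup M₂] [Module A M₂] [Module R M₂] [IsScalarTower R A M₂]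
    [Module.Finite A M₂]
    (ℳ₂ : ℕ → Submodule R M₂) [DirectSum.Decomposition ℳ₂] [SetLike.GradedSMul 𝒜 ℳ₂]
    (f : M₀ →ₗ[A] M₁) (g : M₁ →ₗ[A] M₂)
    (hf : ∀ n, ∀ x ∈ ℳ₀ n, f x ∈ ℳ₁ n) (hg : ∀ n, ∀ x ∈ ℳ₁ n, g x ∈ ℳ₂ n)
    (hf_inj : Function.Injective f) (hfg : Function.Exact f g) (hg_surj : Function.Surjective g)
    (D : ℕ) (hD : Module.supportDim A M₁ ≤ (D : WithBot ℕ∞)) :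
    (∃ a₀ a₁ a₂ : ℕ × ℕ →₀ ℤ,
      (∀ p ∈ a₀.support, p.1 + p.2 + 1 ≤ D) ∧
      (∀ p ∈ a₁.support, p.1 + p.2 + 1 ≤ D) ∧
      (∀ p ∈ a₂.support, p.1 + p.2 + 1 ≤ D) ∧
      IsHilbertPolynomial (sumTransform (hStar I ℳ₀)) (binomialPolynomial a₀) ∧
      IsHilbertPolynomial (sumTransform (hStar I ℳ₁)) (binomialPolynomial a₁) ∧
      IsHilbertPolynomial (sumTransform (hStar I ℳ₂)) (binomialPolynomial a₂) ∧
      HasDegreeAtMost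
        (binomialPolynomial a₀ + binomialPolynomial a₂ - binomialPolynomial a₁)
        ((D : ℤ) - 2)) ∧
    ∀ k : ℕ, k < D → cStar I ℳ₁ D k = cStar I ℳ₀ D k + cStar I ℳ₂ D k := by
  obtain ⟨T, hT1, hT⟩ := h𝒜.exists_finset_adjoin_eq_top
  obtain ⟨V, hV1, hV⟩ := hI.exists_finset
  let G₀ := reesGrading 𝒜 hT hT1 hV hV1 ℳ₀
  let G₁ := reesGrading 𝒜 hT hT1 hV hV1 ℳ₁
  let G₂ := reesGrading 𝒜 hT hT1 hV hV1 ℳ₂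
  have hG₀ : ∀ n z, G₀.proj n z = coeffMap A (componentMap ℳ₀ n) z := fun _ _ => rfl
  have hG₁ : ∀ n z, G₁.proj n z = coeffMap A (componentMap ℳ₁ n) z := fun _ _ => rfl
  have hG₂ : ∀ n z, G₂.proj n z = coeffMap A (componentMap ℳ₂ n) z := fun _ _ => rfl
  have hL₀ : IsHomogeneousFiltration ℳ₀ (I.stableFiltration (⊤ : Submodule A M₀)) :=
    isHomogeneousFiltration_stable hV1 hV fun _ _ _ => trivial
  have hL₁ : IsHomogeneousFiltration ℳ₁ (I.stableFiltration (⊤ : Submodule A M₁)) :=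
    isHomogeneousFiltration_stable hV1 hV fun _ _ _ => trivial
  have hL₂ : IsHomogeneousFiltration ℳ₂ (I.stableFiltration (⊤ : Submodule A M₂)) :=
    isHomogeneousFiltration_stable hV1 hV fun _ _ _ => trivial
  have hrange : ∀ x ∈ LinearMap.range f, ∀ n, componentMap ℳ₁ n x ∈ LinearMap.range f := by
    rintro _ ⟨x, rfl⟩ n
    exact ⟨componentMap ℳ₀ n x, (componentMap_comm (ℳ := ℳ₀) (ℳ' := ℳ₁) (k := 0)
      f.toAddMonoidHom hf n x).symm⟩
  obtain ⟨a₀, n₀, hs₀, ha₀, hp₀, hc₀⟩ := exists_isHilbertPolynomial_hStar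
    ((Module.supportDim_le_of_injective f hf_inj).trans hD) hG₀ hL₀
  obtain ⟨a₁, n₁, hs₁, ha₁, hp₁, hc₁⟩ := exists_isHilbertPolynomial_hStar hD hG₁ hL₁
  obtain ⟨a₂, n₂, hs₂, ha₂, hp₂, hc₂⟩ := exists_isHilbertPolynomial_hStar
    ((Module.supportDim_le_of_surjective g hg_surj).trans hD) hG₂ hL₂
  have hgrowth := growthAtMost_hilb_stableFiltration hD hG₁ (LinearMap.range f) hL₁
    (isHomogeneousFiltration_stable hV1 hV hrange)
  have hsub : SupportedBelow D 2 (a₀ + a₂ - a₁) := by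
    refine (hgrowth.mono (n₀ := max n₀ (max n₁ n₂)) fun s n hs hn => le_of_eq ?_).supportedBelow
    rw [binomialEval_sub, binomialEval_add, ← ha₀ s n (by omega) (by omega),
      ← ha₁ s n (by omega) (by omega), ← ha₂ s n (by omega) (by omega),
      hilb_stableFiltration_of_injective hG₀ hG₁ hL₀ f hf hf_inj,
      hilb_stableFiltration_of_surjective hG₁ hG₂ hL₁ g hg hg_surj
        (fun x => (hfg x).symm) hrange]
  refine ⟨⟨a₀, a₁, a₂, hs₀, hs₁, hs₂, hp₀, hp₁, hp₂, ?_⟩, fun k hk => ?_⟩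
  · have h : binomialPolynomial a₀ + binomialPolynomial a₂ - binomialPolynomial a₁ =
        binomialPolynomial (a₀ + a₂ - a₁) := by
      rw [← binomialPolynomial_add, sub_eq_iff_eq_add, ← binomialPolynomial_add, sub_add_cancel]
    rw [h]
    exact hasDegreeAtMost_binomialPolynomial hsub
  · rw [hc₀ k hk, hc₁ k hk, hc₂ k hk]
    have h : (a₀ + a₂ - a₁) (k, D - k - 1) = 0 := by
      by_contra h
      have := hsub _ (Finsupp.mem_support_iff.2 h)
      dsimp only at this
      omega
    rw [Finsupp.sub_apply, Finsupp.add_apply, sub_eq_zero] at h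
    exact h.symm
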